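/- Let $d\ge 2$, $\hbar>0$, $r>0$, and let $\tilde E(d+1)=\mathrm{Spin}(d+1)\ltimes\mathbb R^{d+1}$ be the universal covering group of the Euclidean group. Let $U$ be an irreducible (strongly continuous) unitary representation of $\tilde E(d+1)$ on a complex Hilbert space $H$. On the space $H^\infty$ of smooth vectors let $X_k$ and $J_{kl}=-J_{lk}$ ($1\le k,l\le d+1$) be $i\hbar$ times the derived representation on the generators of the translations along $e_k$ and of the rotations in the $(k,l)$-plane, so that $$\tfrac1{i\hbar}[X_k,X_l]=0,\quad \tfrac1{i\hbar}[X_k,J_{lm}]=\delta_{kl}X_m-\delta_{km}X_l,\quad \tfrac1{i\hbar}[J_{kl},J_{mn}]=\delta_{kn}J_{lm}+\delta_{lm}J_{kn}-\delta_{km}J_{ln}-\delta_{ln}J_{km}.$$ Assume $X^2:=\sum_m X_m^2=r^2 I$ on $H^\infty$. The little group $\mathrm{Spin}(d)$ is the stabilizer of $e_{d+1}$ in $\mathrm{Spin}(d+1)$. It acts on the space of generalized position eigenvectors at $r e_{d+1}$, that is, of the distribution vectors $\psi$ (continuous conjugate-linear functionals on $H^\infty$ with its Fréchet topology) such that $X_k\psi=0$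 for $k\le d$ and $X_{d+1}\psi=r\psi$. Put $$W_{kl}=X^2J_{kl}-\sum_m J_{km}X_mX_l+\sum_m J_{lm}X_mX_k,\qquad C=\sum_{k<l}W_{kl}^2 .$$ Then: 1. The little group acts trivially on this space if and only if $X^2J_{kl}=\sum_m\bigl(J_{km}X_mX_l-J_{lm}X_mX_k\bigr)$ on $H^\infty$ for all $k,l$. 2. $C$ is a Casimir: the element of the universal enveloping algebra of the complexified Lie algebra of $\tilde E(d+1)$ given by the same formula is central; and on $H^\infty$ the operator $C$ equals $cI$ for a real constant $c$. 3. Each $W_{kl}$ is self-adjoint: $H^\infty$ is dense, $W_{kl}$ is symmetric on $H^\infty$, and its closure is a self-adjoint operator on $H$. 4. $C=0$ if and only if the little group acts trivially. -/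

import Mathlib

noncomputable section

namespace EuclideanCover

/-! ### The spin group and the covering group of the Euclidean group -/

/-- The quadratic form `v ↦ ‖v‖ ^ 2` on `ℝⁿ`. -/
def normForm (n : ℕ) : QuadraticForm ℝ (EuclideanSpace ℝ (Fin n)) :=
  LinearMap.BilinMap.toQuadraticMap (innerₗ (EuclideanSpace ℝ (Fin n)))

theorem normForm_apply {n : ℕ} (v : EuclideanSpace ℝ (Fin n)) :
    normForm n v = inner ℝ v v := rfl

/-- The real Clifford algebra of `ℝⁿ` (it satisfies `v * v = ‖v‖ ^ 2`). -/
abbrev Cl (n : ℕ) : Type := CliffordAlgebra (normForm n)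

/-- The inclusion of vectors in the Clifford algebra. -/
abbrev vec {n : ℕ} : EuclideanSpace ℝ (Fin n) →ₗ[ℝ] Cl n := CliffordAlgebra.ι (normForm n)

/-- The group `Spin(n)`. -/
abbrev Spin (n : ℕ) : Type := spinGroup (normForm n)

/-- The usual topology of the finite-dimensional real vector space `Cl n`; `Spin n` carries the
subspace topology. -/
instance instTopCl (n : ℕ) : TopologicalSpace (Cl n) := moduleTopology ℝ (Cl n)

instance instModTopCl (n : ℕ) : IsModuleTopology ℝ (Cl n) := ⟨rfl⟩

theorem vec_injective {n : ℕ} : Function.Injective (vec (n := n)) := by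
  rw [injective_iff_map_eq_zero]
  intro v hv
  have h := CliffordAlgebra.ι_sq_scalar (normForm n) v
  rw [hv, zero_mul] at h
  have h2 : normForm n v = 0 := by
    have := (algebraMap ℝ (Cl n)).injective (h.symm.trans (map_zero _).symm)
    exact this
  rw [normForm_apply] at h2
  exact inner_self_eq_zero.1 h2

theorem exists_spin_rot {n : ℕ} (s : Spin n) (v : EuclideanSpace ℝ (Fin n)) :
    ∃ w, vec w = (s : Cl n) * vec v * ((s⁻¹ : Spin n) : Cl n) := by
  have hs : ((spinGroup.toUnits s : (Cl n)ˣ) : Cl n) ∈ spinGroup (normForm n) := s.2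
  have := spinGroup.conjAct_smul_ι_mem_range_ι hs v
  rw [ConjAct.units_smul_def, ConjAct.ofConjAct_toConjAct] at this
  obtain ⟨w, hw⟩ := this
  exact ⟨w, hw⟩

/-- The rotation of `ℝⁿ` by `s ∈ Spin(n)`: the vector `w` with `w = s v s⁻¹` in `Cl n`. -/
def spinRot {n : ℕ} (s : Spin n) (v : EuclideanSpace ℝ (Fin n)) : EuclideanSpace ℝ (Fin n) :=
  (exists_spin_rot s v).choose

theorem vec_spinRot {n : ℕ} (s : Spin n) (v : EuclideanSpace ℝ (Fin n)) :
    vec (spinRot s v) = (s : Cl n) * vec v * ((s⁻¹ : Spin n) : Cl n) :=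
  (exists_spin_rot s v).choose_spec

theorem spinRot_one {n : ℕ} (v : EuclideanSpace ℝ (Fin n)) : spinRot (1 : Spin n) v = v := by
  apply vec_injective
  rw [vec_spinRot]
  simp

theorem spinRot_mul {n : ℕ} (s t : Spin n) (v : EuclideanSpace ℝ (Fin n)) :
    spinRot (s * t) v = spinRot s (spinRot t v) := by
  apply vec_injective
  rw [vec_spinRot, vec_spinRot, vec_spinRot, mul_inv_rev]
  simp [mul_assoc]

theorem spinRot_add {n : ℕ} (s : Spin n) (v w : EuclideanSpace ℝ (Fin n)) :
    spinRot s (v + w) = spinRot s v + spinRot s w := by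
  apply vec_injective
  rw [map_add, vec_spinRot, vec_spinRot, vec_spinRot, map_add, mul_add, add_mul]

/-- The action of `Spin(n)` on the additive group `ℝⁿ` by rotations. -/
def spinAut (n : ℕ) : Spin n →* MulAut (Multiplicative (EuclideanSpace ℝ (Fin n))) where
  toFun s :=
    { toFun := fun v => Multiplicative.ofAdd (spinRot s v.toAdd)
      invFun := fun v => Multiplicative.ofAdd (spinRot s⁻¹ v.toAdd)
      left_inv := fun v => by simp [← spinRot_mul, spinRot_one]
      right_inv := fun v => by simp [← spinRot_mul, spinRot_one]
      map_mul' := fun v w => by simp [spinRot_add] }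
  map_one' := by ext v : 1; simp [spinRot_one]
  map_mul' s t := by ext v : 1; simp [spinRot_mul]

/-- The group `Spin(n) ⋉ ℝⁿ`, with normal factor `ℝⁿ`. For `n ≥ 3` it is the connected and simply
connected covering group of the Euclidean group `SO(n) ⋉ ℝⁿ`. -/
abbrev EucCover (n : ℕ) : Type :=
  Multiplicative (EuclideanSpace ℝ (Fin n)) ⋊[spinAut n] Spin n

/-- The product topology. -/
instance instTopEucCover (n : ℕ) : TopologicalSpace (EucCover n) :=
  TopologicalSpace.induced (fun g => (g.left.toAdd, g.right))
    (inferInstance : TopologicalSpace (EuclideanSpace ℝ (Fin n) × Spin n))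

instance instFiniteCl (n : ℕ) : Module.Finite ℝ (Cl n) :=
  Module.Finite.equiv
    ((CliffordAlgebra.equivExterior (normForm n)).trans
      ((EuclideanSpace.basisFun (Fin n) ℝ).toBasis.ExteriorAlgebra).equivFun).symm

instance instTopRingCl (n : ℕ) : IsTopologicalRing (Cl n) :=
  IsModuleTopology.isTopologicalRing ℝ (Cl n)

theorem continuous_spin_inv {n : ℕ} : Continuous fun s : Spin n => s⁻¹ := by
  refine Continuous.subtype_mk ?_ _
  have h : Continuous fun x : Cl n => CliffordAlgebra.reverse
      ((CliffordAlgebra.involute (Q := normForm n)).toLinearMap x) :=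
    IsModuleTopology.continuous_of_linearMap (R := ℝ)
      (CliffordAlgebra.reverse ∘ₗ (CliffordAlgebra.involute (Q := normForm n)).toLinearMap)
  exact h.comp continuous_subtype_val

theorem continuous_spinRot {n : ℕ} :
    Continuous fun p : Spin n × EuclideanSpace ℝ (Fin n) => spinRot p.1 p.2 := by
  obtain ⟨P, hP⟩ := LinearMap.exists_leftInverse_of_injective (vec (n := n))
    (LinearMap.ker_eq_bot.2 vec_injective)
  have e : (fun p : Spin n × EuclideanSpace ℝ (Fin n) => spinRot p.1 p.2)
      = fun p => P ((p.1 : Cl n) * vec p.2 * ((p.1⁻¹ : Spin n) : Cl n)) := by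
    funext p
    rw [← vec_spinRot]
    exact (LinearMap.congr_fun hP _).symm
  rw [e]
  have hPc : Continuous P := IsModuleTopology.continuous_of_linearMap (R := ℝ) P
  have hv : Continuous (vec (n := n)) := LinearMap.continuous_of_finiteDimensional _
  exact hPc.comp (((continuous_subtype_val.comp continuous_fst).mul
    (hv.comp continuous_snd)).mul
    (continuous_subtype_val.comp (continuous_spin_inv.comp continuous_fst)))

instance instContMulSpin (n : ℕ) : ContinuousMul (Spin n) :=
  ⟨Continuous.subtype_mk ((continuous_subtype_val.comp continuous_fst).mul
    (continuous_subtype_val.comp continuous_snd)) _⟩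

theorem continuous_left {n : ℕ} : Continuous fun g : EucCover n => g.left.toAdd :=
  continuous_fst.comp (continuous_induced_dom
    (f := fun g : EucCover n => (g.left.toAdd, g.right)))

theorem continuous_right {n : ℕ} : Continuous fun g : EucCover n => g.right :=
  continuous_snd.comp (continuous_induced_dom
    (f := fun g : EucCover n => (g.left.toAdd, g.right)))

theorem continuous_to_cover {n : ℕ} {Y : Type*} [TopologicalSpace Y] {f : Y → EucCover n}
    (h1 : Continuous fun y => (f y).left.toAdd) (h2 : Continuous fun y => (f y).right) :
    Continuous f :=
  continuous_induced_rng.2 (h1.prodMk h2)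

instance instTopGroupEucCover (n : ℕ) : IsTopologicalGroup (EucCover n) where
  continuous_mul := by
    refine continuous_to_cover ?_ ?_
    · have h : Continuous fun p : EucCover n × EucCover n =>
          p.1.left.toAdd + spinRot p.1.right p.2.left.toAdd :=
        (continuous_left.comp continuous_fst).add (continuous_spinRot.comp
          ((continuous_right.comp continuous_fst).prodMk (continuous_left.comp continuous_snd)))
      exact h
    · have h : Continuous fun p : EucCover n × EucCover n => p.1.right * p.2.right :=
        (continuous_right.comp continuous_fst).mul (continuous_right.comp continuous_snd)
      exact h
  continuous_inv := by
    refine continuous_to_cover ?_ ?_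
    · have h1 : Continuous fun p : EucCover n => p.right⁻¹ :=
        continuous_spin_inv.comp continuous_right
      have h2 : Continuous fun p : EucCover n => -p.left.toAdd := continuous_left.neg
      have h := continuous_spinRot.comp (h1.prodMk h2)
      refine h.congr fun p => ?_
      rw [SemidirectProduct.inv_left]
      rfl
    · have h : Continuous fun p : EucCover n => p.right⁻¹ :=
        continuous_spin_inv.comp continuous_right
      exact h

/-- The inclusion of `Spin(n)`. -/
def inSpin {n : ℕ} : Spin n →* EucCover n := SemidirectProduct.inr

/-- The little group of the last basis vector `e`: its stabilizer in `Spin(d + 1)`. -/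
def littleGroup (d : ℕ) : Subgroup (Spin (d + 1)) where
  carrier := {s | spinRot s (EuclideanSpace.single (Fin.last d) 1)
    = EuclideanSpace.single (Fin.last d) 1}
  one_mem' := spinRot_one _
  mul_mem' := fun {s t} hs ht => by
    simp only [Set.mem_ofPred_eq] at *
    rw [spinRot_mul, ht, hs]
  inv_mem' := fun {s} hs => by
    simp only [Set.mem_ofPred_eq] at *
    conv_lhs => rw [← hs]
    rw [← spinRot_mul, inv_mul_cancel, spinRot_one]

/-! ### One-parameter subgroups -/

/-- A one-parameter subgroup, that is, an element of the Lie algebra. -/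
abbrev OneParam (G : Type*) [Group G] [TopologicalSpace G] : Type _ := Multiplicative ℝ →ₜ* G

/-- The translations `t ↦ t e_k`. -/
def transParam {n : ℕ} (k : Fin n) : OneParam (EucCover n) where
  toFun t := SemidirectProduct.inl (Multiplicative.ofAdd (t.toAdd • EuclideanSpace.single k 1))
  map_one' := by simp
  map_mul' s t := by simp [add_smul]
  continuous_toFun := by
    refine continuous_to_cover ?_ continuous_const
    exact continuous_toAdd.smul (continuous_const (y := (EuclideanSpace.single k (1 : ℝ))))

/-- The basis vector `e_k` in the Clifford algebra. -/
def gen {n : ℕ} (k : Fin n) : Cl n := vec (EuclideanSpace.single k 1)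

theorem gen_sq {n : ℕ} (k : Fin n) : gen k * gen k = 1 := by
  rw [gen, CliffordAlgebra.ι_sq_scalar, normForm_apply]
  simp

theorem inner_single_ne {n : ℕ} {k l : Fin n} (h : k ≠ l) :
    inner ℝ (EuclideanSpace.single k (1 : ℝ)) (EuclideanSpace.single l (1 : ℝ)) = 0 := by
  rw [EuclideanSpace.inner_single_left]
  simp [h]

theorem gen_anticomm {n : ℕ} {k l : Fin n} (h : k ≠ l) : gen k * gen l = -(gen l * gen k) := by
  apply CliffordAlgebra.ι_mul_ι_comm_of_isOrtho
  rw [QuadraticMap.isOrtho_def, normForm_apply, normForm_apply, normForm_apply]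
  rw [inner_add_left, inner_add_right, inner_add_right, inner_single_ne h, inner_single_ne h.symm]
  ring

theorem bivec_sq {n : ℕ} {k l : Fin n} (h : k ≠ l) :
    (gen k * gen l) * (gen k * gen l) = -1 := by
  rw [gen_anticomm h, neg_mul_neg, mul_assoc, ← mul_assoc (gen k) (gen l), gen_anticomm h,
    neg_mul, mul_neg, ← mul_assoc, ← mul_assoc, gen_sq, one_mul, gen_sq]

/-- `exp ((t / 2) e_k e_l)` for `k ≠ l`. -/
def rotor {n : ℕ} (k l : Fin n) (t : ℝ) : Cl n :=
  Real.cos (t / 2) • (1 : Cl n) + Real.sin (t / 2) • (gen k * gen l)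

theorem rotor_add {n : ℕ} {k l : Fin n} (h : k ≠ l) (s t : ℝ) :
    rotor k l (s + t) = rotor k l s * rotor k l t := by
  simp only [rotor, add_div, Real.cos_add, Real.sin_add, mul_add, add_mul, smul_mul_smul_comm,
    one_mul, mul_one, bivec_sq h]
  module

theorem rotor_zero {n : ℕ} (k l : Fin n) : rotor k l 0 = 1 := by simp [rotor]

theorem star_rotor {n : ℕ} {k l : Fin n} (h : k ≠ l) (t : ℝ) :
    star (rotor k l t) = rotor k l (-t) := by
  have h1 : star (gen k * gen l) = -(gen k * gen l) := by
    rw [star_mul, gen, gen, CliffordAlgebra.star_ι, CliffordAlgebra.star_ι, neg_mul_neg]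
    exact gen_anticomm h.symm
  simp only [rotor, star_add, CliffordAlgebra.star_smul, star_one, h1, neg_div, Real.cos_neg,
    Real.sin_neg, smul_neg, neg_smul]

theorem rotor_mem {n : ℕ} {k l : Fin n} (h : k ≠ l) (t : ℝ) :
    rotor k l t ∈ spinGroup (normForm n) := by
  have e1 : rotor k l t = gen k * vec (Real.cos (t / 2) • EuclideanSpace.single k 1
      + Real.sin (t / 2) • EuclideanSpace.single l 1) := by
    rw [map_add, map_smul, map_smul, mul_add, mul_smul_comm, mul_smul_comm, ← gen, ← gen, gen_sq]
    rfl
  refine ⟨⟨?_, ?_, ?_⟩, ?_⟩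
  · have hq : (vec (Real.cos (t / 2) • EuclideanSpace.single k 1
        + Real.sin (t / 2) • EuclideanSpace.single l 1) : Cl n)
        * vec (Real.cos (t / 2) • EuclideanSpace.single k 1
        + Real.sin (t / 2) • EuclideanSpace.single l 1) = 1 := by
      rw [CliffordAlgebra.ι_sq_scalar, normForm_apply]
      simp only [inner_add_left, inner_add_right, inner_smul_left, inner_smul_right,
        inner_single_ne h, inner_single_ne h.symm]
      rw [← map_one (algebraMap ℝ (Cl n))]
      congr 1
      simp [← sq]
    refine ⟨⟨gen k, gen k, gen_sq k, gen_sq k⟩ * ⟨_, _, hq, hq⟩, ?_, ?_⟩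
    · exact mul_mem (Subgroup.subset_closure ⟨_, rfl⟩) (Subgroup.subset_closure ⟨_, rfl⟩)
    · simp [e1]
  · rw [star_rotor h, ← rotor_add h]; simp [rotor_zero]
  · rw [star_rotor h, ← rotor_add h]; simp [rotor_zero]
  · have : rotor k l t ∈ CliffordAlgebra.evenOdd (normForm n) 0 := by
      rw [e1]
      exact CliffordAlgebra.ι_mul_ι_mem_evenOdd_zero _ _ _
    exact this

/-- The lift of the rotations in the `(k, l)`-plane, with infinitesimal generator
`E_{kl} - E_{lk}`, so that `e_l ↦ e_k` and `e_k ↦ -e_l`; it is trivial for `k = l`. -/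
def rotParam {n : ℕ} (k l : Fin n) : OneParam (EucCover n) :=
  if h : k = l then 1 else
    { toFun := fun t => inSpin ⟨rotor k l t.toAdd, rotor_mem h _⟩
      map_one' := by
        rw [← map_one inSpin]
        congr 1
        exact Subtype.ext (rotor_zero k l)
      map_mul' := fun s t => by
        rw [← map_mul inSpin]
        congr 1
        exact Subtype.ext (rotor_add h _ _)
      continuous_toFun := by
        refine continuous_to_cover continuous_const ?_
        have h2 : Continuous fun t : Multiplicative ℝ => t.toAdd / 2 :=
          continuous_toAdd.div_const 2
        have h3 : Continuous fun t : Multiplicative ℝ => (rotor k l t.toAdd : Cl n) :=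
          ((Real.continuous_cos.comp h2).smul (continuous_const (y := (1 : Cl n)))).add
            ((Real.continuous_sin.comp h2).smul (continuous_const (y := (gen k * gen l : Cl n))))
        exact h3.subtype_mk fun t => rotor_mem h t.toAdd }

/-! ### Unitary representations, smooth vectors and distribution vectors -/

/-- Strongly continuous unitary representations of `G` on `H`. -/
structure UnitaryRep (G : Type*) [Group G] [TopologicalSpace G]
    (H : Type*) [NormedAddCommGroup H] [InnerProductSpace ℂ H] [CompleteSpace H] where
  /-- The underlying homomorphism to the unitary group of `H`. -/
  toHom : G →* unitary (H →L[ℂ] H)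
  strongly_continuous : ∀ v : H, Continuous fun g => (toHom g : H →L[ℂ] H) v

namespace UnitaryRep

variable {G : Type*} [Group G] [TopologicalSpace G]
  {H : Type*} [NormedAddCommGroup H] [InnerProductSpace ℂ H] [CompleteSpace H]

/-- The operator by which `g` acts. -/
def op (U : UnitaryRep G H) (g : G) : H →L[ℂ] H := (U.toHom g : H →L[ℂ] H)

/-- `H ≠ 0`, and the only closed invariant subspaces are `0` and `H`. -/
def IsIrreducible (U : UnitaryRep G H) : Prop :=
  Nontrivial H ∧ ∀ S : Submodule ℂ H, IsClosed (S : Set H) →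
    (∀ g, ∀ v ∈ S, U.op g v ∈ S) → S = ⊥ ∨ S = ⊤

/-- The vectors which can be differentiated `m` times in succession along arbitrary one-parameter
subgroups. -/
def smoothLevel (U : UnitaryRep G H) : ℕ → Submodule ℂ H
  | 0 => ⊤
  | m + 1 =>
    { carrier := {v | ∀ φ : OneParam G, ∃ w ∈ smoothLevel U m,
        HasDerivAt (fun t : ℝ => U.op (φ (Multiplicative.ofAdd t)) v) w 0}
      zero_mem' := fun φ => ⟨0, zero_mem _, by simpa using hasDerivAt_const (0 : ℝ) (0 : H)⟩
      add_mem' := fun {v w} hv hw φ => by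
        obtain ⟨v', hv', hv⟩ := hv φ
        obtain ⟨w', hw', hw⟩ := hw φ
        exact ⟨v' + w', add_mem hv' hw', by simpa [Pi.add_def] using hv.add hw⟩
      smul_mem' := fun c v hv φ => by
        obtain ⟨v', hv', hv⟩ := hv φ
        exact ⟨c • v', Submodule.smul_mem _ c hv', by simpa [Pi.smul_def] using hv.const_smul c⟩ }

/-- The space of smooth vectors: all iterated derivatives along one-parameter subgroups exist. For a
Lie group these are the vectors `v` such that `g ↦ U(g) v` is of class `C ^ ∞`. -/
def smooth (U : UnitaryRep G H) : Submodule ℂ H := ⨅ m, U.smoothLevel m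

theorem exists_deriv (U : UnitaryRep G H) (φ : OneParam G) (v : U.smooth) :
    ∃ w : U.smooth, HasDerivAt (fun t : ℝ => U.op (φ (Multiplicative.ofAdd t)) (v : H)) (w : H) 0 :=
  by
  have hv : ∀ m, (v : H) ∈ U.smoothLevel m := (Submodule.mem_iInf _).1 v.2
  obtain ⟨w, -, hw⟩ := hv 1 φ
  refine ⟨⟨w, (Submodule.mem_iInf _).2 fun m => ?_⟩, hw⟩
  obtain ⟨w', hw', h'⟩ := hv (m + 1) φ
  rwa [hw.unique h']

/-- The derived representation on smooth vectors: `dU(φ) v = d/dt U(φ(t)) v` at `t = 0`. -/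
def dRep (U : UnitaryRep G H) (φ : OneParam G) : Module.End ℂ U.smooth where
  toFun v := (U.exists_deriv φ v).choose
  map_add' v w := by
    apply Subtype.ext
    have h1 := (U.exists_deriv φ v).choose_spec
    have h2 := (U.exists_deriv φ w).choose_spec
    have h3 := (U.exists_deriv φ (v + w)).choose_spec
    refine h3.unique ?_
    simpa [Pi.add_def] using h1.add h2
  map_smul' c v := by
    apply Subtype.ext
    have h1 := (U.exists_deriv φ v).choose_spec
    have h3 := (U.exists_deriv φ (c • v)).choose_spec
    refine h3.unique ?_
    simpa [Pi.smul_def] using h1.const_smul c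

theorem dRep_hasDerivAt (U : UnitaryRep G H) (φ : OneParam G) (v : U.smooth) :
    HasDerivAt (fun t : ℝ => U.op (φ (Multiplicative.ofAdd t)) (v : H)) (U.dRep φ v : H) 0 :=
  (U.exists_deriv φ v).choose_spec

theorem op_mem_smooth [IsTopologicalGroup G] (U : UnitaryRep G H) (g : G) {v : H}
    (hv : v ∈ U.smooth) : U.op g v ∈ U.smooth := by
  have op_mul : ∀ (a b : G) (v : H), U.op (a * b) v = U.op a (U.op b v) := fun a b v => by
    simp [op, map_mul]
  have key : ∀ m, ∀ v ∈ U.smoothLevel m, U.op g v ∈ U.smoothLevel m := by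
    intro m
    induction m with
    | zero => intro v _; exact Submodule.mem_top
    | succ m ih =>
      intro v hv φ
      let ψ : OneParam G :=
        { toFun := fun t => g⁻¹ * φ t * g
          map_one' := by simp
          map_mul' := fun s t => by simp [mul_assoc]
          continuous_toFun := by fun_prop }
      obtain ⟨w, hw, h⟩ := hv ψ
      refine ⟨U.op g w, ih w hw, ?_⟩
      have h2 := ((U.op g).restrictScalars ℝ).hasFDerivAt.comp_hasDerivAt (0 : ℝ) h
      refine HasDerivAt.congr_of_eventuallyEq h2 (Filter.Eventually.of_forall fun t => ?_)
      change U.op (φ _) (U.op g v) = U.op g (U.op (g⁻¹ * φ _ * g) v)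
      rw [← op_mul, ← op_mul]
      congr 2
      group
  exact (Submodule.mem_iInf _).2 fun m => key m v ((Submodule.mem_iInf _).1 hv m)

/-- The action of `g` on smooth vectors. -/
def smoothOp [IsTopologicalGroup G] (U : UnitaryRep G H) (g : G) : Module.End ℂ U.smooth :=
  (U.op g : H →ₗ[ℂ] H).restrict fun _ hv => U.op_mem_smooth g hv

/-- A distribution vector: a conjugate-linear functional `v ↦ ⟨v|ψ⟩` on the smooth vectors which is
continuous for the Fréchet topology given by the seminorms
`v ↦ ‖dU(φ₁) ⋯ dU(φ_m) v‖`. -/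
def IsDistribution (U : UnitaryRep G H) (ψ : U.smooth →ₗ⋆[ℂ] ℂ) : Prop :=
  ∃ (S : Finset (List (OneParam G))) (C : ℝ), ∀ v : U.smooth,
    ‖ψ v‖ ≤ C * ∑ L ∈ S, ‖(((L.map U.dRep).prod v : U.smooth) : H)‖

end UnitaryRep

/-! ### Position and angular momentum operators -/

section Algebra

variable {A : Type*} [Ring A] {n : ℕ}

/-- `X² = ∑ X_m X_m`. -/
def sqX (X : Fin n → A) : A := ∑ m, X m * X m

/-- `W_{kl} = X² J_{kl} - J_{km} X_m X_l + J_{lm} X_m X_k` (summed over `m`). -/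
def opW (X : Fin n → A) (J : Fin n → Fin n → A) (k l : Fin n) : A :=
  sqX X * J k l - (∑ m, J k m * X m * X l) + ∑ m, J l m * X m * X k

/-- `C = ∑_{k < l} W_{kl} ²`. -/
def opC (X : Fin n → A) (J : Fin n → Fin n → A) : A :=
  ∑ k, ∑ l ∈ Finset.Ioi k, opW X J k l ^ 2

end Algebra

section Physics

variable {d : ℕ} {H : Type*} [NormedAddCommGroup H] [InnerProductSpace ℂ H] [CompleteSpace H]

/-- The position operators `X_k = i ħ dU(t ↦ t e_k)`. -/
def posOp (ħ : ℝ) (U : UnitaryRep (EucCover (d + 1)) H) (k : Fin (d + 1)) :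
    Module.End ℂ U.smooth :=
  (Complex.I * (ħ : ℂ)) • U.dRep (transParam k)

/-- The angular momentum operators `J_{kl}`: `i ħ` times the derived representation on the
rotations in the `(k, l)`-plane. With these conventions
`[X_k, J_{lm}] = i ħ (δ_{kl} X_m - δ_{km} X_l)`. -/
def angOp (ħ : ℝ) (U : UnitaryRep (EucCover (d + 1)) H) (k l : Fin (d + 1)) :
    Module.End ℂ U.smooth :=
  (Complex.I * (ħ : ℂ)) • U.dRep (rotParam k l)

/-- `ψ` is a generalized position eigenvector at the point `r e` of the sphere, where `e` is the
last basis vector: `X_k ψ = 0` for the first `d` indices `k`, and `X_{d+1} ψ = r ψ`. Here `X_k` acts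
on distribution vectors by `⟨v|X_k ψ⟩ = ⟨X_k v|ψ⟩`. -/
def IsPosEigenvector (ħ r : ℝ) (U : UnitaryRep (EucCover (d + 1)) H)
    (ψ : U.smooth →ₗ⋆[ℂ] ℂ) : Prop :=
  U.IsDistribution ψ ∧
    ∀ k v, ψ (posOp ħ U k v) = (if k = Fin.last d then (r : ℂ) else 0) * ψ v

/-- The little group acts on the space of generalized position eigenvectors at `r e` by
`⟨v|s ψ⟩ = ⟨U(s)⁻¹ v|ψ⟩`; this says that the action is trivial. -/
def LittleGroupTrivial (ħ r : ℝ) (U : UnitaryRep (EucCover (d + 1)) H) : Prop :=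
  ∀ s ∈ littleGroup d, ∀ ψ : U.smooth →ₗ⋆[ℂ] ℂ, IsPosEigenvector ħ r U ψ →
    ∀ v, ψ (U.smoothOp (inSpin s)⁻¹ v) = ψ v

/-- An operator on the smooth vectors as a densely defined operator in `H`. -/
def toPMap (U : UnitaryRep (EucCover (d + 1)) H) (T : Module.End ℂ U.smooth) : H →ₗ.[ℂ] H where
  domain := U.smooth
  toFun := U.smooth.subtype ∘ₗ T

/-- Self-adjointness of an operator given on the smooth vectors: it is symmetric there, and its
closure is a self-adjoint operator in `H`. -/
def IsSelfAdjointOp (U : UnitaryRep (EucCover (d + 1)) H) (T : Module.End ℂ U.smooth) : Prop :=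
  Dense (U.smooth : Set H) ∧
    (∀ v w : U.smooth, inner ℂ ((T v : U.smooth) : H) (w : H) = inner ℂ (v : H) (T w : H)) ∧
    IsSelfAdjoint (toPMap U T).closure

end Physics

/-! ### The universal enveloping algebra of the Euclidean Lie algebra -/

section Enveloping

attribute [local instance 100] LieRing.ofAssociativeRing

/-- The complexified Euclidean Lie algebra `so(n) ⋉ ℝⁿ`, as the Lie algebra of block matrices
`(A v; 0 0)` with `A` skew-symmetric. -/
def eucLie (n : ℕ) : LieSubalgebra ℂ (Matrix (Fin n ⊕ Unit) (Fin n ⊕ Unit) ℂ) where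
  carrier := {M | ∃ (A : Matrix (Fin n) (Fin n) ℂ) (v : Matrix (Fin n) Unit ℂ),
    A.transpose = -A ∧ M = Matrix.fromBlocks A v 0 0}
  zero_mem' := ⟨0, 0, by simp, Matrix.fromBlocks_zero.symm⟩
  add_mem' := by
    rintro _ _ ⟨A, v, hA, rfl⟩ ⟨B, w, hB, rfl⟩
    refine ⟨A + B, v + w, ?_, by simp [Matrix.fromBlocks_add]⟩
    rw [Matrix.transpose_add, hA, hB, neg_add]
  smul_mem' := by
    rintro c _ ⟨A, v, hA, rfl⟩
    refine ⟨c • A, c • v, ?_, by simp [Matrix.fromBlocks_smul]⟩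
    rw [Matrix.transpose_smul, hA, smul_neg]
  lie_mem' := by
    rintro _ _ ⟨A, v, hA, rfl⟩ ⟨B, w, hB, rfl⟩
    refine ⟨A * B - B * A, A * w - B * v, ?_, ?_⟩
    · rw [Matrix.transpose_sub, Matrix.transpose_mul, Matrix.transpose_mul, hA, hB,
        neg_mul_neg, neg_mul_neg, neg_sub]
    · rw [LieRing.of_associative_ring_bracket, Matrix.fromBlocks_multiply,
        Matrix.fromBlocks_multiply]
      ext (i | i) (j | j) <;> simp

/-- The generator of the translations in the direction `e_k`. -/
def lieTrans {n : ℕ} (k : Fin n) : eucLie n :=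
  ⟨Matrix.fromBlocks 0 (Matrix.single k () 1) 0 0, 0, _, by simp, rfl⟩

/-- The generator `E_{kl} - E_{lk}` of the rotations in the `(k, l)`-plane. -/
def lieRot {n : ℕ} (k l : Fin n) : eucLie n :=
  ⟨Matrix.fromBlocks (Matrix.single k l 1 - Matrix.single l k 1) 0 0 0, _, 0, by
    simp [Matrix.transpose_sub], rfl⟩

/-- The universal enveloping algebra of the complexified Euclidean Lie algebra. -/
def EucUEA (n : ℕ) : Type := UniversalEnvelopingAlgebra ℂ (eucLie n)

instance instRingEucUEA (n : ℕ) : Ring (EucUEA n) :=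
  inferInstanceAs (Ring (UniversalEnvelopingAlgebra ℂ (eucLie n)))

instance instAlgebraEucUEA (n : ℕ) : Algebra ℂ (EucUEA n) :=
  inferInstanceAs (Algebra ℂ (UniversalEnvelopingAlgebra ℂ (eucLie n)))

/-- `X_k` as an element of the universal enveloping algebra. -/
def ueaX (ħ : ℝ) {n : ℕ} (k : Fin n) : EucUEA n :=
  (Complex.I * (ħ : ℂ)) • (UniversalEnvelopingAlgebra.ι ℂ (lieTrans k) :
    UniversalEnvelopingAlgebra ℂ (eucLie n))

/-- `J_{kl}` as an element of the universal enveloping algebra. -/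
def ueaJ (ħ : ℝ) {n : ℕ} (k l : Fin n) : EucUEA n :=
  (Complex.I * (ħ : ℂ)) • (UniversalEnvelopingAlgebra.ι ℂ (lieRot k l) :
    UniversalEnvelopingAlgebra ℂ (eucLie n))

end Enveloping

end EuclideanCover

end

open EuclideanCover

noncomputable section

namespace EuclideanCover

open MeasureTheory Topology
open scoped ContDiff

/-! ### Differentiability of one-parameter groups in a Banach algebra -/

section LinearOneParam

variable {𝒜 : Type*} [NormedRing 𝒜] [NormedAlgebra ℝ 𝒜] [CompleteSpace 𝒜]

/-! Up to the factor r², W is the part of the angular momentum tangent to the little group: against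
an eigenvector at the pole r e it keeps the J_kl with k, l ≤ d, which span the Lie algebra of the
little group, and loses all others (`IsPosEigenvector.apply_opW`). The constraint of the theorem is
W_kl = 0 rewritten, so everything rests on the chain: all W_kl = 0 ⇔ C = 0 ⇔ the little group acts
trivially.

Casimir. W commutes with every X_a and is a tensor under commutators with J, so 2C = Σ W_kl² is
invariant. This uses the commutation relations alone (`EuclideanRelations`) and holds both in the
enveloping algebra and for operators. On smooth vectors, commuting with the generators is upgraded
to commuting with the group (`IsTame.commute_smoothOp`), and a form of Schur's lemma for possibly
unbounded symmetric operators (`exists_eq_smul_one_of_symm`) gives C = c. Then Σ ‖W_kl v‖² = 2c‖v‖²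
(`sum_norm_opW_sq`): each W_kl is bounded and symmetric, hence has self-adjoint closure, and C = 0
exactly when all W_kl vanish.

From W = 0 to the little group. An eigenvector ψ annihilates the ranges of the J_kl with k, l ≤ d,
so it is invariant under the corresponding rotations, and for d ≥ 2 these generate the little group
(`littleGroup_le_rotorGroup`).

From the little group to C = 0. Triviality gives ψ ∘ W_kl = 0 for every eigenvector, so cψ = 0. What
is needed is one nonzero eigenvector, and this is the main analytic point (`exists_posEigenvector`).
The X_k are bounded, commute and satisfy Σ X_k² = r², so continuous functions on the sphere act on H
by a calculus Φ which is covariant under rotations (`exists_positionCalculus`). Let p_ε be a cut-off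
of width ε at the pole and consider u ↦ ε⁻ᵈ ⟨Φ(p_ε)u, Φ(p_ε)w⟩. A Sobolev estimate bounds it
uniformly by finitely many seminorms of u (`exists_norm_calculus_cut_le`). Since O(ε⁻ᵈ) rotated
copies of p_ε cover the sphere, its value at u = w stays away from zero for suitably rotated w
(`exists_rotation_norm_ge`), and compactness of Spin allows a single w. A limit along an ultrafilter
is the eigenvector.

Foundations. No manifold structure on the group is used. The group is a closed subgroup of a
finite-dimensional normed algebra (`isClosedEmbedding_linRep`), and relations between generators in
that algebra pass to the derived representation by testing on Gårding vectors (`dRep_eq_sum`,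
`dRep_lie_eq_sum`). -/

theorem exists_isUnit_integral {f : ℝ → 𝒜} (hc : Continuous f) (h0 : f 0 = 1) :
    ∃ a : ℝ, IsUnit (∫ s in (0 : ℝ)..a, f s) := by
  have hd : HasDerivAt (fun a : ℝ => ∫ s in (0 : ℝ)..a, f s) (1 : 𝒜) 0 := by
    rw [← h0]
    exact intervalIntegral.integral_hasDerivAt_right (hc.intervalIntegrable _ _)
      hc.aestronglyMeasurable.stronglyMeasurableAtFilter hc.continuousAt
  -- The mean a⁻¹ ∫₀ᵃ f tends to f(0) = 1, and the units form an open set.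
  have ht := hd.tendsto_slope_zero
  have hu : {x : 𝒜 | IsUnit x} ∈ 𝓝 (1 : 𝒜) := Units.isOpen.mem_nhds isUnit_one
  obtain ⟨a, ha, ha0⟩ := (Filter.inter_mem (ht hu) self_mem_nhdsWithin :
    _ ∈ 𝓝[≠] (0 : ℝ)) |> Filter.nonempty_of_mem
  refine ⟨a, ?_⟩
  simp only [zero_add, intervalIntegral.integral_same, sub_zero, Set.mem_preimage] at ha
  have ha' : IsUnit (a⁻¹ • ∫ s in (0 : ℝ)..a, f s) := ha
  have hne : a ≠ 0 := ha0
  have := ha'.smul (Units.mk0 a hne)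
  rwa [Units.smul_mk0, smul_inv_smul₀ hne] at this

/-- Integrating f(t + s) = f(t) f(s) over s ∈ [0, a] gives f(t) · ∫₀ᵃ f = ∫ₜᵗ⁺ᵃ f. For a suitable a
the left integral is invertible, so f is as smooth as a primitive of itself. -/
theorem exists_hasDerivAt_of_map_add {f : ℝ → 𝒜} (hc : Continuous f) (h0 : f 0 = 1)
    (hadd : ∀ s t, f (s + t) = f s * f t) : ∃ A : 𝒜, ∀ t, HasDerivAt f (A * f t) t := by
  obtain ⟨a, u, hu⟩ := exists_isUnit_integral hc h0
  have key : ∀ t, f t = (∫ s in t..(t + a), f s) * (↑u⁻¹ : 𝒜) := by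
    intro t
    have h1 : f t * (u : 𝒜) = ∫ s in t..(t + a), f s := by
      rw [hu]
      have h2 : ∫ s in (0 : ℝ)..a, f (t + s) = ∫ s in t..(t + a), f s := by
        rw [intervalIntegral.integral_comp_add_left (fun s => f s) t, add_zero]
      rw [← h2]
      simp_rw [hadd]
      exact ((ContinuousLinearMap.mul ℝ 𝒜 (f t)).intervalIntegral_comp_comm
        (hc.intervalIntegrable _ _)).symm
    rw [← h1, mul_assoc, Units.mul_inv, mul_one]
  have hprim : ∀ b, HasDerivAt (fun t : ℝ => ∫ s in (0 : ℝ)..t, f s) (f b) b := fun b =>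
    intervalIntegral.integral_hasDerivAt_right (hc.intervalIntegrable _ _)
      hc.aestronglyMeasurable.stronglyMeasurableAtFilter hc.continuousAt
  have hd0 : HasDerivAt f ((f (0 + a) - f 0) * (↑u⁻¹ : 𝒜)) 0 := by
    have h1 : HasDerivAt (fun t : ℝ => ∫ s in t..(t + a), f s) (f (0 + a) - f 0) 0 := by
      have h2 : HasDerivAt (fun t : ℝ => ∫ s in (0 : ℝ)..(t + a), f s) (f (0 + a)) 0 :=
        (hprim (0 + a)).comp_add_const 0 a
      refine (h2.sub (hprim 0)).congr_of_eventuallyEq (Filter.Eventually.of_forall fun t => ?_)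
      exact (intervalIntegral.integral_interval_sub_left (hc.intervalIntegrable _ _)
        (hc.intervalIntegrable _ _)).symm
    exact (h1.mul_const (↑u⁻¹ : 𝒜)).congr_of_eventuallyEq (Filter.Eventually.of_forall key)
  refine ⟨(f (0 + a) - f 0) * (↑u⁻¹ : 𝒜), fun t => ?_⟩
  have h3 : HasDerivAt (fun s => f (s - t)) ((f (0 + a) - f 0) * (↑u⁻¹ : 𝒜)) t := by
    have := HasDerivAt.comp_sub_const (f := f) t t (by simpa using hd0)
    simpa using this
  refine (h3.mul_const (f t)).congr_of_eventuallyEq (Filter.Eventually.of_forall fun s => ?_)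
  simp [← hadd]

end LinearOneParam

/-! ### Generators of one-parameter subgroups and elementary properties of unitary representations
-/

section Basic

variable {G : Type*} [Group G] [TopologicalSpace G]

/-- The infinitesimal generator of a one-parameter subgroup in a linear representation. -/
def infGen {𝒜 : Type*} [NormedRing 𝒜] [NormedAlgebra ℝ 𝒜] (ρ : G →* 𝒜) (φ : OneParam G) : 𝒜 :=
  deriv (fun t : ℝ => ρ (φ (Multiplicative.ofAdd t))) 0

theorem OneParam.continuous_ofAdd (φ : OneParam G) :
    Continuous fun t : ℝ => φ (Multiplicative.ofAdd t) :=
  φ.continuous_toFun.comp _root_.continuous_ofAdd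

theorem OneParam.map_ofAdd_add (φ : OneParam G) (s t : ℝ) :
    φ (Multiplicative.ofAdd (s + t)) = φ (Multiplicative.ofAdd s) * φ (Multiplicative.ofAdd t) := by
  rw [ofAdd_add, map_mul]

theorem OneParam.map_ofAdd_neg (φ : OneParam G) (t : ℝ) :
    φ (Multiplicative.ofAdd (-t)) = (φ (Multiplicative.ofAdd t))⁻¹ := by
  rw [ofAdd_neg, map_inv]

theorem OneParam.map_ofAdd_zero (φ : OneParam G) : φ (Multiplicative.ofAdd (0 : ℝ)) = 1 := by
  rw [ofAdd_zero, map_one]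

theorem infGen_hasDerivAt {𝒜 : Type*} [NormedRing 𝒜] [NormedAlgebra ℝ 𝒜] [CompleteSpace 𝒜]
    {ρ : G →* 𝒜} (hρ : Continuous ρ) (φ : OneParam G) (t : ℝ) :
    HasDerivAt (fun t : ℝ => ρ (φ (Multiplicative.ofAdd t)))
      (infGen ρ φ * ρ (φ (Multiplicative.ofAdd t))) t := by
  obtain ⟨A, hA⟩ := exists_hasDerivAt_of_map_add (hρ.comp φ.continuous_ofAdd)
    (by simp) (fun s t => by simp)
  have h0 : infGen ρ φ = A := by
    have := (hA 0).deriv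
    simp only [Function.comp_apply, φ.map_ofAdd_zero, map_one, mul_one] at this
    exact this
  rw [h0]
  exact hA t

/-- Generators are determined by derivatives at the origin. -/
theorem infGen_eq {𝒜 : Type*} [NormedRing 𝒜] [NormedAlgebra ℝ 𝒜] {ρ : G →* 𝒜} {φ : OneParam G}
    {A : 𝒜} (h : HasDerivAt (fun t : ℝ => ρ (φ (Multiplicative.ofAdd t))) A 0) :
    infGen ρ φ = A := h.deriv

namespace UnitaryRep

variable {H : Type*} [NormedAddCommGroup H] [InnerProductSpace ℂ H] [CompleteSpace H]

theorem op_mul (U : UnitaryRep G H) (a b : G) (v : H) : U.op (a * b) v = U.op a (U.op b v) := by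
  simp [op, map_mul]

theorem op_one (U : UnitaryRep G H) (v : H) : U.op 1 v = v := by
  simp [op]

theorem norm_op (U : UnitaryRep G H) (g : G) (v : H) : ‖U.op g v‖ = ‖v‖ :=
  ContinuousLinearMap.norm_map_of_mem_unitary (U.toHom g).2 v

theorem inner_op (U : UnitaryRep G H) (g : G) (v w : H) :
    inner ℂ (U.op g v) (U.op g w) = inner ℂ v w :=
  ContinuousLinearMap.inner_map_map_of_mem_unitary (U.toHom g).2 v w

theorem op_inv_op (U : UnitaryRep G H) (g : G) (v : H) : U.op g⁻¹ (U.op g v) = v := by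
  rw [← op_mul, inv_mul_cancel, op_one]

theorem op_op_inv (U : UnitaryRep G H) (g : G) (v : H) : U.op g (U.op g⁻¹ v) = v := by
  rw [← op_mul, mul_inv_cancel, op_one]

theorem inner_op_left (U : UnitaryRep G H) (g : G) (v w : H) :
    inner ℂ (U.op g v) w = inner ℂ v (U.op g⁻¹ w) := by
  rw [← U.inner_op g v, op_op_inv]

theorem continuous_op (U : UnitaryRep G H) (v : H) : Continuous fun g => U.op g v :=
  U.strongly_continuous v

/-- Joint continuity of the action. -/
theorem continuous_op_uncurry (U : UnitaryRep G H) :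
    Continuous fun p : G × H => U.op p.1 p.2 := by
  rw [continuous_iff_continuousAt]
  rintro ⟨g, v⟩
  rw [ContinuousAt, tendsto_iff_norm_sub_tendsto_zero]
  have h1 : Filter.Tendsto (fun p : G × H => ‖p.2 - v‖ + ‖U.op p.1 v - U.op g v‖)
      (𝓝 (g, v)) (𝓝 (‖v - v‖ + ‖U.op g v - U.op g v‖)) := by
    have : Continuous fun p : G × H => ‖p.2 - v‖ + ‖U.op p.1 v - U.op g v‖ :=
      (continuous_snd.sub continuous_const).norm.add
        (((U.continuous_op v).comp continuous_fst).sub continuous_const).norm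
    exact this.tendsto (g, v)
  simp only [sub_self, norm_zero, add_zero] at h1
  refine squeeze_zero (fun _ => norm_nonneg _) (fun p => ?_) h1
  calc ‖U.op p.1 p.2 - U.op g v‖ = ‖U.op p.1 (p.2 - v) + (U.op p.1 v - U.op g v)‖ := by
        rw [map_sub]; congr 1; abel
    _ ≤ ‖U.op p.1 (p.2 - v)‖ + ‖U.op p.1 v - U.op g v‖ := norm_add_le _ _
    _ = _ := by rw [norm_op]

end UnitaryRep

end Basic

/-! ### Gårding vectors -/

section Garding

variable {G : Type*} [Group G] [TopologicalSpace G] [IsTopologicalGroup G]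
  {H : Type*} [NormedAddCommGroup H] [InnerProductSpace ℂ H] [CompleteSpace H]
  {𝒜 : Type*} [NormedRing 𝒜] [NormedAlgebra ℝ 𝒜] [FiniteDimensional ℝ 𝒜]
  [MeasurableSpace G] [BorelSpace G]

/-- The vector `∫ F(ρ(g)) U(g) v dg`. -/
def gardingVec (U : UnitaryRep G H) (ρ : G →* 𝒜) (μ : Measure G) (F : 𝒜 → ℝ) (v : H) : H :=
  ∫ g, F (ρ g) • U.op g v ∂μ

/-- The action of `A` on functions by the vector field `x ↦ -A x`. -/
def leftField (A : 𝒜) (F : 𝒜 → ℝ) (x : 𝒜) : ℝ := -fderiv ℝ F x (A * x)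

theorem leftField_contDiff {F : 𝒜 → ℝ} (hF : ContDiff ℝ ∞ F) (A : 𝒜) :
    ContDiff ℝ ∞ (leftField A F) :=
  ((hF.fderiv_right (m := ∞) (by simp)).clm_apply (contDiff_const.mul contDiff_id)).neg

theorem leftField_hasCompactSupport {F : 𝒜 → ℝ} (hF : HasCompactSupport F) (A : 𝒜) :
    HasCompactSupport (leftField A F) := by
  refine (hF.fderiv (𝕜 := ℝ)).mono fun x hx => ?_
  rw [Function.mem_support] at hx ⊢
  intro h
  exact hx (by simp [leftField, h])

variable {ρ : G →* 𝒜} {μ : Measure G} [IsFiniteMeasureOnCompacts μ]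

theorem garding_integrable (U : UnitaryRep G H) (hρ : IsClosedEmbedding ρ) {F : 𝒜 → ℝ}
    (hF : Continuous F) (hc : HasCompactSupport F) (v : H) :
    Integrable (fun g => F (ρ g) • U.op g v) μ :=
  ((hF.comp hρ.continuous).smul (U.continuous_op v)).integrable_of_hasCompactSupport
    ((hc.comp_isClosedEmbedding hρ).smul_right)

variable [μ.IsMulLeftInvariant]

theorem op_gardingVec (U : UnitaryRep G H) (hρ : IsClosedEmbedding ρ) {F : 𝒜 → ℝ}
    (hF : Continuous F) (hc : HasCompactSupport F) (v : H) (h : G) :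
    U.op h (gardingVec U ρ μ F v) = ∫ g, F (ρ h⁻¹ * ρ g) • U.op g v ∂μ := by
  rw [gardingVec, ← ContinuousLinearMap.integral_comp_comm _ (garding_integrable U hρ hF hc v),
    ← integral_mul_left_eq_self (fun g => F (ρ h⁻¹ * ρ g) • U.op g v) h]
  congr 1
  ext g
  rw [← map_mul, inv_mul_cancel_left, U.op_mul]
  exact ((U.op h).restrictScalars ℝ).map_smul _ _

/-- Left invariance of μ moves U(φ(t)) into the argument of F, so only F has to be differentiated.
As F is defined on the ambient algebra, this is ordinary calculus along t ↦ ρ(φ(-t)) x, whose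
velocity at t = 0 is -A x. -/
theorem gardingVec_hasDerivAt (U : UnitaryRep G H) (hρ : IsClosedEmbedding ρ) {F : 𝒜 → ℝ}
    (hF : ContDiff ℝ ∞ F) (hc : HasCompactSupport F) (v : H) (φ : OneParam G) :
    HasDerivAt (fun t : ℝ => U.op (φ (Multiplicative.ofAdd t)) (gardingVec U ρ μ F v))
      (gardingVec U ρ μ (leftField (infGen ρ φ) F) v) 0 := by
  have : CompleteSpace 𝒜 := FiniteDimensional.complete ℝ 𝒜
  have : T2Space G := hρ.isEmbedding.t2Space
  set A := infGen ρ φ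
  set γ : ℝ → G := fun t => φ (Multiplicative.ofAdd t) with hγ
  have hγc : Continuous γ := φ.continuous_ofAdd
  have hγneg : ∀ t, (γ t)⁻¹ = γ (-t) := fun t => (φ.map_ofAdd_neg t).symm
  simp_rw [op_gardingVec U hρ hF.continuous hc v]
  have hLc := leftField_hasCompactSupport hc A
  have hL := (leftField_contDiff hF A).continuous
  obtain ⟨C, hC⟩ := hL.bounded_above_of_compact_support hLc
  set K : Set G := ρ ⁻¹' tsupport (leftField A F)
  have hK : IsCompact K := hρ.isCompact_preimage hLc
  -- The support of the integrand moves with t. The set K' contains all of its positions for |t| ≤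
  -- 1, so a constant on K' dominates.
  set K' : Set G := (fun p : ℝ × G => γ p.1 * p.2) '' (Set.Icc (-1) 1 ×ˢ K)
  have hK' : IsCompact K' := (isCompact_Icc.prod hK).image
    ((hγc.comp continuous_fst).mul continuous_snd)
  have h1 : gardingVec U ρ μ (leftField A F) v
      = ∫ g, leftField A F (ρ (γ 0)⁻¹ * ρ g) • U.op g v ∂μ := by
    have : γ 0 = 1 := φ.map_ofAdd_zero
    simp [gardingVec, this]
  rw [h1]
  have hcont : ∀ (E : 𝒜 → ℝ), Continuous E → ∀ t : ℝ,
      Continuous fun g => E (ρ (γ t)⁻¹ * ρ g) • U.op g v := fun E hE t =>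
    (hE.comp (continuous_const.mul hρ.continuous)).smul (U.continuous_op v)
  have hcs : ∀ (E : 𝒜 → ℝ), Continuous E → HasCompactSupport E → ∀ t : ℝ,
      Integrable (fun g => E (ρ (γ t)⁻¹ * ρ g) • U.op g v) μ := fun E hE hEc t => by
    refine (hcont E hE t).integrable_of_hasCompactSupport ?_
    have h2 := (hEc.comp_isClosedEmbedding hρ).comp_homeomorph (Homeomorph.mulLeft (γ t)⁻¹)
    have h3 : (fun g => E (ρ (γ t)⁻¹ * ρ g)) = (E ∘ ρ) ∘ Homeomorph.mulLeft (γ t)⁻¹ := by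
      ext g; simp
    rw [← h3] at h2
    exact h2.smul_right
  refine (hasDerivAt_integral_of_dominated_loc_of_deriv_le
    (bound := K'.indicator fun _ => C * ‖v‖)
    (F := fun t g => F (ρ (γ t)⁻¹ * ρ g) • U.op g v)
    (F' := fun t g => leftField A F (ρ (γ t)⁻¹ * ρ g) • U.op g v)
    (Metric.ball_mem_nhds (0 : ℝ) one_pos) ?_ ?_ ?_ ?_ ?_ ?_).2
  · exact Filter.Eventually.of_forall fun t => (hcs F hF.continuous hc t).aestronglyMeasurable
  · exact hcs F hF.continuous hc 0
  · exact (hcs _ hL hLc 0).aestronglyMeasurable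
  · refine Filter.Eventually.of_forall fun g t ht => ?_
    rw [norm_smul, U.norm_op]
    by_cases hg : g ∈ K'
    · rw [Set.indicator_of_mem hg]
      exact mul_le_mul_of_nonneg_right (hC _) (norm_nonneg _)
    · rw [Set.indicator_of_notMem hg]
      have h0 : leftField A F (ρ (γ t)⁻¹ * ρ g) = 0 := by
        by_contra hne
        apply hg
        refine ⟨(t, (γ t)⁻¹ * g), ⟨?_, ?_⟩, by simp⟩
        · have := ht
          rw [Metric.mem_ball, dist_zero_right, Real.norm_eq_abs, abs_lt] at this
          exact ⟨this.1.le, this.2.le⟩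
        · change ρ ((γ t)⁻¹ * g) ∈ tsupport _
          rw [map_mul]
          exact subset_tsupport _ hne
      simp [h0]
  · exact (integrable_indicator_iff hK'.isClosed.measurableSet).2
      (integrableOn_const hK'.measure_lt_top.ne)
  · refine Filter.Eventually.of_forall fun g t _ => ?_
    have h4 : HasDerivAt (fun t => ρ (γ t)⁻¹ * ρ g) (-(A * (ρ (γ t)⁻¹ * ρ g))) t := by
      simp_rw [hγneg]
      have h5 := (infGen_hasDerivAt hρ.continuous φ (-t)).scomp t (hasDerivAt_neg t)
      have h6 := h5.mul_const (ρ g)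
      simpa [Function.comp_def, mul_assoc, hγ] using h6
    have h5 := ((hF.differentiable (by simp)).differentiableAt.hasFDerivAt
      (x := ρ (γ t)⁻¹ * ρ g)).comp_hasDerivAt t h4
    have h6 := h5.smul_const (U.op g v)
    simpa [leftField, Function.comp_def] using h6

/-- A derivative of a Gårding vector is again a Gårding vector, with F replaced by its image under a
vector field, so the induction carries F along. -/
theorem gardingVec_mem_smooth (U : UnitaryRep G H) (hρ : IsClosedEmbedding ρ) {F : 𝒜 → ℝ}
    (hF : ContDiff ℝ ∞ F) (hc : HasCompactSupport F) (v : H) :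
    gardingVec U ρ μ F v ∈ U.smooth := by
  refine (Submodule.mem_iInf _).2 fun m => ?_
  induction m generalizing F with
  | zero => exact Submodule.mem_top
  | succ m ih =>
    intro φ
    exact ⟨_, ih (leftField_contDiff hF _) (leftField_hasCompactSupport hc _),
      gardingVec_hasDerivAt U hρ hF hc v φ⟩

/-- Approximate identity: since ρ is an embedding, a bump function at 1 in the algebra restricts to
a function on the group with support in a prescribed neighbourhood of 1; it is normalized to have
integral 1. -/
theorem exists_gardingVec_near [μ.IsOpenPosMeasure] (U : UnitaryRep G H)
    (hρ : IsClosedEmbedding ρ) (v : H) {ε : ℝ} (hε : 0 < ε) :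
    ∃ F : 𝒜 → ℝ, ContDiff ℝ ∞ F ∧ HasCompactSupport F ∧ ‖gardingVec U ρ μ F v - v‖ ≤ ε := by
  have hV : {g : G | ‖U.op g v - v‖ < ε} ∈ 𝓝 (1 : G) := by
    have h1 : Continuous fun g => ‖U.op g v - v‖ := ((U.continuous_op v).sub continuous_const).norm
    have h2 : ‖U.op 1 v - v‖ < ε := by rw [U.op_one, sub_self, norm_zero]; exact hε
    exact h1.continuousAt.eventually_lt continuousAt_const h2
  rw [hρ.isInducing.nhds_eq_comap, Filter.mem_comap, map_one] at hV
  obtain ⟨O, hO, hOV⟩ := hV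
  obtain ⟨δ, hδ, hball⟩ := Metric.mem_nhds_iff.1 hO
  let f : ContDiffBump (1 : 𝒜) := ⟨δ / 2, δ, by positivity, by linarith⟩
  have hfs : ContDiff ℝ ∞ f := f.contDiff
  have hcomp : HasCompactSupport (fun g : G => f (ρ g)) :=
    f.hasCompactSupport.comp_isClosedEmbedding hρ
  have hcontG : Continuous fun g : G => f (ρ g) := hfs.continuous.comp hρ.continuous
  set c := ∫ g, f (ρ g) ∂μ with hcdef
  have hint : Integrable (fun g : G => f (ρ g)) μ := hcontG.integrable_of_hasCompactSupport hcomp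
  have hcpos : 0 < c := by
    refine hcontG.integral_pos_of_hasCompactSupport_nonneg_nonzero hcomp (fun g => f.nonneg)
      (x := 1) ?_
    rw [map_one]
    have : f 1 = 1 := f.one_of_mem_closedBall (by simp [f]; positivity)
    rw [this]; exact one_ne_zero
  refine ⟨fun x => c⁻¹ * f x, contDiff_const.mul hfs, f.hasCompactSupport.mul_left, ?_⟩
  have e1 : gardingVec U ρ μ (fun x => c⁻¹ * f x) v = c⁻¹ • ∫ g, f (ρ g) • U.op g v ∂μ := by
    simp_rw [gardingVec, mul_smul]
    exact integral_smul _ _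
  have e2 : v = c⁻¹ • ∫ g, f (ρ g) • v ∂μ := by
    rw [integral_smul_const, ← hcdef, inv_smul_smul₀ hcpos.ne']
  have hi1 := garding_integrable (μ := μ) U hρ hfs.continuous f.hasCompactSupport v
  have hi2 : Integrable (fun g => f (ρ g) • v) μ := hint.smul_const v
  have e3 : gardingVec U ρ μ (fun x => c⁻¹ * f x) v - v
      = c⁻¹ • ∫ g, f (ρ g) • (U.op g v - v) ∂μ := by
    rw [e1]
    nth_rewrite 2 [e2]
    rw [← smul_sub, ← integral_sub hi1 hi2]
    simp_rw [smul_sub]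
  rw [e3, norm_smul, Real.norm_eq_abs, abs_of_pos (inv_pos.2 hcpos)]
  have h5 : ‖∫ g, f (ρ g) • (U.op g v - v) ∂μ‖ ≤ ∫ g, f (ρ g) * ε ∂μ := by
    refine norm_integral_le_of_norm_le (hint.mul_const ε) (Filter.Eventually.of_forall fun g => ?_)
    rw [norm_smul, Real.norm_eq_abs, abs_of_nonneg f.nonneg]
    by_cases hg : ρ g ∈ Metric.ball (1 : 𝒜) δ
    · exact mul_le_mul_of_nonneg_left (le_of_lt (hOV (hball hg))) f.nonneg
    · have : f (ρ g) = 0 := by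
        apply f.zero_of_le_dist
        simpa [f] using hg
      simp [this]
  rw [integral_mul_const] at h5
  calc c⁻¹ * _ ≤ c⁻¹ * (c * ε) := by gcongr
    _ = ε := by field_simp

end Garding

end EuclideanCover

end

noncomputable section

namespace EuclideanCover

open MeasureTheory Topology
open scoped ContDiff

/-! ### Conjugation of one-parameter subgroups -/

section Conj

variable {G : Type*} [Group G] [TopologicalSpace G] [IsTopologicalGroup G]

/-- The one-parameter subgroup `t ↦ g φ(t) g⁻¹`. -/
def OneParam.conj (g : G) (φ : OneParam G) : OneParam G where
  toFun t := g * φ t * g⁻¹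
  map_one' := by simp
  map_mul' s t := by simp [mul_assoc]
  continuous_toFun := by fun_prop

theorem OneParam.conj_apply (g : G) (φ : OneParam G) (t : Multiplicative ℝ) :
    φ.conj g t = g * φ t * g⁻¹ := rfl

theorem infGen_conj {𝒜 : Type*} [NormedRing 𝒜] [NormedAlgebra ℝ 𝒜] [CompleteSpace 𝒜]
    {ρ : G →* 𝒜} (hρ : Continuous ρ) (g : G) (φ : OneParam G) :
    infGen ρ (φ.conj g) = ρ g * infGen ρ φ * ρ g⁻¹ := by
  refine infGen_eq ?_
  have h := ((infGen_hasDerivAt hρ φ 0).const_mul (ρ g)).mul_const (ρ g⁻¹)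
  simpa [OneParam.conj_apply, φ.map_ofAdd_zero] using h

end Conj

namespace UnitaryRep

variable {G : Type*} [Group G] [TopologicalSpace G] [IsTopologicalGroup G]
  {H : Type*} [NormedAddCommGroup H] [InnerProductSpace ℂ H] [CompleteSpace H]

/-! ### First properties of the derived representation -/

theorem coe_smoothOp (U : UnitaryRep G H) (g : G) (v : U.smooth) :
    ((U.smoothOp g v : U.smooth) : H) = U.op g v := rfl

theorem smoothOp_mul (U : UnitaryRep G H) (g h : G) :
    U.smoothOp (g * h) = U.smoothOp g * U.smoothOp h := by
  ext v
  simp [coe_smoothOp, op_mul]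

theorem smoothOp_one (U : UnitaryRep G H) : U.smoothOp (1 : G) = 1 := by
  ext v
  simp [coe_smoothOp, op_one]

theorem smoothOp_mul_inv (U : UnitaryRep G H) (g : G) : U.smoothOp g * U.smoothOp g⁻¹ = 1 := by
  rw [← smoothOp_mul, mul_inv_cancel, smoothOp_one]

theorem smoothOp_inv_mul (U : UnitaryRep G H) (g : G) : U.smoothOp g⁻¹ * U.smoothOp g = 1 := by
  rw [← smoothOp_mul, inv_mul_cancel, smoothOp_one]

theorem dRep_eq (U : UnitaryRep G H) {φ : OneParam G} {v w : U.smooth}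
    (h : HasDerivAt (fun t : ℝ => U.op (φ (Multiplicative.ofAdd t)) (v : H)) (w : H) 0) :
    U.dRep φ v = w :=
  Subtype.ext ((U.dRep_hasDerivAt φ v).unique h)

theorem dRep_conj (U : UnitaryRep G H) (g : G) (φ : OneParam G) :
    U.dRep (φ.conj g) = U.smoothOp g * U.dRep φ * U.smoothOp g⁻¹ := by
  ext1 v
  refine U.dRep_eq ?_
  have h := ((U.op g).restrictScalars ℝ).hasFDerivAt.comp_hasDerivAt (0 : ℝ)
    (U.dRep_hasDerivAt φ (U.smoothOp g⁻¹ v))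
  refine h.congr_of_eventuallyEq (Filter.Eventually.of_forall fun t => ?_)
  simp [OneParam.conj_apply, op_mul, coe_smoothOp]

theorem dRep_mul_smoothOp (U : UnitaryRep G H) (g : G) (φ : OneParam G) :
    U.dRep φ * U.smoothOp g = U.smoothOp g * U.dRep (φ.conj g⁻¹) := by
  rw [dRep_conj, inv_inv, ← mul_assoc, ← mul_assoc, smoothOp_mul_inv, one_mul]

theorem dRep_smoothOp_self (U : UnitaryRep G H) (φ : OneParam G) (t : ℝ) (v : U.smooth) :
    U.dRep φ (U.smoothOp (φ (Multiplicative.ofAdd t)) v)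
      = U.smoothOp (φ (Multiplicative.ofAdd t)) (U.dRep φ v) := by
  have h : φ.conj (φ (Multiplicative.ofAdd t))⁻¹ = φ := by
    ext s
    rw [OneParam.conj_apply, inv_inv, ← map_inv, ← map_mul, ← map_mul, mul_comm, ← mul_assoc,
      mul_inv_cancel, one_mul]
  have := LinearMap.congr_fun (U.dRep_mul_smoothOp (φ (Multiplicative.ofAdd t)) φ) v
  rwa [h] at this

theorem op_hasDerivAt (U : UnitaryRep G H) (φ : OneParam G) (v : U.smooth) (t : ℝ) :
    HasDerivAt (fun t : ℝ => U.op (φ (Multiplicative.ofAdd t)) (v : H))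
      (U.op (φ (Multiplicative.ofAdd t)) (U.dRep φ v : H)) t := by
  have h1 : HasDerivAt (fun s : ℝ => U.op (φ (Multiplicative.ofAdd (s - t))) (v : H))
      (U.dRep φ v : H) t := by
    have := HasDerivAt.comp_sub_const
      (f := fun s : ℝ => U.op (φ (Multiplicative.ofAdd s)) (v : H)) t t
      (by simpa using U.dRep_hasDerivAt φ v)
    simpa using this
  have h2 := ((U.op (φ (Multiplicative.ofAdd t))).restrictScalars ℝ).hasFDerivAt.comp_hasDerivAt t h1
  refine h2.congr_of_eventuallyEq (Filter.Eventually.of_forall fun s => ?_)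
  change _ = U.op _ (U.op _ _)
  rw [← op_mul, ← φ.map_ofAdd_add]
  simp

/-- By unitarity t ↦ ⟨U(φ(t))v, U(φ(t))w⟩ is constant; this is its derivative at 0. -/
theorem inner_dRep_left (U : UnitaryRep G H) (φ : OneParam G) (v w : U.smooth) :
    inner ℂ (U.dRep φ v : H) (w : H) = -inner ℂ (v : H) (U.dRep φ w : H) := by
  have h1 := (U.op_hasDerivAt φ v 0).inner ℂ (U.op_hasDerivAt φ w 0)
  simp only [φ.map_ofAdd_zero, op_one, inner_op] at h1
  have h2 := (hasDerivAt_const (0 : ℝ) (inner ℂ (v : H) (w : H))).unique h1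
  rw [eq_neg_iff_add_eq_zero, add_comm]
  exact h2.symm

theorem inner_dRep_right (U : UnitaryRep G H) (φ : OneParam G) (v w : U.smooth) :
    inner ℂ (v : H) (U.dRep φ w : H) = -inner ℂ (U.dRep φ v : H) (w : H) := by
  rw [inner_dRep_left, neg_neg]

/-! ### The derived representation as a representation of a Lie algebra -/

section Lie

variable {𝒜 : Type*} [NormedRing 𝒜] [NormedAlgebra ℝ 𝒜] [FiniteDimensional ℝ 𝒜]

/-- The second-derivative terms cancel by symmetry, and the first-order terms leave DF((BA - AB)x).
The minus sign in `leftField` makes the correspondence a Lie homomorphism rather than an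
antihomomorphism. -/
theorem leftField_lie {F : 𝒜 → ℝ} (hF : ContDiff ℝ ∞ F) (A B x : 𝒜) :
    leftField A (leftField B F) x - leftField B (leftField A F) x
      = leftField (A * B - B * A) F x := by
  have key : ∀ A B : 𝒜, leftField A (leftField B F) x
      = fderiv ℝ (fderiv ℝ F) x (A * x) (B * x) + fderiv ℝ F x (B * (A * x)) := by
    intro A B
    have h1 : HasFDerivAt (fderiv ℝ F) (fderiv ℝ (fderiv ℝ F) x) x :=
      ((hF.fderiv_right (m := ∞) (by simp)).differentiable (by simp)).differentiableAt.hasFDerivAt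
    have h2 : HasFDerivAt (fun y : 𝒜 => B * y) (ContinuousLinearMap.mul ℝ 𝒜 B) x :=
      (ContinuousLinearMap.mul ℝ 𝒜 B).hasFDerivAt
    have h3 := (h1.clm_apply h2).neg
    have h4 : fderiv ℝ (leftField B F) x = _ := h3.fderiv
    rw [leftField, h4]
    simp [add_comm]
  have hsymm : fderiv ℝ (fderiv ℝ F) x (A * x) (B * x)
      = fderiv ℝ (fderiv ℝ F) x (B * x) (A * x) :=
    (hF.contDiffAt.isSymmSndFDerivAt (by
      rw [minSmoothness_of_isRCLikeNormedField]
      exact WithTop.coe_le_coe.2 le_top)).eq _ _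
  rw [key, key, hsymm, leftField, sub_mul, map_sub, mul_assoc, mul_assoc]
  ring

variable {ρ : G →* 𝒜}

/-- Smooth vectors are dense, and skew-symmetric operators are determined by Gårding vectors. -/
theorem dense_smooth (U : UnitaryRep G H) (hρ : IsClosedEmbedding ρ) : Dense (U.smooth : Set H) := by
  let _ : MeasurableSpace G := borel G
  have : BorelSpace G := ⟨rfl⟩
  have : T2Space G := hρ.isEmbedding.t2Space
  have : ProperSpace 𝒜 := FiniteDimensional.proper ℝ 𝒜
  have : LocallyCompactSpace G := hρ.locallyCompactSpace
  rw [Metric.dense_iff]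
  intro v ε hε
  obtain ⟨F, hF, hc, h⟩ := exists_gardingVec_near (μ := (Measure.haar : Measure G)) U hρ v (half_pos hε)
  refine ⟨_, ?_, gardingVec_mem_smooth (μ := (Measure.haar : Measure G)) U hρ hF hc v⟩
  rw [mem_ball_iff_norm]
  linarith

/-- Skewness gives ⟨Tv, w⟩ = -⟨v, Tw⟩ = 0 for every Gårding vector w, and these are dense. Relations
between derived operators thus need to be checked on Gårding vectors only, where they are identities
between vector fields; no continuity of T is involved. -/
theorem eq_zero_of_skew (U : UnitaryRep G H) (hρ : IsClosedEmbedding ρ)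
    [MeasurableSpace G] [BorelSpace G] {μ : Measure G} [μ.IsHaarMeasure]
    {T : Module.End ℂ U.smooth}
    (hskew : ∀ v w : U.smooth, inner ℂ (T v : H) (w : H) = -inner ℂ (v : H) (T w : H))
    (h0 : ∀ (F : 𝒜 → ℝ) (hF : ContDiff ℝ ∞ F) (hc : HasCompactSupport F) (v : H),
      T ⟨gardingVec U ρ μ F v, gardingVec_mem_smooth U hρ hF hc v⟩ = 0) : T = 0 := by
  ext1 v
  apply Subtype.ext
  have key : ∀ x : H, inner ℂ (T v : H) x = 0 := by
    intro x
    have hcl : IsClosed {x : H | inner ℂ (T v : H) x = 0} :=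
      isClosed_eq (continuous_const.inner continuous_id) continuous_const
    have hsub : {x | ∃ F : 𝒜 → ℝ, ContDiff ℝ ∞ F ∧ HasCompactSupport F ∧
        ∃ v : H, x = gardingVec U ρ μ F v} ⊆ {x : H | inner ℂ (T v : H) x = 0} := by
      rintro _ ⟨F, hF, hc, w, rfl⟩
      have := hskew v ⟨gardingVec U ρ μ F w, gardingVec_mem_smooth U hρ hF hc w⟩
      rw [h0 F hF hc w] at this
      simpa using this
    refine hcl.closure_subset_iff.2 hsub ?_
    · rw [Metric.mem_closure_iff]
      intro ε hε
      obtain ⟨F, hF, hc, h⟩ := exists_gardingVec_near (μ := μ) U hρ x (half_pos hε)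
      refine ⟨_, ⟨F, hF, hc, x, rfl⟩, ?_⟩
      rw [dist_comm, dist_eq_norm]
      linarith
  have := key (T v : H)
  simpa using this

theorem dRep_gardingVec (U : UnitaryRep G H) (hρ : IsClosedEmbedding ρ)
    [MeasurableSpace G] [BorelSpace G] {μ : Measure G} [μ.IsHaarMeasure]
    {F : 𝒜 → ℝ} (hF : ContDiff ℝ ∞ F) (hc : HasCompactSupport F) (v : H) (φ : OneParam G) :
    U.dRep φ ⟨gardingVec U ρ μ F v, gardingVec_mem_smooth U hρ hF hc v⟩
      = ⟨gardingVec U ρ μ (leftField (infGen ρ φ) F) v, gardingVec_mem_smooth U hρ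
          (leftField_contDiff hF _) (leftField_hasCompactSupport hc _) v⟩ :=
  U.dRep_eq (gardingVec_hasDerivAt U hρ hF hc v φ)

theorem inner_sum_dRep (U : UnitaryRep G H) {ι : Type*} (s : Finset ι) (c : ι → ℝ)
    (χ : ι → OneParam G) (v w : U.smooth) :
    inner ℂ (((∑ i ∈ s, (c i : ℂ) • U.dRep (χ i)) v : U.smooth) : H) (w : H)
      = -inner ℂ (v : H) (((∑ i ∈ s, (c i : ℂ) • U.dRep (χ i)) w : U.smooth) : H) := by
  simp only [LinearMap.sum_apply, LinearMap.smul_apply, Submodule.coe_sum, Submodule.coe_smul,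
    sum_inner, inner_sum, inner_smul_left, inner_smul_right, inner_dRep_left, Complex.conj_ofReal,
    mul_neg, Finset.sum_neg_distrib]

theorem sum_dRep_gardingVec (U : UnitaryRep G H) (hρ : IsClosedEmbedding ρ)
    [MeasurableSpace G] [BorelSpace G] {μ : Measure G} [μ.IsHaarMeasure]
    {F : 𝒜 → ℝ} (hF : ContDiff ℝ ∞ F) (hc : HasCompactSupport F) (v : H)
    {ι : Type*} (s : Finset ι) (c : ι → ℝ) (χ : ι → OneParam G) :
    (((∑ i ∈ s, (c i : ℂ) • U.dRep (χ i))
      ⟨gardingVec U ρ μ F v, gardingVec_mem_smooth U hρ hF hc v⟩ : U.smooth) : H)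
      = gardingVec U ρ μ (leftField (∑ i ∈ s, c i • infGen ρ (χ i)) F) v := by
  simp only [LinearMap.sum_apply, LinearMap.smul_apply, Submodule.coe_sum, Submodule.coe_smul,
    U.dRep_gardingVec hρ hF hc]
  have h1 : ∀ i ∈ s, Integrable (fun g => c i • (leftField (infGen ρ (χ i)) F (ρ g) • U.op g v)) μ :=
    fun i _ => (garding_integrable U hρ (leftField_contDiff hF _).continuous
      (leftField_hasCompactSupport hc _) v).smul (c i)
  have h2 : ∀ i, (c i : ℂ) • gardingVec U ρ μ (leftField (infGen ρ (χ i)) F) v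
      = ∫ g, c i • (leftField (infGen ρ (χ i)) F (ρ g) • U.op g v) ∂μ := by
    intro i
    rw [integral_smul, Complex.coe_smul]
    rfl
  simp_rw [h2]
  rw [← integral_finsetSum s h1, gardingVec]
  congr 1
  ext g
  simp only [smul_smul, ← Finset.sum_smul]
  congr 1
  simp [leftField, Finset.sum_mul, map_sum, Finset.sum_neg_distrib]

/-- On Gårding vectors the operator acts through the vector field of Σ cᵢ Aᵢ, which is zero by
hypothesis. Real coefficients keep the operator skew. -/
theorem sum_dRep_eq_zero (U : UnitaryRep G H) (hρ : IsClosedEmbedding ρ) {ι : Type*}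
    (s : Finset ι) (c : ι → ℝ) (χ : ι → OneParam G)
    (h : ∑ i ∈ s, c i • infGen ρ (χ i) = 0) : ∑ i ∈ s, (c i : ℂ) • U.dRep (χ i) = 0 := by
  let _ : MeasurableSpace G := borel G
  have : BorelSpace G := ⟨rfl⟩
  have : T2Space G := hρ.isEmbedding.t2Space
  have : ProperSpace 𝒜 := FiniteDimensional.proper ℝ 𝒜
  have : LocallyCompactSpace G := hρ.locallyCompactSpace
  refine U.eq_zero_of_skew hρ (μ := Measure.haar) (U.inner_sum_dRep s c χ) fun F hF hc v => ?_
  apply Subtype.ext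
  rw [U.sum_dRep_gardingVec hρ hF hc, h]
  simp [gardingVec, leftField]

theorem dRep_eq_sum (U : UnitaryRep G H) (hρ : IsClosedEmbedding ρ) {ι : Type*} (s : Finset ι)
    (c : ι → ℝ) (χ : ι → OneParam G) (φ : OneParam G)
    (h : infGen ρ φ = ∑ i ∈ s, c i • infGen ρ (χ i)) :
    U.dRep φ = ∑ i ∈ s, (c i : ℂ) • U.dRep (χ i) := by
  -- The relation -φ + Σ cᵢ χᵢ = 0: the extra index `none` carries φ with coefficient -1.
  have := U.sum_dRep_eq_zero hρ (Finset.insertNone s) (fun o => o.elim (-1) c)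
    (fun o => o.elim φ χ) (by simp [Finset.sum_insertNone, h])
  rw [Finset.sum_insertNone] at this
  have e : ((-1 : ℝ) : ℂ) • U.dRep φ = -U.dRep φ := by
    ext1 v
    rw [LinearMap.smul_apply, LinearMap.neg_apply, Complex.ofReal_neg, Complex.ofReal_one,
      neg_one_smul]
  refine neg_add_eq_zero.1 ?_
  rw [← e]
  exact this

/-- The commutator of skew operators is skew, so `eq_zero_of_skew` applies to the difference of the
two sides; on Gårding vectors that difference vanishes by `leftField_lie`. The bracket enters only
as a combination of known generators. -/
theorem dRep_lie_eq_sum (U : UnitaryRep G H) (hρ : IsClosedEmbedding ρ) {ι : Type*} (s : Finset ι)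
    (c : ι → ℝ) (χ : ι → OneParam G) (φ ψ : OneParam G)
    (h : infGen ρ φ * infGen ρ ψ - infGen ρ ψ * infGen ρ φ = ∑ i ∈ s, c i • infGen ρ (χ i)) :
    U.dRep φ * U.dRep ψ - U.dRep ψ * U.dRep φ = ∑ i ∈ s, (c i : ℂ) • U.dRep (χ i) := by
  let _ : MeasurableSpace G := borel G
  have : BorelSpace G := ⟨rfl⟩
  have : T2Space G := hρ.isEmbedding.t2Space
  have : ProperSpace 𝒜 := FiniteDimensional.proper ℝ 𝒜
  have : LocallyCompactSpace G := hρ.locallyCompactSpace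
  rw [← sub_eq_zero]
  refine U.eq_zero_of_skew hρ (μ := Measure.haar) (fun v w => ?_) fun F hF hc v => ?_
  · simp only [LinearMap.sub_apply, Submodule.coe_sub, inner_sub_left, inner_sub_right,
      Module.End.mul_apply]
    rw [inner_sum_dRep]
    simp only [inner_dRep_left]
    ring
  · apply Subtype.ext
    rw [LinearMap.sub_apply, Submodule.coe_sub, U.sum_dRep_gardingVec hρ hF hc, ← h]
    simp only [LinearMap.sub_apply, Submodule.coe_sub, Module.End.mul_apply]
    rw [U.dRep_gardingVec hρ hF hc, U.dRep_gardingVec hρ hF hc, 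
      U.dRep_gardingVec hρ (leftField_contDiff hF _) (leftField_hasCompactSupport hc _),
      U.dRep_gardingVec hρ (leftField_contDiff hF _) (leftField_hasCompactSupport hc _)]
    simp only [gardingVec]
    rw [← integral_sub, sub_eq_zero.2]
    · simp
    · congr 1
      ext g
      rw [← leftField_lie hF, sub_smul]
    · exact garding_integrable U hρ (leftField_contDiff (leftField_contDiff hF _) _).continuous
        (leftField_hasCompactSupport (leftField_hasCompactSupport hc _) _) v
    · exact garding_integrable U hρ (leftField_contDiff (leftField_contDiff hF _) _).continuous
        (leftField_hasCompactSupport (leftField_hasCompactSupport hc _) _) v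

/-- Finitely many one-parameter subgroups span the Lie algebra. -/
theorem exists_finite_generators (ρ : G →* 𝒜) :
    ∃ (n : ℕ) (χ : Fin n → OneParam G) (c : Fin n → 𝒜 →ₗ[ℝ] ℝ),
      ∀ φ : OneParam G, infGen ρ φ = ∑ i, c i (infGen ρ φ) • infGen ρ (χ i) := by
  obtain ⟨b, hb, hspan, hli⟩ := exists_linearIndependent ℝ (Set.range (infGen ρ))
  have hfin : Finite b := hli.finite
  let B := Module.Basis.span hli
  obtain ⟨n, ⟨e⟩⟩ := Finite.exists_equiv_fin b
  choose χ hχ using fun x : b => hb x.2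
  -- The coordinate functionals are extended from the span to the whole algebra, so that later the
  -- coefficients of a conjugated generator depend continuously on the group element.
  choose c hc using fun x : b => LinearMap.exists_extend (p := Submodule.span ℝ (Set.range
    ((↑) : b → 𝒜))) (B.coord x)
  refine ⟨n, fun i => χ (e.symm i), fun i => c (e.symm i), fun φ => ?_⟩
  have : Fintype b := Fintype.ofFinite b
  have hmem : infGen ρ φ ∈ Submodule.span ℝ (Set.range ((↑) : b → 𝒜)) := by
    rw [Subtype.range_coe, hspan]
    exact Submodule.subset_span ⟨φ, rfl⟩
  have h1 := B.sum_repr ⟨_, hmem⟩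
  have h2 := congrArg Subtype.val h1
  rw [Submodule.coe_sum] at h2
  refine h2.symm.trans ?_
  rw [← e.symm.sum_comp]
  refine Finset.sum_congr rfl fun i _ => ?_
  rw [hχ, Submodule.coe_smul]
  have h3 := LinearMap.congr_fun (hc (e.symm i)) ⟨_, hmem⟩
  simp only [LinearMap.comp_apply, Submodule.subtype_apply, Module.Basis.coord_apply] at h3
  rw [h3, Module.Basis.span_apply]

/-- A conjugated generator is a combination of finitely many fixed generators, with coefficients
continuous in g. Multiplying out, a word in conjugated generators applied to v stays in the span of
finitely many vectors which do not depend on g. -/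
theorem exists_conj_expansion (U : UnitaryRep G H) (hρ : IsClosedEmbedding ρ)
    (L : List (OneParam G)) (v : U.smooth) :
    ∃ (m : ℕ) (w : Fin m → U.smooth) (a : Fin m → G → ℝ), (∀ i, Continuous (a i)) ∧
      ∀ g, (L.map fun φ => U.dRep (φ.conj g⁻¹)).prod v = ∑ i, (a i g : ℂ) • w i := by
  have : CompleteSpace 𝒜 := FiniteDimensional.complete ℝ 𝒜
  obtain ⟨n, χ, c, hc⟩ := exists_finite_generators ρ
  induction L with
  | nil => exact ⟨1, fun _ => v, fun _ _ => 1, fun _ => continuous_const, fun g => by simp⟩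
  | cons φ L ih =>
    obtain ⟨m, w, a, ha, h⟩ := ih
    have e := (finProdFinEquiv (m := n) (n := m)).symm
    refine ⟨n * m, fun i => U.dRep (χ (e i).1) (w (e i).2),
      fun i g => c (e i).1 (infGen ρ (φ.conj g⁻¹)) * a (e i).2 g, fun i => ?_, fun g => ?_⟩
    · refine Continuous.mul ?_ (ha _)
      have h1 : Continuous (c (e i).1) := LinearMap.continuous_of_finiteDimensional _
      refine h1.comp ?_
      simp_rw [infGen_conj hρ.continuous, inv_inv]
      exact ((hρ.continuous.comp continuous_inv).mul continuous_const).mul hρ.continuous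
    · rw [List.map_cons, List.prod_cons, Module.End.mul_apply, h,
        U.dRep_eq_sum hρ Finset.univ _ χ _ (hc (φ.conj g⁻¹)),
        e.sum_comp (fun p : Fin n × Fin m => (((c p.1 (infGen ρ (φ.conj g⁻¹)) * a p.2 g : ℝ)) : ℂ) •
          U.dRep (χ p.1) (w p.2)), Fintype.sum_prod_type]
      simp only [LinearMap.sum_apply, map_sum, LinearMap.smul_apply, map_smul, Finset.smul_sum,
        smul_smul, Complex.ofReal_mul]
      rw [Finset.sum_comm]
      simp only [mul_comm]

theorem prod_dRep_mul_smoothOp (U : UnitaryRep G H) (L : List (OneParam G)) (g : G) :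
    (L.map U.dRep).prod * U.smoothOp g
      = U.smoothOp g * (L.map fun φ => U.dRep (φ.conj g⁻¹)).prod := by
  induction L with
  | nil => simp
  | cons φ L ih =>
    rw [List.map_cons, List.prod_cons, List.map_cons, List.prod_cons, mul_assoc, ih, ← mul_assoc,
      dRep_mul_smoothOp, mul_assoc]

/-- Moving U(g) to the left of the word conjugates its letters. What remains is U(g) applied to a
finite sum with continuous coefficients, and the action is jointly continuous. Thus orbits of smooth
vectors are continuous in the Fréchet topology. -/
theorem continuous_prod_dRep_smoothOp (U : UnitaryRep G H) (hρ : IsClosedEmbedding ρ)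
    (L : List (OneParam G)) (v : U.smooth) :
    Continuous fun g => (((L.map U.dRep).prod (U.smoothOp g v) : U.smooth) : H) := by
  obtain ⟨m, w, a, ha, h⟩ := U.exists_conj_expansion hρ L v
  have e : (fun g => (((L.map U.dRep).prod (U.smoothOp g v) : U.smooth) : H))
      = fun g => U.op g (∑ i, (a i g : ℂ) • (w i : H)) := by
    ext g
    have := LinearMap.congr_fun (U.prod_dRep_mul_smoothOp L g) v
    rw [Module.End.mul_apply] at this
    rw [this, Module.End.mul_apply, h, coe_smoothOp, Submodule.coe_sum]
    rfl
  rw [e]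
  have hsum : Continuous fun g => ∑ i, (a i g : ℂ) • (w i : H) := continuous_finsetSum _ fun i _ =>
    (Complex.continuous_ofReal.comp (ha i)).smul (continuous_const (y := (w i : H)))
  exact U.continuous_op_uncurry.comp (continuous_id.prodMk hsum)

end Lie

/-! ### Operators with adjoints and continuous orbits -/

/-- An operator on smooth vectors which has a formal adjoint, and for which the images of the
orbits `g ↦ U(g) v` are continuous. -/
structure IsTame (U : UnitaryRep G H) (T : Module.End ℂ U.smooth) : Prop where
  continuous : ∀ v : U.smooth, Continuous fun g => ((T (U.smoothOp g v) : U.smooth) : H)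
  exists_adjoint : ∃ T' : Module.End ℂ U.smooth, ∀ v w : U.smooth,
    inner ℂ (v : H) (T w : H) = inner ℂ (T' v : H) (w : H)

theorem IsTame.add {U : UnitaryRep G H} {S T : Module.End ℂ U.smooth} (hS : U.IsTame S)
    (hT : U.IsTame T) : U.IsTame (S + T) := by
  obtain ⟨S', hS'⟩ := hS.exists_adjoint
  obtain ⟨T', hT'⟩ := hT.exists_adjoint
  refine ⟨fun v => (hS.continuous v).add (hT.continuous v), S' + T', fun v w => ?_⟩
  simp only [LinearMap.add_apply, Submodule.coe_add, inner_add_left, inner_add_right, hS', hT']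

theorem IsTame.smul {U : UnitaryRep G H} {T : Module.End ℂ U.smooth} (c : ℂ)
    (hT : U.IsTame T) : U.IsTame (c • T) := by
  obtain ⟨T', hT'⟩ := hT.exists_adjoint
  refine ⟨fun v => (hT.continuous v).const_smul c, (starRingEnd ℂ c) • T', fun v w => ?_⟩
  simp only [LinearMap.smul_apply, Submodule.coe_smul, inner_smul_left, inner_smul_right, hT',
    Complex.conj_conj]

theorem isTame_prod_dRep (U : UnitaryRep G H) {𝒜 : Type*} [NormedRing 𝒜] [NormedAlgebra ℝ 𝒜]
    [FiniteDimensional ℝ 𝒜] {ρ : G →* 𝒜} (hρ : IsClosedEmbedding ρ) (L : List (OneParam G)) :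
    U.IsTame (L.map U.dRep).prod := by
  refine ⟨U.continuous_prod_dRep_smoothOp hρ L, ?_⟩
  induction L with
  | nil => exact ⟨1, fun v w => by simp⟩
  | cons φ L ih =>
    obtain ⟨T', hT'⟩ := ih
    refine ⟨-(T' * U.dRep φ), fun v w => ?_⟩
    simp [inner_dRep_right, hT']

theorem isTame_of_mem_adjoin (U : UnitaryRep G H) {𝒜 : Type*} [NormedRing 𝒜] [NormedAlgebra ℝ 𝒜]
    [FiniteDimensional ℝ 𝒜] {ρ : G →* 𝒜} (hρ : IsClosedEmbedding ρ) {T : Module.End ℂ U.smooth}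
    (hT : T ∈ Algebra.adjoin ℂ (Set.range U.dRep)) : U.IsTame T := by
  rw [← Subalgebra.mem_toSubmodule, Algebra.adjoin_eq_span] at hT
  induction hT using Submodule.span_induction with
  | mem x hx =>
    obtain ⟨l, hl, rfl⟩ := Submonoid.exists_list_of_mem_closure hx
    choose! f hf using hl
    have : l = (l.map f).map U.dRep := by
      rw [List.map_map]
      conv_lhs => rw [← List.map_id l]
      exact List.map_congr_left fun y hy => (hf y hy).symm
    rw [this]
    exact U.isTame_prod_dRep hρ _
  | zero => exact ⟨fun v => by simpa using continuous_const, 0, fun v w => by simp⟩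
  | add x y _ _ hx hy => exact hx.add hy
  | smul c x _ hx => exact hx.smul c

/-- T may be unbounded and cannot simply be exchanged with a derivative. Tested against a smooth w,
the adjoint moves T onto w, and the fundamental theorem of calculus gives T U(φ(t))v = Tv + ∫₀ᵗ T
U(φ(s)) dU(φ)v ds, first weakly and then by density in H. The integrand is norm continuous, hence
the derivative exists in norm. -/
theorem IsTame.hasDerivAt {U : UnitaryRep G H} {T : Module.End ℂ U.smooth} (hT : U.IsTame T)
    (hd : Dense (U.smooth : Set H)) (φ : OneParam G) (v : U.smooth) (t : ℝ) :
    HasDerivAt (fun t : ℝ => ((T (U.smoothOp (φ (Multiplicative.ofAdd t)) v) : U.smooth) : H))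
      ((T (U.dRep φ (U.smoothOp (φ (Multiplicative.ofAdd t)) v)) : U.smooth) : H) t := by
  obtain ⟨T', hT'⟩ := hT.exists_adjoint
  set k : ℝ → H := fun s => ((T (U.smoothOp (φ (Multiplicative.ofAdd s)) (U.dRep φ v)) :
    U.smooth) : H) with hk
  have hkc : Continuous k := (hT.continuous (U.dRep φ v)).comp φ.continuous_ofAdd
  have key : ∀ t : ℝ, ((T (U.smoothOp (φ (Multiplicative.ofAdd t)) v) : U.smooth) : H)
      = (T v : H) + ∫ s in (0 : ℝ)..t, k s := by
    intro t
    refine hd.eq_of_inner_right (𝕜 := ℂ) fun w hw => ?_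
    lift w to U.smooth using hw
    have h1 : ∀ s : ℝ, HasDerivAt (fun s : ℝ => inner ℂ (T' w : H)
        (U.op (φ (Multiplicative.ofAdd s)) (v : H))) (inner ℂ (w : H) (k s)) s := by
      intro s
      have := (hasDerivAt_const s (T' w : H)).inner ℂ (U.op_hasDerivAt φ v s)
      rw [hk, hT']
      simpa [coe_smoothOp] using this
    have h2 := intervalIntegral.integral_eq_sub_of_hasDerivAt (a := 0) (b := t)
      (fun s _ => h1 s) ((continuous_const.inner hkc).intervalIntegrable _ _)
    rw [inner_add_right, hT', hT', coe_smoothOp]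
    have h3 : inner ℂ (w : H) (∫ s in (0 : ℝ)..t, k s) = ∫ s in (0 : ℝ)..t, inner ℂ (w : H) (k s) :=
      ((innerSL ℂ (w : H)).intervalIntegral_comp_comm (hkc.intervalIntegrable _ _)).symm
    rw [h3, h2, φ.map_ofAdd_zero, op_one]
    ring
  rw [U.dRep_smoothOp_self]
  have h4 : HasDerivAt (fun t : ℝ => (T v : H) + ∫ s in (0 : ℝ)..t, k s) (k t) t :=
    (intervalIntegral.integral_hasDerivAt_right (hkc.intervalIntegrable _ _)
      hkc.aestronglyMeasurable.stronglyMeasurableAtFilter hkc.continuousAt).const_add _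
  exact h4.congr_of_eventuallyEq (Filter.Eventually.of_forall key)

/-- A tame operator which commutes with the generator of a one-parameter group commutes with the
group. -/
theorem IsTame.commute_smoothOp {U : UnitaryRep G H} {T : Module.End ℂ U.smooth} (hT : U.IsTame T)
    (hd : Dense (U.smooth : Set H)) {φ : OneParam G} (h : Commute T (U.dRep φ)) (t : ℝ) :
    Commute T (U.smoothOp (φ (Multiplicative.ofAdd t))) := by
  ext v
  refine hd.eq_of_inner_right (𝕜 := ℂ) fun w hw => ?_
  lift w to U.smooth using hw
  rw [← U.op_op_inv (φ (Multiplicative.ofAdd t)) (w : H)]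
  have hw' : U.op (φ (Multiplicative.ofAdd t))⁻¹ (w : H)
    = ((U.smoothOp (φ (Multiplicative.ofAdd t))⁻¹ w : U.smooth) : H) := rfl
  rw [hw']
  generalize U.smoothOp (φ (Multiplicative.ofAdd t))⁻¹ w = w
  -- The function s ↦ ⟨U(φ(s))w, T U(φ(s))v⟩ has derivative zero because dU(φ) is skew and commutes
  -- with T. Its values at s = t and s = 0 give the claim.
  have h1 : ∀ s : ℝ, HasDerivAt (fun s : ℝ => inner ℂ (U.op (φ (Multiplicative.ofAdd s)) (w : H))
      ((T (U.smoothOp (φ (Multiplicative.ofAdd s)) v) : U.smooth) : H)) 0 s := by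
    intro s
    have h2 := (U.op_hasDerivAt φ w s).inner ℂ (hT.hasDerivAt hd φ v s)
    have h3 : T (U.dRep φ (U.smoothOp (φ (Multiplicative.ofAdd s)) v))
        = U.dRep φ (T (U.smoothOp (φ (Multiplicative.ofAdd s)) v)) := LinearMap.congr_fun h _
    have h4 := U.inner_dRep_right φ (U.smoothOp (φ (Multiplicative.ofAdd s)) w)
      (T (U.smoothOp (φ (Multiplicative.ofAdd s)) v))
    rw [U.dRep_smoothOp_self] at h4
    rw [h3] at h2
    simp only [coe_smoothOp] at h4
    rwa [h4, neg_add_cancel] at h2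
  have h5 := is_const_of_deriv_eq_zero (fun s => (h1 s).differentiableAt)
    (fun s => (h1 s).deriv) t 0
  simp only [φ.map_ofAdd_zero, op_one, smoothOp_one, Module.End.one_apply] at h5
  rw [Module.End.mul_apply, h5, Module.End.mul_apply, coe_smoothOp, inner_op]

/-! ### Distribution vectors along one-parameter groups -/

/-- ψ is dominated by finitely many seminorms, and in each of them the difference quotient of the
orbit converges, since words in the generators are tame. Conjugate-linearity is harmless because the
increment s - t is real. -/
theorem IsDistribution.hasDerivAt {U : UnitaryRep G H} {𝒜 : Type*} [NormedRing 𝒜]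
    [NormedAlgebra ℝ 𝒜] [FiniteDimensional ℝ 𝒜] {ρ : G →* 𝒜} (hρ : IsClosedEmbedding ρ)
    {ψ : U.smooth →ₗ⋆[ℂ] ℂ} (hψ : U.IsDistribution ψ) (φ : OneParam G) (v : U.smooth) (t : ℝ) :
    HasDerivAt (fun t : ℝ => ψ (U.smoothOp (φ (Multiplicative.ofAdd t)) v))
      (ψ (U.dRep φ (U.smoothOp (φ (Multiplicative.ofAdd t)) v))) t := by
  obtain ⟨S, C, hC⟩ := hψ
  rw [hasDerivAt_iff_isLittleO]
  have h1 : ∀ L ∈ S, (fun s : ℝ => ‖(((L.map U.dRep).prod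
      (U.smoothOp (φ (Multiplicative.ofAdd s)) v - U.smoothOp (φ (Multiplicative.ofAdd t)) v
        - ((s - t : ℝ) : ℂ) • U.dRep φ (U.smoothOp (φ (Multiplicative.ofAdd t)) v)) : U.smooth) : H)‖)
      =o[𝓝 t] fun s => s - t := by
    intro L _
    have h2 := hasDerivAt_iff_isLittleO.1
      ((U.isTame_prod_dRep hρ L).hasDerivAt (U.dense_smooth hρ) φ v t)
    refine h2.norm_left.congr_left fun s => ?_
    rw [map_sub, map_sub, map_smul, Submodule.coe_sub, Submodule.coe_sub, Submodule.coe_smul,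
      Complex.coe_smul]
  refine Asymptotics.IsBigO.trans_isLittleO ?_ (Asymptotics.IsLittleO.sum h1)
  refine Asymptotics.IsBigO.of_bound C (Filter.Eventually.of_forall fun s => ?_)
  have h3 := hC (U.smoothOp (φ (Multiplicative.ofAdd s)) v
    - U.smoothOp (φ (Multiplicative.ofAdd t)) v
    - ((s - t : ℝ) : ℂ) • U.dRep φ (U.smoothOp (φ (Multiplicative.ofAdd t)) v))
  rw [map_sub, map_sub, LinearMap.map_smulₛₗ, Complex.conj_ofReal, smul_eq_mul] at h3
  rw [Finset.sum_apply, Real.norm_of_nonneg (Finset.sum_nonneg fun _ _ => norm_nonneg _)]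
  simpa [Complex.real_smul] using h3

theorem IsDistribution.invariant {U : UnitaryRep G H} {𝒜 : Type*} [NormedRing 𝒜]
    [NormedAlgebra ℝ 𝒜] [FiniteDimensional ℝ 𝒜] {ρ : G →* 𝒜} (hρ : IsClosedEmbedding ρ)
    {ψ : U.smooth →ₗ⋆[ℂ] ℂ} (hψ : U.IsDistribution ψ) {φ : OneParam G}
    (h : ∀ v, ψ (U.dRep φ v) = 0) (t : ℝ) (v : U.smooth) :
    ψ (U.smoothOp (φ (Multiplicative.ofAdd t)) v) = ψ v := by
  have h5 := is_const_of_deriv_eq_zero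
    (fun s => (IsDistribution.hasDerivAt hρ hψ φ v s).differentiableAt)
    (fun s => by rw [(IsDistribution.hasDerivAt hρ hψ φ v s).deriv, h]) t 0
  simpa [smoothOp_one] using h5

theorem IsDistribution.dRep_eq_zero {U : UnitaryRep G H} {𝒜 : Type*} [NormedRing 𝒜]
    [NormedAlgebra ℝ 𝒜] [FiniteDimensional ℝ 𝒜] {ρ : G →* 𝒜} (hρ : IsClosedEmbedding ρ)
    {ψ : U.smooth →ₗ⋆[ℂ] ℂ} (hψ : U.IsDistribution ψ) {φ : OneParam G}
    (h : ∀ (t : ℝ) (v : U.smooth), ψ (U.smoothOp (φ (Multiplicative.ofAdd t)) v) = ψ v)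
    (v : U.smooth) : ψ (U.dRep φ v) = 0 := by
  have h1 := IsDistribution.hasDerivAt hρ hψ φ v 0
  simp only [h, φ.map_ofAdd_zero, smoothOp_one, Module.End.one_apply] at h1
  exact h1.unique (hasDerivAt_const _ _)

end UnitaryRep

end EuclideanCover

end

noncomputable section

namespace EuclideanCover

open Topology

/-! ### Elements of the Clifford algebra which commute with vectors -/

section Clifford

variable {n : ℕ}

/-- Contraction with the basis vector `e_j`. -/
def contr (j : Fin n) : Cl n →ₗ[ℝ] Cl n :=
  CliffordAlgebra.contractLeft (innerₗ (EuclideanSpace ℝ (Fin n)) (EuclideanSpace.single j 1))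

theorem gen_mul_vec (j : Fin n) (v : EuclideanSpace ℝ (Fin n)) :
    gen j * vec v = -(vec v * gen j) + algebraMap ℝ (Cl n) (2 * v j) := by
  have h := CliffordAlgebra.ι_mul_ι_add_swap (Q := normForm n) (EuclideanSpace.single j 1) v
  rw [gen, eq_neg_add_iff_add_eq, add_comm, h]
  congr 1
  rw [QuadraticMap.polar, normForm_apply, normForm_apply, normForm_apply, inner_add_left,
    inner_add_right, inner_add_right]
  simp only [EuclideanSpace.inner_single_left, EuclideanSpace.inner_single_right]
  simp
  ring

theorem contr_vec_mul (j : Fin n) (v : EuclideanSpace ℝ (Fin n)) (x : Cl n) :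
    contr j (vec v * x) = v j • x - vec v * contr j x := by
  rw [contr, CliffordAlgebra.contractLeft_ι_mul, innerₗ_apply_apply,
    EuclideanSpace.inner_single_left]
  simp

theorem contr_gen_mul_self (j : Fin n) (x : Cl n) :
    contr j (gen j * x) = x - gen j * contr j x := by
  rw [gen, contr_vec_mul]
  simp

theorem contr_gen_mul {i j : Fin n} (h : i ≠ j) (x : Cl n) :
    contr j (gen i * x) = -(gen i * contr j x) := by
  rw [gen, contr_vec_mul]
  simp [h.symm]

/-- The graded commutator with e_j is twice the contraction by e_j. This turns commutation with
basis vectors into vanishing of contractions. -/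
theorem gen_mul_eq (j : Fin n) (x : Cl n) :
    gen j * x = CliffordAlgebra.involute x * gen j + (2 : ℝ) • contr j x := by
  induction x using CliffordAlgebra.left_induction with
  | algebraMap r =>
    rw [AlgHom.commutes, contr, CliffordAlgebra.contractLeft_algebraMap, smul_zero, add_zero]
    exact (Algebra.commutes r _).symm
  | add x y hx hy =>
    rw [mul_add, hx, hy, map_add, map_add, smul_add, add_mul]
    abel
  | ι_mul x v hx =>
    rw [contr_vec_mul, ← mul_assoc, gen_mul_vec, add_mul, neg_mul, mul_assoc, hx,
      ← Algebra.smul_def, map_mul, CliffordAlgebra.involute_ι, smul_sub, smul_smul, mul_add,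
      mul_smul_comm]
    simp only [mul_assoc, neg_mul]
    abel

theorem contr_eq_zero_of_commute {j : Fin n} {x : Cl n} (hx : CliffordAlgebra.involute x = x)
    (h : gen j * x = x * gen j) : contr j x = 0 := by
  have := gen_mul_eq j x
  rw [hx, h, left_eq_add] at this
  exact (smul_eq_zero.1 this).resolve_left two_ne_zero

/-- The subalgebra generated by some of the basis vectors. -/
def genAdjoin (S : Set (Fin n)) : Subalgebra ℝ (Cl n) := Algebra.adjoin ℝ (gen '' S)

theorem genAdjoin_univ : genAdjoin (Set.univ : Set (Fin n)) = ⊤ := by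
  rw [eq_top_iff, ← CliffordAlgebra.adjoin_range_ι, Algebra.adjoin_le_iff]
  rintro _ ⟨v, rfl⟩
  have h : v = ∑ i, v i • EuclideanSpace.single i (1 : ℝ) := by
    ext i
    simp [Finset.sum_apply, Pi.single_apply]
  rw [h, map_sum]
  refine Subalgebra.sum_mem _ fun i _ => ?_
  rw [map_smul]
  exact Subalgebra.smul_mem _ (Algebra.subset_adjoin (Set.mem_image_of_mem _ (Set.mem_univ i))) _

/-- Every x is y + e_j z with y and z free of e_j, where z is the contraction. Multiplication by e_j
exchanges y and z, and multiplication by another e_i acts on both up to sign. -/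
theorem contr_mem_genAdjoin {S : Set (Fin n)} (j : Fin n) {x : Cl n} (hx : x ∈ genAdjoin S) :
    x - gen j * contr j x ∈ genAdjoin (S \ {j}) ∧ contr j x ∈ genAdjoin (S \ {j}) := by
  rw [genAdjoin, ← Subalgebra.mem_toSubmodule, Algebra.adjoin_eq_span] at hx
  induction hx using Submodule.span_induction with
  | mem x hx =>
    induction hx using Submonoid.closure_induction_left with
    | one =>
      have h1 : contr j (1 : Cl n) = 0 := CliffordAlgebra.contractLeft_one (Q := normForm n) _
      rw [h1, mul_zero, sub_zero]
      exact ⟨one_mem _, zero_mem _⟩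
    | mul_left y hy x _ ih =>
      obtain ⟨i, hi, rfl⟩ := hy
      by_cases hij : i = j
      · subst hij
        rw [contr_gen_mul_self, mul_sub, ← mul_assoc, gen_sq, one_mul, sub_sub_cancel]
        exact ih.symm
      · have hmem : gen i ∈ genAdjoin (S \ {j}) := Algebra.subset_adjoin ⟨i, ⟨hi, hij⟩, rfl⟩
        have e : gen i * x - gen j * contr j (gen i * x) = gen i * (x - gen j * contr j x) := by
          rw [contr_gen_mul hij, mul_sub, mul_neg, ← mul_assoc, gen_anticomm (Ne.symm hij),
            neg_mul, neg_neg, mul_assoc]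
        rw [e, contr_gen_mul hij]
        exact ⟨mul_mem hmem ih.1, neg_mem (mul_mem hmem ih.2)⟩
  | zero => simp [zero_mem]
  | add x y _ _ hx hy =>
    rw [map_add, mul_add, add_sub_add_comm]
    exact ⟨add_mem hx.1 hy.1, add_mem hx.2 hy.2⟩
  | smul c x _ hx =>
    rw [map_smul, mul_smul_comm, ← smul_sub]
    exact ⟨Subalgebra.smul_mem _ hx.1 c, Subalgebra.smul_mem _ hx.2 c⟩

theorem mem_genAdjoin_of_contr_eq_zero (T : Finset (Fin n)) {x : Cl n}
    (h : ∀ j ∈ T, contr j x = 0) : x ∈ genAdjoin ((T : Set (Fin n))ᶜ) := by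
  induction T using Finset.induction_on with
  | empty => simp [genAdjoin_univ]
  | insert j T _ ih =>
    have h1 := (contr_mem_genAdjoin j (ih fun i hi => h i (Finset.mem_insert_of_mem hi))).1
    rw [h j (Finset.mem_insert_self _ _), mul_zero, sub_zero] at h1
    convert h1 using 2
    ext i
    simp [not_or, and_comm]

theorem exists_eq_algebraMap {x : Cl n} (h : ∀ j, contr j x = 0) : ∃ a : ℝ, x = algebraMap ℝ _ a := by
  have h1 := mem_genAdjoin_of_contr_eq_zero Finset.univ (x := x) fun j _ => h j
  rw [genAdjoin, Finset.coe_univ, Set.compl_univ, Set.image_empty, Algebra.adjoin_empty] at h1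
  obtain ⟨a, ha⟩ := Algebra.mem_bot.1 h1
  exact ⟨a, ha.symm⟩

theorem exists_eq_add_smul_gen {x : Cl n} {i : Fin n} (h : ∀ j ≠ i, contr j x = 0) :
    ∃ a b : ℝ, x = a • 1 + b • gen i := by
  have h1 := mem_genAdjoin_of_contr_eq_zero (Finset.univ.erase i) (x := x) fun j hj =>
    h j (Finset.ne_of_mem_erase hj)
  have h2 : ((Finset.univ.erase i : Finset (Fin n)) : Set (Fin n))ᶜ = {i} := by ext; simp
  rw [genAdjoin, h2, Set.image_singleton] at h1
  clear h
  induction h1 using Algebra.adjoin_induction with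
  | mem y hy =>
    rw [Set.mem_singleton_iff.1 hy]
    exact ⟨0, 1, by simp⟩
  | algebraMap r => exact ⟨r, 0, by simp [Algebra.algebraMap_eq_smul_one]⟩
  | add y z _ _ hy hz =>
    obtain ⟨a, b, rfl⟩ := hy
    obtain ⟨a', b', rfl⟩ := hz
    exact ⟨a + a', b + b', by module⟩
  | mul y z _ _ hy hz =>
    obtain ⟨a, b, rfl⟩ := hy
    obtain ⟨a', b', rfl⟩ := hz
    refine ⟨a * a' + b * b', a * b' + b * a', ?_⟩
    simp only [add_mul, mul_add, smul_mul_smul_comm, one_mul, mul_one, gen_sq]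
    module

/-- Here x = a + b e_i, and anticommuting with e_i forces a e_i + b = 0. This excludes an even
element which would act as the reflection in e_i. -/
theorem eq_zero_of_anticommute {x : Cl n} {i : Fin n} (h : ∀ j ≠ i, contr j x = 0)
    (hi : gen i * x = -(x * gen i)) : x = 0 := by
  obtain ⟨a, b, rfl⟩ := exists_eq_add_smul_gen h
  have h1 : a • gen i + b • (1 : Cl n) = 0 := by
    simp only [add_mul, mul_add, smul_mul_assoc, mul_smul_comm, one_mul, mul_one, gen_sq] at hi
    have h2 : (2 : ℝ) • (a • gen i + b • (1 : Cl n)) = 0 := by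
      rw [eq_neg_iff_add_eq_zero] at hi
      rw [← hi]
      module
    exact (smul_eq_zero.1 h2).resolve_left two_ne_zero
  have h2 := congrArg (fun y => gen i * y) h1
  simpa only [mul_add, mul_smul_comm, gen_sq, mul_one, mul_zero] using h2

end Clifford

/-! ### Rotations -/

section Spin

variable {n : ℕ}

theorem spin_mul_vec (s : Spin n) (v : EuclideanSpace ℝ (Fin n)) :
    (s : Cl n) * vec v = vec (spinRot s v) * (s : Cl n) := by
  rw [vec_spinRot, mul_assoc, ← Submonoid.coe_mul, inv_mul_cancel]
  simp

theorem spinRot_eq_iff (s : Spin n) (v w : EuclideanSpace ℝ (Fin n)) :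
    spinRot s v = w ↔ (s : Cl n) * vec v = vec w * (s : Cl n) := by
  rw [spin_mul_vec]
  refine ⟨fun h => by rw [h], fun h => vec_injective ?_⟩
  have h1 := congrArg (fun x => x * ((s⁻¹ : Spin n) : Cl n)) h
  simpa only [mul_assoc, ← Submonoid.coe_mul, mul_inv_cancel, Submonoid.coe_one, mul_one] using h1

theorem spinRot_smul (s : Spin n) (c : ℝ) (v : EuclideanSpace ℝ (Fin n)) :
    spinRot s (c • v) = c • spinRot s v := by
  rw [spinRot_eq_iff, map_smul, map_smul, mul_smul_comm, spin_mul_vec, smul_mul_assoc]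

/-- The rotation as a linear map. -/
def spinRotₗ (s : Spin n) : EuclideanSpace ℝ (Fin n) →ₗ[ℝ] EuclideanSpace ℝ (Fin n) where
  toFun := spinRot s
  map_add' := spinRot_add s
  map_smul' := spinRot_smul s

theorem inner_spinRot_self (s : Spin n) (v : EuclideanSpace ℝ (Fin n)) :
    inner ℝ (spinRot s v) (spinRot s v) = inner ℝ v v := by
  rw [← normForm_apply, ← normForm_apply]
  apply (algebraMap ℝ (Cl n)).injective
  rw [← CliffordAlgebra.ι_sq_scalar, vec_spinRot]
  have h1 : ((s⁻¹ : Spin n) : Cl n) * (s : Cl n) = 1 := by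
    rw [← Submonoid.coe_mul, inv_mul_cancel, Submonoid.coe_one]
  have h2 : (s : Cl n) * ((s⁻¹ : Spin n) : Cl n) = 1 := by
    rw [← Submonoid.coe_mul, mul_inv_cancel, Submonoid.coe_one]
  calc (s : Cl n) * vec v * ((s⁻¹ : Spin n) : Cl n) * (s * vec v * ((s⁻¹ : Spin n) : Cl n))
      = s * vec v * (((s⁻¹ : Spin n) : Cl n) * s) * vec v * ((s⁻¹ : Spin n) : Cl n) := by
        simp only [mul_assoc]
    _ = s * (vec v * vec v) * ((s⁻¹ : Spin n) : Cl n) := by rw [h1]; simp only [mul_assoc, one_mul]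
    _ = _ := by
        rw [CliffordAlgebra.ι_sq_scalar, ← Algebra.commutes, mul_assoc, h2, mul_one]

theorem norm_spinRot (s : Spin n) (v : EuclideanSpace ℝ (Fin n)) : ‖spinRot s v‖ = ‖v‖ := by
  rw [norm_eq_sqrt_real_inner, norm_eq_sqrt_real_inner, inner_spinRot_self]

theorem inner_spinRot (s : Spin n) (v w : EuclideanSpace ℝ (Fin n)) :
    inner ℝ (spinRot s v) (spinRot s w) = inner ℝ v w :=
  (LinearIsometry.mk (spinRotₗ s) (norm_spinRot s)).inner_map_map v w

/-- The rotor as an element of the spin group. -/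
def spinRotor (k l : Fin n) (h : k ≠ l) (t : ℝ) : Spin n := ⟨rotor k l t, rotor_mem h t⟩

theorem continuous_spinRotor (k l : Fin n) (h : k ≠ l) : Continuous (spinRotor k l h) := by
  have h2 : Continuous fun t : ℝ => t / 2 := continuous_id.div_const 2
  have h3 : Continuous fun t : ℝ => (rotor k l t : Cl n) :=
    ((Real.continuous_cos.comp h2).smul (continuous_const (y := (1 : Cl n)))).add
      ((Real.continuous_sin.comp h2).smul (continuous_const (y := (gen k * gen l : Cl n))))
  exact h3.subtype_mk fun t => rotor_mem h t

theorem isCompact_range_spinRotor (k l : Fin n) (h : k ≠ l) :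
    IsCompact (Set.range (spinRotor k l h)) := by
  -- The period is 4π rather than 2π because of the half angles: at 2π the rotor is -1.
  have hp : Function.Periodic (spinRotor k l h) (4 * Real.pi) := by
    intro t
    apply Subtype.ext
    change rotor k l _ = rotor k l _
    have : (t + 4 * Real.pi) / 2 = t / 2 + 2 * Real.pi := by ring
    rw [rotor, rotor, this, Real.cos_add_two_pi, Real.sin_add_two_pi]
  rw [← hp.image_Icc (by positivity) 0]
  exact isCompact_Icc.image (continuous_spinRotor k l h)

theorem spinRot_spinRotor (k l : Fin n) (h : k ≠ l) (t : ℝ) (v : EuclideanSpace ℝ (Fin n)) :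
    spinRot (spinRotor k l h t) v = v
      + ((Real.cos t - 1) * v k + Real.sin t * v l) • EuclideanSpace.single k 1
      + ((Real.cos t - 1) * v l - Real.sin t * v k) • EuclideanSpace.single l 1 := by
  rw [spinRot_eq_iff]
  simp only [map_add, map_smul]
  change rotor k l t * vec v = (vec v + _ • gen k + _ • gen l) * rotor k l t
  have hB : gen k * gen l * vec v
      = vec v * (gen k * gen l) + (2 * v l) • gen k - (2 * v k) • gen l := by
    rw [mul_assoc, gen_mul_vec, mul_add, mul_neg, ← mul_assoc, gen_mul_vec,
      ← Algebra.commutes, ← Algebra.smul_def, add_mul, ← Algebra.smul_def]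
    simp only [mul_assoc, neg_mul]
    abel
  have hk : gen k * (gen k * gen l) = gen l := by rw [← mul_assoc, gen_sq, one_mul]
  have hl : gen l * (gen k * gen l) = -gen k := by
    rw [gen_anticomm h, mul_neg, ← mul_assoc, gen_sq, one_mul]
  have hc : Real.cos t = Real.cos (t / 2) ^ 2 - Real.sin (t / 2) ^ 2 := by
    rw [← Real.cos_two_mul']; ring_nf
  have hs : Real.sin t = 2 * Real.sin (t / 2) * Real.cos (t / 2) := by
    rw [← Real.sin_two_mul]; ring_nf
  have h1 := Real.sin_sq_add_cos_sq (t / 2)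
  simp only [rotor, add_mul, mul_add, smul_mul_assoc, mul_smul_comm, one_mul, mul_one, hB, hk, hl,
    hc, hs]
  set c := Real.cos (t / 2)
  set s := Real.sin (t / 2)
  match_scalars <;> (try ring)
  · linear_combination (-s * v l - c * v k) * h1
  · linear_combination (s * v k - c * v l) * h1

theorem spinRot_spinRotor_left (k l : Fin n) (h : k ≠ l) (t : ℝ) (v : EuclideanSpace ℝ (Fin n)) :
    spinRot (spinRotor k l h t) v k = Real.cos t * v k + Real.sin t * v l := by
  rw [spinRot_spinRotor]
  simp [h]
  ring

theorem spinRot_spinRotor_right (k l : Fin n) (h : k ≠ l) (t : ℝ) (v : EuclideanSpace ℝ (Fin n)) :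
    spinRot (spinRotor k l h t) v l = Real.cos t * v l - Real.sin t * v k := by
  rw [spinRot_spinRotor]
  simp [h.symm]
  ring

theorem spinRot_spinRotor_of_ne (k l : Fin n) (h : k ≠ l) (t : ℝ) (v : EuclideanSpace ℝ (Fin n))
    {i : Fin n} (hk : i ≠ k) (hl : i ≠ l) : spinRot (spinRotor k l h t) v i = v i := by
  rw [spinRot_spinRotor]
  simp [hk, hl]

/-! ### Generation of the spin group by rotors -/

/-- The subgroup generated by the rotations in the planes of the first `J` basis vectors. -/
def rotorGroup (n J : ℕ) : Subgroup (Spin n) :=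
  Subgroup.closure {s | ∃ (k l : Fin n) (h : k ≠ l) (t : ℝ),
    (k : ℕ) < J ∧ (l : ℕ) < J ∧ s = spinRotor k l h t}

theorem spinRotor_mem_rotorGroup {J : ℕ} {k l : Fin n} (h : k ≠ l) (t : ℝ) (hk : (k : ℕ) < J)
    (hl : (l : ℕ) < J) : spinRotor k l h t ∈ rotorGroup n J :=
  Subgroup.subset_closure ⟨k, l, h, t, hk, hl, rfl⟩

theorem rotorGroup_mono {J J' : ℕ} (h : J ≤ J') : rotorGroup n J ≤ rotorGroup n J' := by
  refine Subgroup.closure_mono ?_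
  rintro _ ⟨k, l, hkl, t, hk, hl, rfl⟩
  exact ⟨k, l, hkl, t, hk.trans_le h, hl.trans_le h, rfl⟩

theorem spinRot_apply_of_mem_rotorGroup {J : ℕ} {s : Spin n} (hs : s ∈ rotorGroup n J)
    (v : EuclideanSpace ℝ (Fin n)) {i : Fin n} (hi : J ≤ i) : spinRot s v i = v i := by
  induction hs using Subgroup.closure_induction generalizing v with
  | mem s hs =>
    obtain ⟨k, l, h, t, hk, hl, rfl⟩ := hs
    exact spinRot_spinRotor_of_ne k l h t v (by rintro rfl; omega) (by rintro rfl; omega)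
  | one => rw [spinRot_one]
  | mul s t _ _ hs ht => rw [spinRot_mul, hs, ht]
  | inv s _ hs =>
    conv_rhs => rw [← spinRot_one v, ← mul_inv_cancel s, spinRot_mul]
    rw [hs]

/-- The i-th coordinate is preserved, so the unit vectors e_i and s e_i have inner product 1 and
must coincide. -/
theorem spinRot_single_of_mem_rotorGroup {J : ℕ} {s : Spin n} (hs : s ∈ rotorGroup n J)
    {i : Fin n} (hi : J ≤ i) :
    spinRot s (EuclideanSpace.single i 1) = EuclideanSpace.single i 1 := by
  have h1 := inner_spinRot_self s (EuclideanSpace.single i 1 - spinRot s⁻¹ (EuclideanSpace.single i 1))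
  have h2 : inner ℝ (EuclideanSpace.single i (1 : ℝ)) (spinRot s (EuclideanSpace.single i 1)) = 1 := by
    rw [EuclideanSpace.inner_single_left, spinRot_apply_of_mem_rotorGroup hs _ hi]
    simp
  have h3 : inner ℝ (spinRot s (EuclideanSpace.single i 1)) (spinRot s (EuclideanSpace.single i 1))
      = (1 : ℝ) := by
    rw [inner_spinRot_self]; simp
  rw [← sub_eq_zero, ← inner_self_eq_zero (𝕜 := ℝ), inner_sub_left, inner_sub_right,
    inner_sub_right, h3, h2, real_inner_comm, h2]
  simp

/-- The coordinates of a vector can be rotated away successively. -/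
theorem exists_compact_rotors_kill {j : Fin n} (m : ℕ) (hm : m ≤ j) :
    ∃ Q : Set (Spin n), IsCompact Q ∧ Q ⊆ rotorGroup n (j + 1) ∧ ∀ v : EuclideanSpace ℝ (Fin n),
      ∃ q ∈ Q, (∀ i : Fin n, (i : ℕ) < m → spinRot q v i = 0) ∧ (0 < m → 0 ≤ spinRot q v j) := by
  induction m with
  | zero =>
    exact ⟨{1}, isCompact_singleton, by simp, fun v => ⟨1, rfl, by simp, by simp⟩⟩
  | succ m ih =>
    obtain ⟨Q, hQ, hQJ, h⟩ := ih (by omega)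
    let k : Fin n := ⟨m, by omega⟩
    have hkj : k ≠ j := by
      intro h
      have := congrArg Fin.val h
      simp only [k] at this
      omega
    refine ⟨(fun p : Spin n × Spin n => p.1 * p.2) '' (Set.range (spinRotor k j hkj) ×ˢ Q),
      ((isCompact_range_spinRotor k j hkj).prod hQ).image continuous_mul, ?_, fun v => ?_⟩
    · rintro _ ⟨⟨_, q⟩, ⟨⟨t, rfl⟩, hq⟩, rfl⟩
      exact mul_mem (spinRotor_mem_rotorGroup hkj t (by simp only [k]; omega) (by omega)) (hQJ hq)
    · obtain ⟨q, hq, h0, -⟩ := h v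
      set w := spinRot q v
      -- Turning by -arg z makes the k-th coordinate zero and the j-th equal to ‖z‖ ≥ 0. The angle
      -- depends on v, but the whole circle of rotors is compact.
      set z : ℂ := ⟨w j, w k⟩
      have hre : ‖z‖ * Real.cos z.arg = w j := Complex.norm_mul_cos_arg z
      have him : ‖z‖ * Real.sin z.arg = w k := Complex.norm_mul_sin_arg z
      refine ⟨_, ⟨(spinRotor k j hkj (-z.arg), q), ⟨⟨_, rfl⟩, hq⟩, rfl⟩, fun i hi => ?_, fun _ => ?_⟩
      · rw [spinRot_mul]
        change spinRot _ w i = 0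
        by_cases hik : i = k
        · rw [hik, spinRot_spinRotor_left, Real.cos_neg, Real.sin_neg, ← hre, ← him]
          ring
        · have him : (i : ℕ) ≠ m := fun h => hik (Fin.ext h)
          rw [spinRot_spinRotor_of_ne _ _ _ _ _ hik (by rintro rfl; omega)]
          exact h0 i (by omega)
      · rw [spinRot_mul]
        change 0 ≤ spinRot _ w j
        rw [spinRot_spinRotor_right, Real.cos_neg, Real.sin_neg, ← hre, ← him]
        have : Real.cos z.arg * (‖z‖ * Real.cos z.arg) - -Real.sin z.arg * (‖z‖ * Real.sin z.arg)
            = ‖z‖ := by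
          linear_combination ‖z‖ * Real.sin_sq_add_cos_sq z.arg
        rw [this]
        exact norm_nonneg _

/-- Once all coordinates below j are rotated away, only the j-th is left, and it is ±1. The sign is
controlled only if some rotation took place, hence the condition 0 < j. -/
theorem exists_compact_rotors_to_single {j : Fin n} (hj : 0 < (j : ℕ)) :
    ∃ Q : Set (Spin n), IsCompact Q ∧ Q ⊆ rotorGroup n (j + 1) ∧ ∀ v : EuclideanSpace ℝ (Fin n),
      ‖v‖ = 1 → (∀ i, j < i → v i = 0) → ∃ q ∈ Q, spinRot q v = EuclideanSpace.single j 1 := by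
  obtain ⟨Q, hQ, hQJ, h⟩ := exists_compact_rotors_kill (j := j) j le_rfl
  refine ⟨Q, hQ, hQJ, fun v hv hv0 => ?_⟩
  obtain ⟨q, hq, h0, hpos⟩ := h v
  refine ⟨q, hq, ?_⟩
  have h1 : ∀ i, i ≠ j → spinRot q v i = 0 := by
    intro i hi
    rcases lt_or_gt_of_ne hi with h2 | h2
    · exact h0 i h2
    · rw [spinRot_apply_of_mem_rotorGroup (hQJ hq) v (by exact h2), hv0 i h2]
  have h2 : spinRot q v = EuclideanSpace.single j (spinRot q v j) := by
    ext i
    by_cases hi : i = j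
    · rw [hi]; simp
    · rw [h1 i hi]; simp [hi]
  have h3 := norm_spinRot q v
  rw [h2, hv, PiLp.norm_single, Real.norm_eq_abs, abs_of_nonneg (hpos hj)] at h3
  rw [h2, h3]

/-- The kernel of Spin → SO. Such an s commutes with e_i for i ≥ 1, and s e_0 = ±e_0 by
orthogonality. With the plus sign all contractions vanish, so s is a scalar of square 1; with the
minus sign s would be zero. The scalar -1 is the rotor of angle 2π. -/
theorem spin_eq_of_fixes {J : ℕ} (hn : J ≤ n) (hJ : 2 ≤ J) {s : Spin n}
    (h : ∀ i : Fin n, 1 ≤ (i : ℕ) →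
      spinRot s (EuclideanSpace.single i 1) = EuclideanSpace.single i 1) :
    s = 1 ∨ s = spinRotor ⟨0, by omega⟩ ⟨1, by omega⟩ (by simp) (2 * Real.pi) := by
  have hinv : CliffordAlgebra.involute (s : Cl n) = s := spinGroup.involute_eq s.2
  let o : Fin n := ⟨0, by omega⟩
  have hc : ∀ i : Fin n, i ≠ o → contr i (s : Cl n) = 0 := by
    intro i hi
    have h1 : 1 ≤ (i : ℕ) := by
      rcases Nat.eq_zero_or_pos i with h0 | h0
      · exact absurd (Fin.ext h0) hi
      · exact h0
    exact contr_eq_zero_of_commute hinv (((spinRot_eq_iff s _ _).1 (h i h1)).symm)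
  have hs1 : star (s : Cl n) * (s : Cl n) = 1 := spinGroup.star_mul_self_of_mem s.2
  set w := spinRot s (EuclideanSpace.single o 1)
  have hw : w = EuclideanSpace.single o (w o) := by
    ext i
    by_cases hi : i = o
    · rw [hi]; simp
    · have h1 : 1 ≤ (i : ℕ) := by
        rcases Nat.eq_zero_or_pos i with h0 | h0
        · exact absurd (Fin.ext h0) hi
        · exact h0
      have h2 := inner_spinRot s (EuclideanSpace.single i 1) (EuclideanSpace.single o 1)
      rw [h i h1, inner_single_ne hi, EuclideanSpace.inner_single_left] at h2
      simpa [hi] using h2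
  have hn1 : |w o| = 1 := by
    have := norm_spinRot s (EuclideanSpace.single o 1)
    change ‖w‖ = _ at this
    rw [hw] at this
    simpa using this
  have hmul : (s : Cl n) * gen o = w o • (gen o * (s : Cl n)) := by
    have h1 : (s : Cl n) * gen o = vec w * s := spin_mul_vec s _
    have h2 : (EuclideanSpace.single o (w o) : EuclideanSpace ℝ (Fin n))
        = w o • EuclideanSpace.single o 1 := by ext i; simp
    rw [h1, hw, h2, map_smul, smul_mul_assoc, ← gen]
    simp
  rcases (abs_eq (zero_le_one)).1 hn1 with h1 | h1
  · rw [h1, one_smul] at hmul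
    obtain ⟨a, ha⟩ := exists_eq_algebraMap (x := (s : Cl n)) fun j => by
      by_cases hj : j = o
      · rw [hj]; exact contr_eq_zero_of_commute hinv hmul.symm
      · exact hc j hj
    rw [ha, CliffordAlgebra.star_algebraMap, ← map_mul, ← map_one (algebraMap ℝ (Cl n))] at hs1
    have h2 := (algebraMap ℝ (Cl n)).injective hs1
    rcases mul_self_eq_one_iff.1 h2 with h3 | h3
    · left
      apply Subtype.ext
      rw [ha, h3, map_one]; rfl
    · right
      apply Subtype.ext
      rw [ha, h3]
      change _ = rotor _ _ _
      rw [rotor, mul_div_cancel_left₀ _ two_ne_zero]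
      simp
  · rw [h1, neg_one_smul] at hmul
    have h2 := eq_zero_of_anticommute hc (by rw [hmul, neg_neg])
    rw [h2, mul_zero] at hs1
    exact absurd hs1.symm one_ne_zero

/-- Descent along stabilizers: if s fixes all e_i with i > j + 1, then s e_{j+1} involves only
coordinates up to j + 1, and a rotor product q from a fixed compact set takes it back to e_{j+1}, so
that q s fixes one vector more. Compactness and generation by rotors come out together. The bound 2
≤ J puts -1 into the rotor group. -/
theorem exists_compact_of_fixes {J : ℕ} (hn : J ≤ n) (hJ : 2 ≤ J) (j : ℕ) (hj : j + 1 ≤ J) :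
    ∃ Q : Set (Spin n), IsCompact Q ∧ Q ⊆ rotorGroup n J ∧ ∀ s : Spin n,
      (∀ i : Fin n, j + 1 ≤ (i : ℕ) →
        spinRot s (EuclideanSpace.single i 1) = EuclideanSpace.single i 1) → s ∈ Q := by
  induction j with
  | zero =>
    refine ⟨{1, spinRotor ⟨0, by omega⟩ ⟨1, by omega⟩ (by simp) (2 * Real.pi)},
      (Set.toFinite _).isCompact, ?_, fun s hs => spin_eq_of_fixes hn hJ hs⟩
    rintro s (rfl | rfl)
    · exact one_mem _
    · exact spinRotor_mem_rotorGroup _ _ (by simp only; omega) (by simp only; omega)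
  | succ j ih =>
    obtain ⟨Q, hQ, hQJ, h⟩ := ih (by omega)
    let k : Fin n := ⟨j + 1, by omega⟩
    obtain ⟨Q', hQ', hQJ', h'⟩ := exists_compact_rotors_to_single (j := k) (by simp [k])
    refine ⟨(fun p : Spin n × Spin n => p.1⁻¹ * p.2) '' (Q' ×ˢ Q), (hQ'.prod hQ).image
      ((continuous_spin_inv.comp continuous_fst).mul continuous_snd), ?_, fun s hs => ?_⟩
    · rintro _ ⟨⟨q', q⟩, ⟨hq', hq⟩, rfl⟩
      exact mul_mem (inv_mem (rotorGroup_mono (by simp only [k]; omega) (hQJ' hq'))) (hQJ hq)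
    · obtain ⟨q, hq, hqs⟩ := h' (spinRot s (EuclideanSpace.single k 1)) (by
        rw [norm_spinRot]; simp) fun i hi => by
          have h1 := inner_spinRot s (EuclideanSpace.single i 1) (EuclideanSpace.single k 1)
          have hi' : j + 1 < (i : ℕ) := hi
          rw [hs i (by omega), inner_single_ne hi.ne', EuclideanSpace.inner_single_left] at h1
          simpa using h1
      refine ⟨(q, q * s), ⟨hq, h _ fun i hi => ?_⟩, by simp⟩
      rw [spinRot_mul]
      by_cases hik : i = k
      · rw [hik, hqs]
      · have h2 : j + 1 ≠ (i : ℕ) := fun h => hik (Fin.ext h.symm)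
        rw [hs i (by omega)]
        exact spinRot_single_of_mem_rotorGroup (hQJ' hq) (by simp only [k]; omega)

theorem compactSpace_spin (hn : 2 ≤ n) : CompactSpace (Spin n) := by
  obtain ⟨Q, hQ, -, h⟩ := exists_compact_of_fixes (n := n) le_rfl hn (n - 1) (by omega)
  refine ⟨hQ.of_isClosed_subset isClosed_univ fun s _ => h s fun i hi => ?_⟩
  omega

theorem rotorGroup_eq_top (hn : 2 ≤ n) : rotorGroup n n = ⊤ := by
  obtain ⟨Q, -, hQ, h⟩ := exists_compact_of_fixes (n := n) le_rfl hn (n - 1) (by omega)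
  refine eq_top_iff.2 fun s _ => hQ (h s fun i hi => ?_)
  omega

/-- The place where d ≥ 2 matters: -1 lies in the little group and has to be reached by rotating in
a plane of the first d coordinates. -/
theorem littleGroup_le_rotorGroup {d : ℕ} (hd : 2 ≤ d) : littleGroup d ≤ rotorGroup (d + 1) d := by
  obtain ⟨Q, -, hQ, h⟩ := exists_compact_of_fixes (n := d + 1) (J := d) (by omega) hd (d - 1)
    (by omega)
  refine fun s hs => hQ (h s fun i hi => ?_)
  have : i = Fin.last d := Fin.ext (by simp only [Fin.val_last]; omega)
  rw [this]
  exact hs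

end Spin

end EuclideanCover

end

noncomputable section

namespace EuclideanCover

open Topology

/-! ### The covering group as a closed subgroup of a matrix algebra -/

section Embedding

variable {n : ℕ}

/-- The Clifford algebra is a Hausdorff space. -/
theorem t2Space_Cl (n : ℕ) : T2Space (Cl n) := by
  obtain ⟨N, ⟨b⟩⟩ : ∃ N, Nonempty (Module.Basis (Fin N) ℝ (Cl n)) :=
    ⟨_, ⟨Module.finBasis ℝ (Cl n)⟩⟩
  have hc : Continuous b.equivFun := IsModuleTopology.continuous_of_linearMap b.equivFun.toLinearMap
  exact T2Space.of_injective_continuous b.equivFun.injective hc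

attribute [local instance] t2Space_Cl

/-- The algebra of dual Clifford numbers, as upper triangular matrices. -/
abbrev DualCl (n : ℕ) : Type := Matrix (Fin 2) (Fin 2) (Cl n)

/-- The representation of the covering group by dual Clifford numbers. -/
def toDualCl (n : ℕ) : EucCover n →* DualCl n where
  -- The pair (v, s) goes to (1 + εv)s with ε² = 0; the identity s v = (s·v) s turns the semidirect
  -- product into multiplication.
  toFun g := !![(g.right : Cl n), vec g.left.toAdd * (g.right : Cl n); 0, (g.right : Cl n)]
  map_one' := by
    rw [Matrix.one_fin_two]
    simp
  map_mul' g h := by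
    have e : vec (g * h).left.toAdd * ((g * h).right : Cl n)
        = g.right * (vec h.left.toAdd * h.right) + vec g.left.toAdd * g.right * (h.right : Cl n) := by
      have h1 : (g * h).left.toAdd = g.left.toAdd + spinRot g.right h.left.toAdd := rfl
      rw [h1, SemidirectProduct.mul_right, map_add, add_mul, Submonoid.coe_mul,
        ← mul_assoc (vec (spinRot _ _)), ← spin_mul_vec, add_comm]
      simp only [mul_assoc]
    rw [e, Matrix.mul_fin_two]
    simp

/-- The pair (v, s) is recovered continuously from the matrix x: s is x₀₀, and v is the vector part
of x₀₁ s*. The range is cut out by the closed conditions that x₀₀ lies in the compact set Spin and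
that x is the matrix rebuilt from this pair. -/
theorem isClosedEmbedding_toDualCl (hn : 2 ≤ n) : IsClosedEmbedding (toDualCl n) := by
  obtain ⟨P, hP⟩ := LinearMap.exists_leftInverse_of_injective (vec (n := n))
    (LinearMap.ker_eq_bot.2 vec_injective)
  have hPc : Continuous P := IsModuleTopology.continuous_of_linearMap (R := ℝ) P
  have hv : Continuous (vec (n := n)) := LinearMap.continuous_of_finiteDimensional _
  have hstar : Continuous fun x : Cl n => star x :=
    IsModuleTopology.continuous_of_linearMap (R := ℝ)
      (CliffordAlgebra.reverse ∘ₗ (CliffordAlgebra.involute (Q := normForm n)).toLinearMap)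
  have hPv : ∀ v, P (vec v) = v := fun v => LinearMap.congr_fun hP v
  let M : EuclideanSpace ℝ (Fin n) × Cl n → DualCl n := fun p => !![p.2, vec p.1 * p.2; 0, p.2]
  let Λ : DualCl n → EuclideanSpace ℝ (Fin n) × Cl n := fun x => (P (x 0 1 * star (x 0 0)), x 0 0)
  let i : EucCover n → EuclideanSpace ℝ (Fin n) × Cl n := fun g => (g.left.toAdd, (g.right : Cl n))
  have hM : Continuous M := by
    refine continuous_matrix fun a b => ?_
    fin_cases a <;> fin_cases b
    · exact continuous_snd
    · exact (hv.comp continuous_fst).mul continuous_snd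
    · exact continuous_const
    · exact continuous_snd
  have hΛ : Continuous Λ :=
    (hPc.comp ((continuous_id.matrix_elem 0 1).mul (hstar.comp (continuous_id.matrix_elem 0 0)))).prodMk
      (continuous_id.matrix_elem 0 0)
  have hi : IsInducing i := by
    have h1 : IsInducing (Prod.map id Subtype.val :
        EuclideanSpace ℝ (Fin n) × Spin n → EuclideanSpace ℝ (Fin n) × Cl n) :=
      IsInducing.id.prodMap IsInducing.subtypeVal
    exact h1.comp (⟨rfl⟩ : IsInducing fun g : EucCover n => (g.left.toAdd, g.right))
  have hMi : ∀ g, toDualCl n g = M (i g) := fun g => rfl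
  have hΛM : ∀ (a : EuclideanSpace ℝ (Fin n)) (s : Spin n), Λ (M (a, s)) = (a, (s : Cl n)) := by
    intro a s
    have h1 : (s : Cl n) * star (s : Cl n) = 1 := spinGroup.mul_star_self_of_mem s.2
    change (P (vec a * (s : Cl n) * star (s : Cl n)), (s : Cl n)) = _
    rw [mul_assoc, h1, mul_one, hPv]
  have hind : IsInducing (toDualCl n) := by
    refine IsInducing.of_comp (hM.comp hi.continuous) hΛ ?_
    have : Λ ∘ toDualCl n = i := funext fun g => hΛM _ _
    rw [this]
    exact hi
  refine ⟨⟨hind, fun g h hgh => ?_⟩, ?_⟩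
  · have h1 := congrArg Λ hgh
    rw [hMi, hMi, hΛM, hΛM, Prod.mk.injEq] at h1
    exact SemidirectProduct.ext h1.1 (Subtype.ext h1.2)
  · have hr : Set.range (toDualCl n)
        = {x | x 0 0 ∈ Set.range (Subtype.val : Spin n → Cl n)} ∩ {x | M (Λ x) = x} := by
      ext x
      constructor
      · rintro ⟨g, rfl⟩
        refine ⟨⟨g.right, rfl⟩, ?_⟩
        change M (Λ (M (_, _))) = _
        rw [hΛM]
        rfl
      · rintro ⟨⟨s, hs⟩, hx⟩
        refine ⟨⟨Multiplicative.ofAdd (Λ x).1, s⟩, ?_⟩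
        rw [hMi, ← hx]
        congr 1
        change (_, (s : Cl n)) = (_, x 0 0)
        rw [hs, hx]
        rfl
    rw [hr]
    have := compactSpace_spin hn
    have hcl : IsClosed (Set.range (Subtype.val : Spin n → Cl n)) :=
      (isCompact_range continuous_subtype_val).isClosed
    exact (hcl.preimage (continuous_id.matrix_elem 0 0)).inter (isClosed_eq (hM.comp hΛ) continuous_id)

/-- A Euclidean space on which dual Clifford numbers act. -/
abbrev DualClSpace (n : ℕ) : Type := EuclideanSpace ℝ (Fin (Module.finrank ℝ (DualCl n)))

/-- A normed algebra containing the dual Clifford numbers. -/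
abbrev LinAlg (n : ℕ) : Type := DualClSpace n →L[ℝ] DualClSpace n

/-- The left regular representation of the dual Clifford numbers. -/
def dualClRep (n : ℕ) : DualCl n →ₐ[ℝ] LinAlg n :=
  ((Module.End.toContinuousLinearMap (DualClSpace n)).toAlgHom.comp
    (LinearEquiv.conjAlgEquiv ℝ (LinearEquiv.ofFinrankEq (DualCl n) (DualClSpace n)
      (by simp))).toAlgHom).comp
    (Algebra.lmul ℝ (DualCl n))

theorem dualClRep_injective (n : ℕ) : Function.Injective (dualClRep n) := by
  intro a b h
  have h1 := (Module.End.toContinuousLinearMap (DualClSpace n)).injective h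
  have h2 := (LinearEquiv.conjAlgEquiv ℝ (LinearEquiv.ofFinrankEq (DualCl n) (DualClSpace n)
      (by simp))).injective h1
  have h3 := LinearMap.congr_fun h2 1
  simpa using h3

/-- The representation of the covering group in a normed algebra. -/
def linRep (n : ℕ) : EucCover n →* LinAlg n := ((dualClRep n : DualCl n →* LinAlg n)).comp (toDualCl n)

/-- The embedding to which the Gårding arguments are applied. They need a norm on the target,
whereas `Cl n` carries only a topology; hence the passage to operators on a Euclidean space. -/
theorem isClosedEmbedding_linRep (hn : 2 ≤ n) : IsClosedEmbedding (linRep n) := by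
  have h : IsClosedEmbedding (dualClRep n).toLinearMap :=
    LinearMap.isClosedEmbedding_of_injective (LinearMap.ker_eq_bot.2 (dualClRep_injective n))
  exact h.comp (isClosedEmbedding_toDualCl hn)

/-! ### Infinitesimal generators -/

/-- An infinitesimal translation. -/
def dualTrans (x : Cl n) : DualCl n := !![0, x; 0, 0]

/-- An infinitesimal rotation. -/
def dualRot (x : Cl n) : DualCl n := !![x, 0; 0, x]

/-- `dualTrans` as a linear map. -/
def dualTransₗ : Cl n →ₗ[ℝ] DualCl n where
  toFun := dualTrans
  map_add' x y := by ext a b; fin_cases a <;> fin_cases b <;> simp [dualTrans]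
  map_smul' c x := by ext a b; fin_cases a <;> fin_cases b <;> simp [dualTrans]

/-- `dualRot` as a linear map. -/
def dualRotₗ : Cl n →ₗ[ℝ] DualCl n where
  toFun := dualRot
  map_add' x y := by ext a b; fin_cases a <;> fin_cases b <;> simp [dualRot]
  map_smul' c x := by ext a b; fin_cases a <;> fin_cases b <;> simp [dualRot]

theorem dualRot_one : dualRot (1 : Cl n) = 1 := by
  rw [dualRot, Matrix.one_fin_two]

theorem toDualCl_apply (g : EucCover n) :
    toDualCl n g = dualRotₗ (g.right : Cl n) + dualTransₗ (vec g.left.toAdd * (g.right : Cl n)) := by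
  change !![_, _; _, _] = dualRot _ + dualTrans _
  ext a b; fin_cases a <;> fin_cases b <;> simp [dualRot, dualTrans]

/-- The infinitesimal rotation in the `(k, l)`-plane. -/
def bivec (k l : Fin n) : Cl n := (1 / 4 : ℝ) • (gen k * gen l - gen l * gen k)

theorem toDualCl_transParam (k : Fin n) (t : ℝ) :
    toDualCl n (transParam k (Multiplicative.ofAdd t)) = 1 + t • dualTrans (gen k) := by
  have h1 : (transParam k (Multiplicative.ofAdd t)).left.toAdd
    = t • (EuclideanSpace.single k 1 : EuclideanSpace ℝ (Fin n)) := rfl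
  have h2 : (transParam k (Multiplicative.ofAdd t)).right = 1 := rfl
  rw [toDualCl_apply, h1, h2, LinearMap.map_smul, Submonoid.coe_one, mul_one, ← dualRot_one,
    LinearMap.map_smul]
  rfl

theorem toDualCl_rotParam {k l : Fin n} (h : k ≠ l) (t : ℝ) :
    toDualCl n (rotParam k l (Multiplicative.ofAdd t))
      = Real.cos (t / 2) • (1 : DualCl n) + Real.sin (t / 2) • dualRot (gen k * gen l) := by
  have h1 : (rotParam k l (Multiplicative.ofAdd t)).left.toAdd = 0 := by
    rw [rotParam, dif_neg h]; rfl
  have h2 : ((rotParam k l (Multiplicative.ofAdd t)).right : Cl n) = rotor k l t := by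
    rw [rotParam, dif_neg h]; rfl
  rw [toDualCl_apply, h1, h2, LinearMap.map_zero, zero_mul, LinearMap.map_zero, add_zero, rotor,
    LinearMap.map_add, LinearMap.map_smul, LinearMap.map_smul, ← dualRot_one]
  rfl

section

variable {𝒜 : Type*} [NormedRing 𝒜] [NormedAlgebra ℝ 𝒜] (Ψ : DualCl n →ₐ[ℝ] 𝒜)

theorem infGen_transParam (k : Fin n) :
    infGen ((Ψ : DualCl n →* 𝒜).comp (toDualCl n)) (transParam k) = Ψ (dualTrans (gen k)) := by
  refine infGen_eq ?_
  have h1 : ∀ t : ℝ, (Ψ : DualCl n →* 𝒜).comp (toDualCl n) (transParam k (Multiplicative.ofAdd t))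
      = 1 + t • Ψ (dualTrans (gen k)) := by
    intro t
    rw [← map_smul, ← map_one Ψ, ← map_add, ← toDualCl_transParam]
    rfl
  simp_rw [h1]
  simpa only [one_smul] using
    ((hasDerivAt_id' (0 : ℝ)).smul_const (Ψ (dualTrans (gen k)))).const_add 1

theorem infGen_rotParam (k l : Fin n) :
    infGen ((Ψ : DualCl n →* 𝒜).comp (toDualCl n)) (rotParam k l) = Ψ (dualRot (bivec k l)) := by
  refine infGen_eq ?_
  -- For k = l both sides vanish: the one-parameter group is trivial, and the antisymmetrized
  -- bivector is zero.
  by_cases h : k = l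
  · have h0 : bivec k l = 0 := by rw [bivec, h, sub_self, smul_zero]
    have h1 : dualRot (0 : Cl n) = 0 := dualRotₗ.map_zero
    have h2 : rotParam k l = 1 := by rw [rotParam, dif_pos h]
    rw [h0, h1, h2, map_zero]
    have h3 : ∀ t : ℝ, (Ψ : DualCl n →* 𝒜).comp (toDualCl n)
        ((1 : OneParam (EucCover n)) (Multiplicative.ofAdd t)) = 1 :=
      fun t => map_one _
    simp_rw [h3]
    exact hasDerivAt_const (0 : ℝ) (1 : 𝒜)
  have h1 : ∀ t : ℝ, (Ψ : DualCl n →* 𝒜).comp (toDualCl n) (rotParam k l (Multiplicative.ofAdd t))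
      = Real.cos (t / 2) • (1 : 𝒜) + Real.sin (t / 2) • Ψ (dualRot (gen k * gen l)) := by
    intro t
    rw [← map_one Ψ, ← map_smul, ← map_smul, ← map_add, ← toDualCl_rotParam h]
    rfl
  have h2 : bivec k l = (1 / 2 : ℝ) • (gen k * gen l) := by
    rw [bivec, gen_anticomm (Ne.symm h)]
    module
  have h3 : dualRot (bivec k l) = (1 / 2 : ℝ) • dualRot (gen k * gen l) := by
    rw [h2]
    exact dualRotₗ.map_smul _ _
  simp_rw [h1]
  rw [h3, map_smul]
  have hd : HasDerivAt (fun t : ℝ => t / 2) (1 / 2) 0 := (hasDerivAt_id' 0).div_const 2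
  have h4 := (hd.cos.smul_const (1 : 𝒜)).add
    (hd.sin.smul_const (Ψ (dualRot (gen k * gen l))))
  rw [zero_div, Real.sin_zero, Real.cos_zero, neg_zero, zero_mul, zero_smul, zero_add, one_mul] at h4
  exact h4

end

theorem gen_mul_gen (k l : Fin n) :
    gen k * gen l = -(gen l * gen k) + (2 * if k = l then (1 : ℝ) else 0) • 1 := by
  rw [gen, gen, ← gen, gen_mul_vec, Algebra.algebraMap_eq_smul_one]
  congr 2
  by_cases h : k = l <;> simp [h]

theorem dualTrans_mul (x y : Cl n) : dualTrans x * dualTrans y = 0 := by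
  rw [dualTrans, dualTrans, Matrix.mul_fin_two]
  ext a b; fin_cases a <;> fin_cases b <;> simp

theorem dualTrans_mul_dualRot (x y : Cl n) : dualTrans x * dualRot y = dualTrans (x * y) := by
  rw [dualTrans, dualRot, Matrix.mul_fin_two]
  simp [dualTrans]

theorem dualRot_mul_dualTrans (x y : Cl n) : dualRot x * dualTrans y = dualTrans (x * y) := by
  rw [dualTrans, dualRot, Matrix.mul_fin_two]
  simp [dualTrans]

theorem dualRot_mul_dualRot (x y : Cl n) : dualRot x * dualRot y = dualRot (x * y) := by
  rw [dualRot, dualRot, Matrix.mul_fin_two]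
  simp [dualRot]

theorem gen_lie_bivec (k l m : Fin n) :
    gen k * bivec l m - bivec l m * gen k
      = (if k = l then (1 : ℝ) else 0) • gen m - (if k = m then (1 : ℝ) else 0) • gen l := by
  have e : ∀ a b : Fin n, gen k * (gen a * gen b) = gen a * gen b * gen k
      + (2 * if k = a then (1 : ℝ) else 0) • gen b - (2 * if k = b then (1 : ℝ) else 0) • gen a := by
    intro a b
    rw [← mul_assoc, gen_mul_gen k a, add_mul, neg_mul, mul_assoc, gen_mul_gen k b, mul_add,
      mul_neg, smul_mul_assoc, one_mul, mul_smul_comm, mul_one, ← mul_assoc]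
    abel
  rw [bivec, mul_smul_comm, smul_mul_assoc, mul_sub, sub_mul, e, e]
  module

/-- The commutator with a bivector is a derivation, known on vectors by `gen_lie_bivec`; apply it to
both products e_k e_l and e_l e_k. -/
theorem bivec_lie_bivec (k l m p : Fin n) :
    bivec k l * bivec m p - bivec m p * bivec k l
      = (if k = p then (1 : ℝ) else 0) • bivec l m + (if l = m then (1 : ℝ) else 0) • bivec k p
        - (if k = m then (1 : ℝ) else 0) • bivec l p
        - (if l = p then (1 : ℝ) else 0) • bivec k m := by
  have e : ∀ a b : Fin n, gen a * gen b * bivec m p - bivec m p * (gen a * gen b)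
      = ((if a = m then (1 : ℝ) else 0) • gen p - (if a = p then (1 : ℝ) else 0) • gen m) * gen b
        + gen a * ((if b = m then (1 : ℝ) else 0) • gen p
          - (if b = p then (1 : ℝ) else 0) • gen m) := by
    intro a b
    rw [← gen_lie_bivec, ← gen_lie_bivec]
    generalize bivec m p = x
    simp only [sub_mul, mul_sub, mul_assoc]
    abel
  have e2 : bivec k l * bivec m p - bivec m p * bivec k l
      = (1 / 4 : ℝ) • ((gen k * gen l * bivec m p - bivec m p * (gen k * gen l))
        - (gen l * gen k * bivec m p - bivec m p * (gen l * gen k))) := by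
    generalize bivec m p = x
    rw [bivec, smul_mul_assoc, mul_smul_comm, ← smul_sub, sub_mul, mul_sub]
    congr 1
    abel
  rw [e2, e, e]
  simp only [bivec, sub_mul, mul_sub, smul_mul_assoc, mul_smul_comm]
  module

end Embedding

end EuclideanCover

end

noncomputable section

namespace EuclideanCover

open Topology

/-! ### Relations of the derived representation -/

section Relations

variable {n : ℕ} {H : Type*} [NormedAddCommGroup H] [InnerProductSpace ℂ H] [CompleteSpace H]
  (U : UnitaryRep (EucCover n) H)

/-- Infinitesimal translations in the normed algebra. -/
def linTrans (n : ℕ) : Cl n →ₗ[ℝ] LinAlg n := (dualClRep n).toLinearMap ∘ₗ dualTransₗ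

/-- Infinitesimal rotations in the normed algebra. -/
def linRot (n : ℕ) : Cl n →ₗ[ℝ] LinAlg n := (dualClRep n).toLinearMap ∘ₗ dualRotₗ

theorem linTrans_mul_linTrans (x y : Cl n) : linTrans n x * linTrans n y = 0 := by
  change dualClRep n (dualTrans x) * dualClRep n (dualTrans y) = 0
  rw [← map_mul, dualTrans_mul, map_zero]

theorem linTrans_mul_linRot (x y : Cl n) : linTrans n x * linRot n y = linTrans n (x * y) := by
  change dualClRep n (dualTrans x) * dualClRep n (dualRot y) = dualClRep n (dualTrans _)
  rw [← map_mul, dualTrans_mul_dualRot]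

theorem linRot_mul_linTrans (x y : Cl n) : linRot n x * linTrans n y = linTrans n (x * y) := by
  change dualClRep n (dualRot x) * dualClRep n (dualTrans y) = dualClRep n (dualTrans _)
  rw [← map_mul, dualRot_mul_dualTrans]

theorem linRot_mul_linRot (x y : Cl n) : linRot n x * linRot n y = linRot n (x * y) := by
  change dualClRep n (dualRot x) * dualClRep n (dualRot y) = dualClRep n (dualRot _)
  rw [← map_mul, dualRot_mul_dualRot]

theorem infGen_linRep_transParam (k : Fin n) :
    infGen (linRep n) (transParam k) = linTrans n (gen k) := infGen_transParam _ k

theorem infGen_linRep_rotParam (k l : Fin n) :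
    infGen (linRep n) (rotParam k l) = linRot n (bivec k l) := infGen_rotParam _ k l

theorem linRep_inSpin (s : Spin n) : linRep n (inSpin s) = linRot n (s : Cl n) := by
  change dualClRep n (toDualCl n (inSpin s)) = dualClRep n (dualRotₗ _)
  have h1 : (inSpin s).left.toAdd = 0 := rfl
  have h2 : (inSpin s).right = s := rfl
  rw [toDualCl_apply, h1, h2, LinearMap.map_zero, zero_mul, LinearMap.map_zero, add_zero]

theorem dRep_transParam_comm (hn : 2 ≤ n) (k l : Fin n) :
    U.dRep (transParam k) * U.dRep (transParam l) = U.dRep (transParam l) * U.dRep (transParam k) := by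
  have h := U.dRep_lie_eq_sum (isClosedEmbedding_linRep hn) (∅ : Finset (Fin 0)) (fun _ => 0)
    (fun _ => 1) (transParam k) (transParam l) (by
      rw [infGen_linRep_transParam, infGen_linRep_transParam, linTrans_mul_linTrans,
        linTrans_mul_linTrans, Finset.sum_empty, sub_zero])
  rwa [Finset.sum_empty, sub_eq_zero] at h

theorem dRep_rotParam_swap (hn : 2 ≤ n) (k l : Fin n) :
    U.dRep (rotParam l k) = -U.dRep (rotParam k l) := by
  have h := U.dRep_eq_sum (isClosedEmbedding_linRep hn) (Finset.univ : Finset (Fin 1))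
    (fun _ => -1) (fun _ => rotParam k l) (rotParam l k) (by
      rw [infGen_linRep_rotParam, infGen_linRep_rotParam, Fin.sum_univ_one, ← map_smul]
      congr 1
      rw [bivec, bivec]
      module)
  rw [h, Fin.sum_univ_one]
  ext1 v
  rw [LinearMap.smul_apply, LinearMap.neg_apply, Complex.ofReal_neg, Complex.ofReal_one,
    neg_one_smul]

theorem ite_end_apply {V : Type*} [AddCommGroup V] [Module ℂ V] (q : Prop) [Decidable q]
    (T : Module.End ℂ V) (v : V) :
    (if q then T else 0) v = (((if q then (1 : ℝ) else 0 : ℝ)) : ℂ) • T v := by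
  split_ifs <;> simp

theorem dRep_transParam_lie_rotParam (hn : 2 ≤ n) (k l m : Fin n) :
    U.dRep (transParam k) * U.dRep (rotParam l m) - U.dRep (rotParam l m) * U.dRep (transParam k)
      = (if k = l then U.dRep (transParam m) else 0)
        - (if k = m then U.dRep (transParam l) else 0) := by
  have h := U.dRep_lie_eq_sum (isClosedEmbedding_linRep hn) (Finset.univ : Finset (Fin 2))
    ![if k = l then 1 else 0, -(if k = m then 1 else 0)]
    ![transParam m, transParam l] (transParam k) (rotParam l m) (by
      have key := congrArg (linTrans n) (gen_lie_bivec k l m)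
      simp only [map_sub, map_smul] at key
      rw [Fin.sum_univ_two]
      simp only [Matrix.cons_val_zero, Matrix.cons_val_one, infGen_linRep_transParam,
        infGen_linRep_rotParam]
      rw [linTrans_mul_linRot, linRot_mul_linTrans, key]
      module)
  rw [h, Fin.sum_univ_two]
  simp only [Matrix.cons_val_zero, Matrix.cons_val_one]
  ext1 v
  simp only [LinearMap.add_apply, LinearMap.smul_apply, LinearMap.sub_apply, ite_end_apply,
    Complex.ofReal_neg, neg_smul]
  abel

theorem dRep_rotParam_lie_rotParam (hn : 2 ≤ n) (k l m p : Fin n) :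
    U.dRep (rotParam k l) * U.dRep (rotParam m p) - U.dRep (rotParam m p) * U.dRep (rotParam k l)
      = (if k = p then U.dRep (rotParam l m) else 0) + (if l = m then U.dRep (rotParam k p) else 0)
        - (if k = m then U.dRep (rotParam l p) else 0)
        - (if l = p then U.dRep (rotParam k m) else 0) := by
  have h := U.dRep_lie_eq_sum (isClosedEmbedding_linRep hn) (Finset.univ : Finset (Fin 4))
    ![if k = p then 1 else 0, if l = m then 1 else 0, -(if k = m then 1 else 0),
      -(if l = p then 1 else 0)]
    ![rotParam l m, rotParam k p, rotParam l p, rotParam k m] (rotParam k l) (rotParam m p) (by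
      have key := congrArg (linRot n) (bivec_lie_bivec k l m p)
      simp only [map_add, map_sub, map_smul] at key
      rw [Fin.sum_univ_four]
      simp only [Matrix.cons_val, infGen_linRep_rotParam]
      rw [linRot_mul_linRot, linRot_mul_linRot, key]
      module)
  rw [h, Fin.sum_univ_four]
  simp only [Matrix.cons_val]
  ext1 v
  simp only [LinearMap.add_apply, LinearMap.smul_apply, LinearMap.sub_apply, ite_end_apply,
    Complex.ofReal_neg, neg_smul]
  abel

/-- In the Clifford algebra conjugation by s takes e_k to s·e_k, and this relation between
generators passes to the derived representation. It makes the position operators a vector operator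
for the whole group. -/
theorem inSpin_conj_dRep_transParam (hn : 2 ≤ n) (s : Spin n) (k : Fin n) :
    U.smoothOp (inSpin s) * U.dRep (transParam k) * U.smoothOp (inSpin s)⁻¹
      = ∑ m, ((spinRot s (EuclideanSpace.single k 1) m : ℝ) : ℂ) • U.dRep (transParam m) := by
  rw [← U.dRep_conj]
  refine U.dRep_eq_sum (isClosedEmbedding_linRep hn) _ _ _ _ ?_
  rw [infGen_conj (isClosedEmbedding_linRep hn).continuous]
  simp only [infGen_linRep_transParam]
  rw [← map_inv, linRep_inSpin, linRep_inSpin, linRot_mul_linTrans, linTrans_mul_linRot, gen,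
    ← vec_spinRot]
  have h : spinRot s (EuclideanSpace.single k 1)
      = ∑ i, spinRot s (EuclideanSpace.single k 1) i • EuclideanSpace.single i (1 : ℝ) := by
    ext i
    simp [Finset.sum_apply, Pi.single_apply]
  conv_lhs => rw [h]
  simp only [map_sum, map_smul]
  rfl

theorem rotParam_ofAdd {k l : Fin n} (h : k ≠ l) (t : ℝ) :
    rotParam k l (Multiplicative.ofAdd t) = inSpin (spinRotor k l h t) := by
  rw [rotParam, dif_neg h]
  rfl

theorem eucCover_generated (hn : 2 ≤ n) {S : Subgroup (EucCover n)}
    (ht : ∀ (k : Fin n) (t : ℝ), transParam k (Multiplicative.ofAdd t) ∈ S)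
    (hr : ∀ (k l : Fin n) (t : ℝ), rotParam k l (Multiplicative.ofAdd t) ∈ S) (g : EucCover n) :
    g ∈ S := by
  have h1 : ∀ s : Spin n, inSpin s ∈ S := by
    intro s
    have hs : s ∈ rotorGroup n n := by rw [rotorGroup_eq_top hn]; trivial
    have hle : rotorGroup n n ≤ S.comap inSpin := by
      refine (Subgroup.closure_le _).2 ?_
      rintro _ ⟨k, l, h, t, -, -, rfl⟩
      change inSpin _ ∈ S
      rw [← rotParam_ofAdd h]
      exact hr k l t
    exact hle hs
  have h2 : ∀ v : EuclideanSpace ℝ (Fin n),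
      (SemidirectProduct.inl (Multiplicative.ofAdd v) : EucCover n) ∈ S := by
    intro v
    have hv : v = ∑ i, v i • EuclideanSpace.single i (1 : ℝ) := by
      ext i
      simp [Finset.sum_apply, Pi.single_apply]
    rw [hv, ofAdd_sum]
    exact Subgroup.prod_mem (S.comap SemidirectProduct.inl) fun i _ => ht i (v i)
  rw [← SemidirectProduct.inl_left_mul_inr_right g]
  exact mul_mem (h2 g.left.toAdd) (h1 g.right)

end Relations

end EuclideanCover

end

noncomputable section

namespace EuclideanCover

/-! ### The algebra of position and angular momentum operators -/

section Algebra

variable {A : Type*} [Ring A] [Algebra ℂ A] {n : ℕ}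

/-- The commutation relations of the Euclidean Lie algebra. -/
structure EuclideanRelations (c : ℂ) (X : Fin n → A) (J : Fin n → Fin n → A) : Prop where
  X_comm : ∀ k l, X k * X l = X l * X k
  J_swap : ∀ k l, J l k = -J k l
  X_lie_J : ∀ k l m, X k * J l m - J l m * X k
    = c • ((if k = l then X m else 0) - (if k = m then X l else 0))
  J_lie_J : ∀ k l m p, J k l * J m p - J m p * J k l
    = c • ((if k = p then J l m else 0) + (if l = m then J k p else 0)
      - (if k = m then J l p else 0) - (if l = p then J k m else 0))

/-- An antisymmetric tensor contracted with a symmetric one. This is what removes every summed index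
below. -/
theorem sum_skew_eq_zero {M : Type*} [AddCommGroup M] [Module ℂ M] {o : Fin n → Fin n → ℂ}
    (ho : ∀ i j, o j i = -o i j) {F : Fin n → Fin n → M} (hF : ∀ i j, F j i = F i j) :
    ∑ i, ∑ j, o i j • F i j = 0 := by
  have h : ∑ i, ∑ j, o i j • F i j = -∑ i, ∑ j, o i j • F i j := by
    conv_lhs => rw [Finset.sum_comm]
    rw [← Finset.sum_neg_distrib]
    refine Finset.sum_congr rfl fun i _ => ?_
    rw [← Finset.sum_neg_distrib]
    refine Finset.sum_congr rfl fun j _ => ?_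
    rw [ho i j, hF i j, neg_smul]
  have h2 : (2 : ℂ) • ∑ i, ∑ j, o i j • F i j = 0 := by
    rw [two_smul]
    nth_rewrite 1 [h]
    exact neg_add_cancel _
  exact (smul_eq_zero.1 h2).resolve_left two_ne_zero

/-- Tensors of rank two with respect to a derivation acting on indices by the matrix `o`. -/
def IsTensor₂ (D : A →ₗ[ℂ] A) (o : Fin n → Fin n → ℂ) (T : Fin n → Fin n → A) : Prop :=
  ∀ k l, D (T k l) = ∑ i, o k i • T i l + ∑ i, o l i • T k i

theorem IsTensor₂.transpose {D : A →ₗ[ℂ] A} {o : Fin n → Fin n → ℂ} {T : Fin n → Fin n → A}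
    (h : IsTensor₂ D o T) : IsTensor₂ D o fun k l => T l k :=
  fun k l => by rw [h l k, add_comm]

theorem IsTensor₂.add {D : A →ₗ[ℂ] A} {o : Fin n → Fin n → ℂ} {S T : Fin n → Fin n → A}
    (hS : IsTensor₂ D o S) (hT : IsTensor₂ D o T) : IsTensor₂ D o fun k l => S k l + T k l :=
  fun k l => by
    rw [map_add, hS, hT]
    simp only [smul_add, Finset.sum_add_distrib]
    abel

theorem IsTensor₂.sub {D : A →ₗ[ℂ] A} {o : Fin n → Fin n → ℂ} {S T : Fin n → Fin n → A}
    (hS : IsTensor₂ D o S) (hT : IsTensor₂ D o T) : IsTensor₂ D o fun k l => S k l - T k l :=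
  fun k l => by
    rw [map_sub, hS, hT]
    simp only [smul_sub, Finset.sum_sub_distrib]
    abel

/-! ### Tensor calculus for a derivation which acts on indices by an antisymmetric matrix -/

section Derivation

variable {D : A →ₗ[ℂ] A} (hD : ∀ x y, D (x * y) = D x * y + x * D y) {o : Fin n → Fin n → ℂ}
  (ho : ∀ i j, o j i = -o i j) {X : Fin n → A} {J : Fin n → Fin n → A}
  (hX : ∀ k, D (X k) = ∑ i, o k i • X i)

include hD ho hX in
theorem derivation_sqX : D (sqX X) = 0 := by
  have h := sum_skew_eq_zero ho (F := fun m i => X i * X m + X m * X i) fun i j => add_comm _ _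
  rw [sqX, map_sum, ← h]
  refine Finset.sum_congr rfl fun m _ => ?_
  rw [hD, hX, Finset.sum_mul, Finset.mul_sum, ← Finset.sum_add_distrib]
  refine Finset.sum_congr rfl fun i _ => ?_
  rw [smul_mul_assoc, mul_smul_comm, smul_add]

include hD ho hX in
-- By the Leibniz rule the two summed indices contribute o_{mi} times an expression symmetric in m
-- and i, which cancels; the free indices k and l transform as in a tensor.
theorem isTensor₂_contract (hJ : IsTensor₂ D o J) :
    IsTensor₂ D o fun k l => ∑ m, J k m * X m * X l := by
  intro k l
  have h := sum_skew_eq_zero ho (F := fun m i => (J k i * X m + J k m * X i) * X l)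
    fun i j => by rw [add_comm]
  have e : ∀ m, D (J k m * X m * X l) = ∑ i, o k i • (J i m * X m * X l)
      + ∑ i, o m i • ((J k i * X m + J k m * X i) * X l) + ∑ i, o l i • (J k m * X m * X i) := by
    intro m
    rw [hD, hD, hX, hX, hJ]
    simp only [add_mul, Finset.sum_mul, Finset.mul_sum, smul_mul_assoc, mul_smul_comm, smul_add,
      Finset.sum_add_distrib]
    abel
  rw [map_sum]
  simp only [e, Finset.sum_add_distrib]
  rw [h, add_zero]
  simp only [Finset.smul_sum]
  rw [Finset.sum_comm, Finset.sum_comm (f := fun x y => o l y • (J k x * X x * X y))]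

include hD ho hX in
theorem isTensor₂_opW (hJ : IsTensor₂ D o J) : IsTensor₂ D o (opW X J) := by
  have h1 : IsTensor₂ D o fun k l => sqX X * J k l := by
    intro k l
    rw [hD, derivation_sqX hD ho hX, zero_mul, zero_add, hJ, mul_add, Finset.mul_sum,
      Finset.mul_sum]
    simp only [mul_smul_comm]
  have h2 := isTensor₂_contract hD ho hX hJ
  exact (h1.sub h2).add h2.transpose

include hD ho in
theorem derivation_sum_sq {T : Fin n → Fin n → A} (hT : IsTensor₂ D o T) :
    D (∑ k, ∑ l, T k l * T k l) = 0 := by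
  have e : ∀ k l, D (T k l * T k l) = ∑ i, o k i • (T i l * T k l + T k l * T i l)
      + ∑ i, o l i • (T k i * T k l + T k l * T k i) := by
    intro k l
    rw [hD, hT]
    simp only [add_mul, mul_add, Finset.sum_mul, Finset.mul_sum, smul_mul_assoc, mul_smul_comm,
      smul_add, Finset.sum_add_distrib]
    abel
  simp only [map_sum, e, Finset.sum_add_distrib]
  have h1 : ∀ l, ∑ k, ∑ i, o k i • (T i l * T k l + T k l * T i l) = 0 := fun l =>
    sum_skew_eq_zero ho (F := fun k i => T i l * T k l + T k l * T i l) fun i j => add_comm _ _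
  have h2 : ∀ k, ∑ l, ∑ i, o l i • (T k i * T k l + T k l * T k i) = 0 := fun k =>
    sum_skew_eq_zero ho (F := fun l i => T k i * T k l + T k l * T k i) fun i j => add_comm _ _
  rw [Finset.sum_comm, Finset.sum_eq_zero fun l _ => h1 l, Finset.sum_eq_zero fun k _ => h2 k,
    add_zero]

end Derivation

/-- The commutator with an element as a linear map. -/
def commMap (a : A) : A →ₗ[ℂ] A := LinearMap.mulLeft ℂ a - LinearMap.mulRight ℂ a

theorem commMap_apply (a x : A) : commMap a x = a * x - x * a := rfl

theorem commMap_mul (a x y : A) : commMap a (x * y) = commMap a x * y + x * commMap a y := by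
  simp only [commMap_apply, sub_mul, mul_sub, mul_assoc]
  abel

variable {c : ℂ} {X : Fin n → A} {J : Fin n → Fin n → A}

/-! ### Consequences of the commutation relations for W and C -/

namespace EuclideanRelations

/-- The matrix by which the commutator with `J_{ab}` acts on indices. -/
def indexAction (c : ℂ) (a b : Fin n) (j i : Fin n) : ℂ :=
  c * ((if j = b ∧ i = a then 1 else 0) - (if j = a ∧ i = b then 1 else 0))

theorem indexAction_skew (c : ℂ) (a b i j : Fin n) :
    indexAction c a b j i = -indexAction c a b i j := by
  simp only [indexAction, and_comm]
  ring

theorem sum_indexAction (c : ℂ) (a b j : Fin n) (F : Fin n → A) :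
    ∑ i, indexAction c a b j i • F i
      = c • ((if j = b then F a else 0) - (if j = a then F b else 0)) := by
  simp only [indexAction, mul_smul, sub_smul, ite_smul, one_smul, zero_smul]
  rw [← Finset.smul_sum, Finset.sum_sub_distrib]
  congr 2
  · by_cases h : j = b <;> simp [h]
  · by_cases h : j = a <;> simp [h]

theorem commMap_J_X (h : EuclideanRelations c X J) (a b k : Fin n) :
    commMap (J a b) (X k) = ∑ i, indexAction c a b k i • X i := by
  rw [sum_indexAction, commMap_apply, ← neg_sub, h.X_lie_J, ← smul_neg, neg_sub]

theorem isTensor₂_J (h : EuclideanRelations c X J) (a b : Fin n) :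
    IsTensor₂ (commMap (J a b)) (indexAction c a b) J := by
  intro k l
  rw [sum_indexAction, sum_indexAction c a b l (J k), commMap_apply, h.J_lie_J, ← smul_add]
  congr 1
  have e : ∀ (p : Prop) [Decidable p] (x : A), (if p then -x else 0) = -(if p then x else 0) := by
    intro p _ x
    split_ifs <;> simp
  rw [h.J_swap a k, h.J_swap b k, e, e]
  simp only [eq_comm (a := k), eq_comm (a := l)]
  abel

theorem isTensor₂_W (h : EuclideanRelations c X J) (a b : Fin n) :
    IsTensor₂ (commMap (J a b)) (indexAction c a b) (opW X J) :=
  isTensor₂_opW (commMap_mul _) (indexAction_skew c a b) (h.commMap_J_X a b) (h.isTensor₂_J a b)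

theorem sqX_commute_J (h : EuclideanRelations c X J) (a b : Fin n) : Commute (sqX X) (J a b) := by
  have h1 := derivation_sqX (commMap_mul (J a b)) (indexAction_skew c a b) (h.commMap_J_X a b)
  rw [commMap_apply, sub_eq_zero] at h1
  exact h1.symm

theorem sqX_commute_X (h : EuclideanRelations c X J) (k : Fin n) : Commute (sqX X) (X k) :=
  Commute.sum_left _ _ _ fun m _ => Commute.mul_left (h.X_comm m k) (h.X_comm m k)

/-- The commutator of X_a with X² J_kl is c X²(δ_ak X_l - δ_al X_k). The contracted terms subtract
exactly this and add c(X_k X_a X_l - X_l X_a X_k), which is zero as the X commute. -/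
theorem X_commute_W (h : EuclideanRelations c X J) (a k l : Fin n) :
    Commute (X a) (opW X J k l) := by
  have e0 : ∀ j, commMap (X a) (X j) = 0 := fun j => sub_eq_zero.2 (h.X_comm a j)
  have e1 : commMap (X a) (sqX X) = 0 := sub_eq_zero.2 (h.sqX_commute_X a).eq.symm
  have e2 : ∀ k l, commMap (X a) (∑ m, J k m * X m * X l)
      = c • ((if a = k then sqX X * X l else 0) - X k * X a * X l) := by
    intro k l
    simp only [map_sum, commMap_mul, e0, mul_zero, add_zero]
    have e3 : ∀ m, commMap (X a) (J k m) * X m * X l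
        = c • ((if a = k then X m * X m * X l else 0) - (if a = m then X k * X m * X l else 0)) := by
      intro m
      rw [commMap_apply, h.X_lie_J, smul_mul_assoc, smul_mul_assoc, sub_mul, sub_mul, ite_mul,
        ite_mul, ite_mul, ite_mul, zero_mul, zero_mul]
    simp only [e3]
    rw [← Finset.smul_sum, Finset.sum_sub_distrib, Finset.sum_ite_eq Finset.univ a]
    congr 2
    · by_cases hak : a = k <;> simp [hak, sqX, Finset.sum_mul]
    · simp
  have e4 : commMap (X a) (opW X J k l) = 0 := by
    rw [opW, map_add, map_sub, e2, e2, commMap_mul, e1, zero_mul, zero_add, commMap_apply,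
      h.X_lie_J, mul_smul_comm, ← smul_sub, ← smul_add]
    have e5 : X l * X a * X k = X k * X a * X l := by
      rw [h.X_comm l a, mul_assoc, h.X_comm l k, ← mul_assoc, h.X_comm a k]
    rw [e5, mul_sub, mul_ite, mul_ite, mul_zero]
    convert smul_zero c using 2
    abel
  exact sub_eq_zero.1 e4

theorem W_swap (h : EuclideanRelations c X J) (k l : Fin n) : opW X J l k = -opW X J k l := by
  rw [opW, opW, h.J_swap k l, mul_neg]
  abel

/-- Antisymmetry of W: the diagonal vanishes and each pair k < l occurs twice. The tensor calculus
sees the unrestricted double sum. -/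
theorem two_smul_C (h : EuclideanRelations c X J) :
    (2 : ℂ) • opC X J = ∑ k, ∑ l, opW X J k l * opW X J k l := by
  have h0 : ∀ k, opW X J k k = 0 := by
    intro k
    have h1 : (2 : ℂ) • opW X J k k = 0 := by
      rw [two_smul]
      nth_rewrite 1 [h.W_swap k k]
      exact neg_add_cancel _
    exact (smul_eq_zero.1 h1).resolve_left two_ne_zero
  have h1 : ∀ k, ∑ l, opW X J k l * opW X J k l
      = ∑ l ∈ Finset.Ioi k, opW X J k l ^ 2 + ∑ l ∈ Finset.Iio k, opW X J l k ^ 2 := by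
    intro k
    have h2 : (Finset.univ : Finset (Fin n)) = Finset.cons k (Finset.Ioi k ∪ Finset.Iio k)
        (by simp) := by
      ext i
      simp only [Finset.mem_univ, Finset.mem_cons, Finset.mem_union, Finset.mem_Ioi,
        Finset.mem_Iio, true_iff]
      rcases lt_trichotomy i k with h | h | h
      · exact Or.inr (Or.inr h)
      · exact Or.inl h
      · exact Or.inr (Or.inl h)
    rw [h2, Finset.sum_cons, h0, mul_zero, zero_add, Finset.sum_union]
    · congr 1
      · exact Finset.sum_congr rfl fun l _ => (sq _).symm
      · refine Finset.sum_congr rfl fun l _ => ?_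
        rw [h.W_swap l k, neg_mul_neg, sq]
    · rw [Finset.disjoint_left]
      intro i hi hi'
      exact absurd (Finset.mem_Ioi.1 hi) (Finset.mem_Iio.1 hi').not_gt
  simp only [h1, Finset.sum_add_distrib]
  rw [two_smul, opC]
  congr 1
  rw [Finset.sum_sigma', Finset.sum_sigma']
  refine Finset.sum_bij' (fun x _ => ⟨x.2, x.1⟩) (fun x _ => ⟨x.2, x.1⟩) ?_ ?_ ?_ ?_ ?_ <;>
    simp

theorem X_commute_C (h : EuclideanRelations c X J) (a : Fin n) : Commute (X a) (opC X J) :=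
  Commute.sum_right _ _ _ fun k _ => Commute.sum_right _ _ _ fun l _ =>
    (h.X_commute_W a k l).pow_right 2

theorem J_commute_C (h : EuclideanRelations c X J) (a b : Fin n) : Commute (J a b) (opC X J) := by
  have h1 := derivation_sum_sq (commMap_mul (J a b)) (indexAction_skew c a b) (h.isTensor₂_W a b)
  rw [← h.two_smul_C, map_smul] at h1
  exact sub_eq_zero.1 ((smul_eq_zero.1 h1).resolve_left two_ne_zero)

/-- `W_{kl}` with the position operators on the left. -/
theorem W_eq_left (h : EuclideanRelations c X J) (k l : Fin n) :
    opW X J k l = sqX X * J k l - (∑ m, X m * X l * J k m) + ∑ m, X m * X k * J l m := by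
  have e1 : ∀ k j m, J k m * X j = X j * J k m
      - c • ((if j = k then X m else 0) - (if j = m then X k else 0)) := by
    intro k j m
    rw [← h.X_lie_J]
    abel
  -- The correction produced by reordering is symmetric in k and l, so it drops out of the
  -- antisymmetric combination W.
  have e2 : ∀ k l, ∑ m, J k m * X m * X l = (∑ m, X m * X l * J k m)
      - c • (X k * X l - (n : ℂ) • (X k * X l) + (if l = k then sqX X else 0) - X k * X l) := by
    intro k l
    have e3 : ∀ m, J k m * X m * X l = X m * X l * J k m
        - c • ((if m = k then X m * X l else 0) - X k * X l + (if l = k then X m * X m else 0)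
          - (if l = m then X k * X m else 0)) := by
      intro m
      rw [e1, sub_mul, mul_assoc, e1, mul_sub, if_pos rfl, smul_mul_assoc, mul_smul_comm, sub_sub,
        ← smul_add, mul_assoc]
      congr 2
      simp only [sub_mul, mul_sub, ite_mul, mul_ite, mul_zero, zero_mul, h.X_comm m k]
      abel
    have hconst : ∑ _m : Fin n, X k * X l = (n : ℂ) • (X k * X l) := by
      rw [Finset.sum_const, Finset.card_univ, Fintype.card_fin, Nat.cast_smul_eq_nsmul]
    have hite : (∑ m, if l = k then X m * X m else 0) = if l = k then sqX X else 0 := by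
      by_cases hlk : l = k <;> simp [hlk, sqX]
    simp only [e3]
    rw [Finset.sum_sub_distrib, ← Finset.smul_sum, Finset.sum_sub_distrib, Finset.sum_add_distrib,
      Finset.sum_sub_distrib, Finset.sum_ite_eq' Finset.univ k, Finset.sum_ite_eq Finset.univ l,
      hconst, hite, if_pos (Finset.mem_univ _), if_pos (Finset.mem_univ _)]
  rw [opW, e2, e2, h.X_comm l k]
  simp only [eq_comm (a := k)]
  abel

end EuclideanRelations

end Algebra

end EuclideanCover

end

noncomputable section

namespace EuclideanCover

theorem EuclideanRelations.smul {A : Type*} [Ring A] [Algebra ℂ A] {n : ℕ} {X : Fin n → A}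
    {J : Fin n → Fin n → A} (h : EuclideanRelations 1 X J) (c : ℂ) :
    EuclideanRelations c (fun k => c • X k) (fun k l => c • J k l) where
  X_comm k l := by rw [smul_mul_smul_comm, smul_mul_smul_comm, h.X_comm]
  J_swap k l := by rw [h.J_swap, smul_neg]
  X_lie_J k l m := by
    rw [smul_mul_smul_comm, smul_mul_smul_comm, ← smul_sub, h.X_lie_J, one_smul, mul_smul]
    congr 1
    simp only [smul_sub, smul_ite, smul_zero]
  J_lie_J k l m p := by
    rw [smul_mul_smul_comm, smul_mul_smul_comm, ← smul_sub, h.J_lie_J, one_smul, mul_smul]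
    congr 1
    simp only [smul_sub, smul_add, smul_ite, smul_zero]

/-! ### The enveloping algebra -/

section Enveloping

attribute [local instance 100] LieRing.ofAssociativeRing

variable {n : ℕ}

theorem eucLie_bracket (x y : eucLie n) :
    ((⁅x, y⁆ : eucLie n) : Matrix (Fin n ⊕ Unit) (Fin n ⊕ Unit) ℂ) = x * y - y * x := rfl

theorem coe_lieTrans (k : Fin n) : (lieTrans k : Matrix (Fin n ⊕ Unit) (Fin n ⊕ Unit) ℂ)
    = Matrix.single (Sum.inl k) (Sum.inr ()) 1 := by
  ext (i | i) (j | j) <;> simp [lieTrans, Matrix.single_apply]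

theorem coe_lieRot (k l : Fin n) : (lieRot k l : Matrix (Fin n ⊕ Unit) (Fin n ⊕ Unit) ℂ)
    = Matrix.single (Sum.inl k) (Sum.inl l) 1 - Matrix.single (Sum.inl l) (Sum.inl k) 1 := by
  ext (i | i) (j | j) <;> simp [lieRot, Matrix.single_apply]

theorem single_one_mul_single_one {m : Type*} [Fintype m] [DecidableEq m] (i j k l : m) :
    (Matrix.single i j 1 * Matrix.single k l 1 : Matrix m m ℂ)
      = if j = k then Matrix.single i l 1 else 0 := by
  by_cases h : j = k
  · rw [h, Matrix.single_mul_single_same, if_pos rfl, one_mul]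
  · rw [Matrix.single_mul_single_of_ne (h := h), if_neg h]

theorem coe_ite_eucLie (p : Prop) [Decidable p] (x : eucLie n) :
    ((if p then x else 0 : eucLie n) : Matrix (Fin n ⊕ Unit) (Fin n ⊕ Unit) ℂ)
      = if p then (x : Matrix (Fin n ⊕ Unit) (Fin n ⊕ Unit) ℂ) else 0 := by
  split_ifs <;> rfl

theorem lieTrans_lie_lieTrans (k l : Fin n) : ⁅lieTrans k, lieTrans l⁆ = (0 : eucLie n) := by
  apply Subtype.ext
  rw [eucLie_bracket, coe_lieTrans, coe_lieTrans, single_one_mul_single_one,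
    single_one_mul_single_one]
  simp

theorem lieRot_swap (k l : Fin n) : lieRot l k = -lieRot k l := by
  apply Subtype.ext
  rw [NegMemClass.coe_neg, coe_lieRot, coe_lieRot, neg_sub]

theorem lieTrans_lie_lieRot (k l m : Fin n) : ⁅lieTrans k, lieRot l m⁆
    = (if k = l then lieTrans m else 0) - (if k = m then lieTrans l else 0) := by
  apply Subtype.ext
  rw [AddSubgroupClass.coe_sub, coe_ite_eucLie, coe_ite_eucLie, eucLie_bracket, coe_lieTrans,
    coe_lieTrans, coe_lieTrans, coe_lieRot]
  simp only [mul_sub, sub_mul, single_one_mul_single_one, Sum.inl.injEq, reduceCtorEq, if_false]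
  simp only [eq_comm (b := k)]
  abel

theorem lieRot_lie_lieRot (k l m p : Fin n) : ⁅lieRot k l, lieRot m p⁆
    = (if k = p then lieRot l m else 0) + (if l = m then lieRot k p else 0)
      - (if k = m then lieRot l p else 0) - (if l = p then lieRot k m else 0) := by
  apply Subtype.ext
  rw [AddSubgroupClass.coe_sub, AddSubgroupClass.coe_sub, AddMemClass.coe_add, coe_ite_eucLie,
    coe_ite_eucLie, coe_ite_eucLie, coe_ite_eucLie, eucLie_bracket]
  simp only [coe_lieRot, mul_sub, sub_mul, single_one_mul_single_one, Sum.inl.injEq]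
  have e : ∀ (q : Prop) [Decidable q] (x y : Matrix (Fin n ⊕ Unit) (Fin n ⊕ Unit) ℂ),
      (if q then x - y else 0) = (if q then x else 0) - (if q then y else 0) := by
    intro q _ x y
    split_ifs <;> simp
  simp only [e, eq_comm (b := k), eq_comm (b := l)]
  abel

/-- The canonical map into the enveloping algebra. -/
def ueaι (n : ℕ) : eucLie n →ₗ[ℂ] EucUEA n where
  toFun x := (UniversalEnvelopingAlgebra.ι ℂ x : UniversalEnvelopingAlgebra ℂ (eucLie n))
  map_add' x y := (UniversalEnvelopingAlgebra.ι ℂ :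
    eucLie n →ₗ⁅ℂ⁆ UniversalEnvelopingAlgebra ℂ (eucLie n)).map_add x y
  map_smul' c x := (UniversalEnvelopingAlgebra.ι ℂ :
    eucLie n →ₗ⁅ℂ⁆ UniversalEnvelopingAlgebra ℂ (eucLie n)).map_smul c x

theorem ueaι_lie (x y : eucLie n) : ueaι n x * ueaι n y - ueaι n y * ueaι n x = ueaι n ⁅x, y⁆ :=
  ((UniversalEnvelopingAlgebra.ι ℂ :
    eucLie n →ₗ⁅ℂ⁆ UniversalEnvelopingAlgebra ℂ (eucLie n)).map_lie x y).symm

theorem euclideanRelations_uea (ħ : ℝ) :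
    EuclideanRelations (A := EucUEA n) (Complex.I * (ħ : ℂ)) (ueaX ħ) (ueaJ ħ) := by
  have h : EuclideanRelations (A := EucUEA n) 1 (fun k => ueaι n (lieTrans k))
      (fun k l => ueaι n (lieRot k l)) :=
    { X_comm := fun k l => by
        rw [← sub_eq_zero, ueaι_lie, lieTrans_lie_lieTrans, map_zero]
      J_swap := fun k l => by rw [lieRot_swap, map_neg]
      X_lie_J := fun k l m => by
        rw [ueaι_lie, lieTrans_lie_lieRot, map_sub, one_smul]
        congr 1 <;> split_ifs <;> simp
      J_lie_J := fun k l m p => by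
        rw [ueaι_lie, lieRot_lie_lieRot, map_sub, map_sub, map_add, one_smul]
        congr 1
        · congr 1
          · congr 1 <;> split_ifs <;> simp
          · split_ifs <;> simp
        · split_ifs <;> simp }
  exact h.smul _

theorem eucLie_mem_span (x : eucLie n) :
    x ∈ Submodule.span ℂ (Set.range (lieTrans (n := n)) ∪
      Set.range fun p : Fin n × Fin n => lieRot p.1 p.2) := by
  obtain ⟨M, B, v, hB, rfl⟩ := x
  -- The coefficients are halved because both (k, l) and (l, k) occur in the sum.
  have e : (⟨Matrix.fromBlocks B v 0 0, B, v, hB, rfl⟩ : eucLie n)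
      = ∑ k, v k () • lieTrans k + ∑ k, ∑ l, (B k l / 2) • lieRot k l := by
    apply Subtype.ext
    simp only [AddMemClass.coe_add, AddSubmonoidClass.coe_finsetSum, SetLike.val_smul,
      coe_lieTrans, coe_lieRot]
    have hB' : ∀ i j, B j i = -B i j := fun i j => congrFun (congrFun hB i) j
    ext (i | i) (j | j)
    · simp only [Matrix.fromBlocks_apply₁₁, Matrix.add_apply, Matrix.sum_apply, Matrix.smul_apply,
        Matrix.sub_apply, Matrix.single_apply, Sum.inl.injEq, reduceCtorEq, and_false, if_false,
        Finset.sum_const_zero, zero_add, smul_sub, Finset.sum_sub_distrib, smul_eq_mul,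
        mul_ite, mul_one, mul_zero, ite_and]
      simp [hB' i j]
      ring
    · simp [Matrix.sum_apply, Matrix.single_apply]
    · simp [Matrix.sum_apply]
    · simp [Matrix.sum_apply]
  rw [e]
  refine add_mem (sum_mem fun k _ => Submodule.smul_mem _ _ (Submodule.subset_span (Or.inl ⟨k, rfl⟩)))
    (sum_mem fun k _ => sum_mem fun l _ => Submodule.smul_mem _ _
      (Submodule.subset_span (Or.inr ⟨(k, l), rfl⟩)))

/-- The universal property gives an algebra map into the centralizer of z which lifts the canonical
map. Followed by the inclusion it is the identity, so the centralizer is everything. -/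
theorem mem_center_of_commute_ι {z : EucUEA n} (h : ∀ x, Commute (ueaι n x) z) :
    z ∈ Subalgebra.center ℂ (EucUEA n) := by
  rw [Subalgebra.mem_center_iff]
  let Z : Subalgebra ℂ (EucUEA n) := Subalgebra.centralizer ℂ {z}
  let f : eucLie n →ₗ⁅ℂ⁆ Z :=
    { toFun := fun x => ⟨ueaι n x, by
        rw [Subalgebra.mem_centralizer_iff]
        rintro _ rfl
        exact (h x).eq.symm⟩
      map_add' := fun x y => Subtype.ext (map_add _ x y)
      map_smul' := fun c x => Subtype.ext (map_smul _ c x)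
      map_lie' := fun {x y} => Subtype.ext (ueaι_lie x y).symm }
  let F : UniversalEnvelopingAlgebra ℂ (eucLie n) →ₐ[ℂ] Z := UniversalEnvelopingAlgebra.lift ℂ f
  have hF : (Z.val : Z →ₐ[ℂ] UniversalEnvelopingAlgebra ℂ (eucLie n)).comp F = AlgHom.id ℂ _ := by
    apply UniversalEnvelopingAlgebra.hom_ext
    ext x
    change ((F (UniversalEnvelopingAlgebra.ι ℂ x) : Z) : EucUEA n) = ueaι n x
    rw [UniversalEnvelopingAlgebra.lift_ι_apply]
    rfl
  intro b
  have h1 : ((F b : Z) : EucUEA n) = b := AlgHom.congr_fun hF b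
  have h2 := (F b).2
  rw [Subalgebra.mem_centralizer_iff] at h2
  have h3 := h2 z rfl
  rw [h1] at h3
  exact h3.symm

theorem opC_uea_mem_center {ħ : ℝ} (hħ : ħ ≠ 0) :
    opC (ueaX ħ) (ueaJ ħ) ∈ Subalgebra.center ℂ (EucUEA n) := by
  have hc : Complex.I * (ħ : ℂ) ≠ 0 := mul_ne_zero Complex.I_ne_zero (Complex.ofReal_ne_zero.2 hħ)
  have hrel := euclideanRelations_uea (n := n) ħ
  have hun : ∀ x : EucUEA n, Commute ((Complex.I * (ħ : ℂ)) • x) (opC (ueaX ħ) (ueaJ ħ)) →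
      Commute x (opC (ueaX ħ) (ueaJ ħ)) := by
    intro x hx
    have := hx.smul_left (Complex.I * (ħ : ℂ))⁻¹
    rwa [inv_smul_smul₀ hc] at this
  refine mem_center_of_commute_ι fun x => ?_
  induction eucLie_mem_span x using Submodule.span_induction with
  | mem x hx =>
    rcases hx with ⟨k, rfl⟩ | ⟨⟨k, l⟩, rfl⟩
    · exact hun _ (hrel.X_commute_C k)
    · exact hun _ (hrel.J_commute_C k l)
  | zero => rw [map_zero]; exact Commute.zero_left _
  | add x y _ _ hx hy => rw [map_add]; exact hx.add_left hy
  | smul c x _ hx => rw [map_smul]; exact hx.smul_left c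

end Enveloping

/-! ### Position and angular momentum in a representation -/

section Operators

variable {d : ℕ} {H : Type*} [NormedAddCommGroup H] [InnerProductSpace ℂ H] [CompleteSpace H]
  (U : UnitaryRep (EucCover (d + 1)) H)

theorem euclideanRelations_rep (hd : 1 ≤ d) (ħ : ℝ) :
    EuclideanRelations (Complex.I * (ħ : ℂ)) (posOp ħ U) (angOp ħ U) := by
  have h : EuclideanRelations 1 (fun k => U.dRep (transParam k)) (fun k l => U.dRep (rotParam k l)) :=
    { X_comm := fun k l => dRep_transParam_comm U (by omega) k l
      J_swap := fun k l => dRep_rotParam_swap U (by omega) k l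
      X_lie_J := fun k l m => by rw [one_smul, dRep_transParam_lie_rotParam U (by omega)]
      J_lie_J := fun k l m p => by rw [one_smul, dRep_rotParam_lie_rotParam U (by omega)] }
  exact h.smul _

/-- Pairs of operators on the smooth vectors which are formally adjoint. -/
def IsAdjPair (S T : Module.End ℂ U.smooth) : Prop :=
  ∀ v w : U.smooth, inner ℂ ((S v : U.smooth) : H) (w : H) = inner ℂ (v : H) (T w : H)

variable {U}

theorem IsAdjPair.mul {S T S' T' : Module.End ℂ U.smooth} (h : IsAdjPair U S T)
    (h' : IsAdjPair U S' T') : IsAdjPair U (S * S') (T' * T) := fun v w => by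
  rw [Module.End.mul_apply, h, h', Module.End.mul_apply]

theorem IsAdjPair.add {S T S' T' : Module.End ℂ U.smooth} (h : IsAdjPair U S T)
    (h' : IsAdjPair U S' T') : IsAdjPair U (S + S') (T + T') := fun v w => by
  rw [LinearMap.add_apply, LinearMap.add_apply, Submodule.coe_add, Submodule.coe_add,
    inner_add_left, inner_add_right, h, h']

theorem IsAdjPair.sub {S T S' T' : Module.End ℂ U.smooth} (h : IsAdjPair U S T)
    (h' : IsAdjPair U S' T') : IsAdjPair U (S - S') (T - T') := fun v w => by
  rw [LinearMap.sub_apply, LinearMap.sub_apply, Submodule.coe_sub, Submodule.coe_sub,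
    inner_sub_left, inner_sub_right, h, h']

theorem IsAdjPair.sum {ι : Type*} (s : Finset ι) {S T : ι → Module.End ℂ U.smooth}
    (h : ∀ i ∈ s, IsAdjPair U (S i) (T i)) : IsAdjPair U (∑ i ∈ s, S i) (∑ i ∈ s, T i) :=
  fun v w => by
    rw [LinearMap.sum_apply, LinearMap.sum_apply, Submodule.coe_sum, Submodule.coe_sum, sum_inner,
      inner_sum]
    exact Finset.sum_congr rfl fun i hi => h i hi v w

theorem isAdjPair_I_smul_dRep (ħ : ℝ) (φ : OneParam (EucCover (d + 1))) :
    IsAdjPair U ((Complex.I * (ħ : ℂ)) • U.dRep φ) ((Complex.I * (ħ : ℂ)) • U.dRep φ) := by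
  intro v w
  simp only [LinearMap.smul_apply, Submodule.coe_smul, inner_smul_left, inner_smul_right,
    U.inner_dRep_left, map_mul, Complex.conj_I, Complex.conj_ofReal]
  ring

theorem isAdjPair_posOp (ħ : ℝ) (k : Fin (d + 1)) : IsAdjPair U (posOp ħ U k) (posOp ħ U k) :=
  isAdjPair_I_smul_dRep _ _

theorem isAdjPair_angOp (ħ : ℝ) (k l : Fin (d + 1)) :
    IsAdjPair U (angOp ħ U k l) (angOp ħ U k l) :=
  isAdjPair_I_smul_dRep _ _

/-- Taking adjoints reverses the order of the factors, and by `W_eq_left` the reversed expression is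
again W. -/
theorem isAdjPair_opW (hd : 1 ≤ d) (ħ : ℝ) (k l : Fin (d + 1)) :
    IsAdjPair U (opW (posOp ħ U) (angOp ħ U) k l) (opW (posOp ħ U) (angOp ħ U) k l) := by
  have hrel := euclideanRelations_rep U hd ħ
  have hX := isAdjPair_posOp (U := U) ħ
  have hJ := isAdjPair_angOp (U := U) ħ
  have hS : IsAdjPair U (sqX (posOp ħ U)) (sqX (posOp ħ U)) :=
    IsAdjPair.sum _ fun m _ => (hX m).mul (hX m)
  have h := ((hS.mul (hJ k l)).sub (IsAdjPair.sum Finset.univ fun m _ =>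
    ((hJ k m).mul (hX m)).mul (hX l))).add (IsAdjPair.sum Finset.univ fun m _ =>
    ((hJ l m).mul (hX m)).mul (hX k))
  have e : opW (posOp ħ U) (angOp ħ U) k l = angOp ħ U k l * sqX (posOp ħ U)
      - (∑ m, posOp ħ U l * (posOp ħ U m * angOp ħ U k m))
      + ∑ m, posOp ħ U k * (posOp ħ U m * angOp ħ U l m) := by
    rw [hrel.W_eq_left, (hrel.sqX_commute_J k l).eq]
    simp only [← mul_assoc, hrel.X_comm _ l, hrel.X_comm _ k]
  rw [← e] at h
  exact h

end Operators

end EuclideanCover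

end

noncomputable section

namespace EuclideanCover

open MeasureTheory Topology

/-! ### Schur's lemma -/

namespace UnitaryRep

section Schur

variable {G : Type*} [Group G] [TopologicalSpace G]
  {H : Type*} [NormedAddCommGroup H] [InnerProductSpace ℂ H] [CompleteSpace H]

/-- A bounded self-adjoint operator commuting with an irreducible representation is a scalar. -/
theorem exists_eq_smul_one (U : UnitaryRep G H) (hU : U.IsIrreducible) {T : H →L[ℂ] H}
    (hT : IsSelfAdjoint T) (h : ∀ g, Commute T (U.op g)) : ∃ a : ℝ, T = a • (1 : H →L[ℂ] H) := by
  have := hU.1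
  have : Nontrivial (H →L[ℂ] H) := inferInstance
  obtain ⟨a, ha⟩ := ContinuousFunctionalCalculus.spectrum_nonempty (R := ℝ) T hT
  refine ⟨a, ?_⟩
  have hsp : ∀ b ∈ spectrum ℝ T, b = a := by
    intro b hb
    by_contra hba
    have hd : 0 < |b - a| := abs_pos.2 (sub_ne_zero.2 hba)
    -- Two spectral points a ≠ b carry tent functions with disjoint supports. Then f(T) g(T) = 0
    -- with both factors nonzero, so the kernel of f(T) is a closed invariant subspace which is
    -- neither 0 nor H.
    set f : ℝ → ℝ := fun x => max 0 (|b - a| / 2 - |x - a|) with hf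
    set g : ℝ → ℝ := fun x => max 0 (|b - a| / 2 - |x - b|) with hg
    have hfc : Continuous f := by fun_prop
    have hgc : Continuous g := by fun_prop
    have hfg : f * g = 0 := by
      funext x
      simp only [Pi.mul_apply, Pi.zero_apply, mul_eq_zero, hf, hg, max_eq_left_iff]
      by_contra! hx
      have h3 := abs_sub_le b x a
      rw [abs_sub_comm b x] at h3
      linarith
    have hne : ∀ (f : ℝ → ℝ) (c : ℝ), Continuous f → c ∈ spectrum ℝ T → f c ≠ 0 → cfc f T ≠ 0 := by
      intro f c hf hc hfc h0
      have h1 : f c ∈ spectrum ℝ (cfc f T) := by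
        rw [cfc_map_spectrum f T hT hf.continuousOn]
        exact ⟨c, hc, rfl⟩
      rw [h0, spectrum.zero_eq] at h1
      exact hfc h1
    have hfT : cfc f T ≠ 0 := hne f a hfc ha (by
      simp only [hf, sub_self, abs_zero, sub_zero]
      exact (lt_max_of_lt_right (by linarith)).ne')
    have hgT : cfc g T ≠ 0 := hne g b hgc hb (by
      simp only [hg, sub_self, abs_zero, sub_zero]
      exact (lt_max_of_lt_right (by linarith)).ne')
    have hmul : cfc f T * cfc g T = 0 := by
      rw [← cfc_mul f g T hfc.continuousOn hgc.continuousOn]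
      have : (fun x => f x * g x) = 0 := hfg
      rw [this]
      exact cfc_zero ℝ T
    let F : H →L[ℂ] H := cfc f T
    rcases hU.2 (LinearMap.ker (F : H →ₗ[ℂ] H)) (ContinuousLinearMap.isClosed_ker (cfc f T)) (fun k v hv => by
        have h1 := (h k).cfc_real f
        change cfc f T (U.op k v) = 0
        have h2 := congrArg (fun S : H →L[ℂ] H => S v) h1.eq
        simp only [mul_apply_eq_comp] at h2
        have hv' : cfc f T v = 0 := hv
        rw [h2, hv', map_zero]) with h1 | h1
    · apply hgT
      ext v
      have h2 : cfc g T v ∈ LinearMap.ker (F : H →ₗ[ℂ] H) :=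
        congrArg (fun S : H →L[ℂ] H => S v) hmul
      rw [h1] at h2
      simpa using h2
    · apply hfT
      ext v
      have h2 : v ∈ LinearMap.ker (F : H →ₗ[ℂ] H) := by rw [h1]; trivial
      exact h2
  calc T = cfc (fun x : ℝ => x) T := (cfc_id' ℝ T).symm
    _ = cfc (fun _ : ℝ => a) T := cfc_congr fun b hb => hsp b hb
    _ = a • (1 : H →L[ℂ] H) := by rw [cfc_const a T, Algebra.algebraMap_eq_smul_one]

variable [IsTopologicalGroup G]

/-- A symmetric operator on the smooth vectors commuting with an irreducible representation is a
scalar. -/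
theorem exists_eq_smul_one_of_symm (U : UnitaryRep G H) (hU : U.IsIrreducible)
    (hd : Dense (U.smooth : Set H)) {T : Module.End ℂ U.smooth}
    (hT : ∀ v w : U.smooth, inner ℂ (T v : H) (w : H) = inner ℂ (v : H) (T w : H))
    (h : ∀ g, Commute T (U.smoothOp g)) :
    ∃ a : ℝ, T = (a : ℂ) • (1 : Module.End ℂ U.smooth) := by
  have := hU.1
  -- T is not known to be bounded, so the closure Γ of its graph in H ⊕ H is used. The orthogonal
  -- projection onto Γ is bounded and commutes with U ⊕ U; its blocks ρ and σ are bounded operators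
  -- on H that commute with U, and ρ is self-adjoint.
  let E := WithLp 2 (H × H)
  let e := WithLp.prodContinuousLinearEquiv 2 ℂ H H
  let j : U.smooth →ₗ[ℂ] E :=
    (e.symm : H × H →ₗ[ℂ] E) ∘ₗ (U.smooth.subtype.prod (U.smooth.subtype ∘ₗ T))
  let Γ : Submodule ℂ E := (LinearMap.range j).topologicalClosure
  have hj : ∀ v : U.smooth, j v ∈ Γ := fun v => Submodule.le_topologicalClosure _ ⟨v, rfl⟩
  have : CompleteSpace Γ := (Submodule.isClosed_topologicalClosure _).completeSpace_coe
  have hsym : ∀ x ∈ Γ, ∀ w : U.smooth, inner ℂ (T w : H) x.fst = inner ℂ (w : H) x.snd := by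
    intro x hx w
    refine closure_minimal (t := {x : E | inner ℂ (T w : H) x.fst = inner ℂ (w : H) x.snd}) ?_ ?_ hx
    · rintro _ ⟨v, rfl⟩
      exact hT w v
    · exact isClosed_eq (continuous_const.inner (WithLp.fstL 2 ℂ H H).continuous)
        (continuous_const.inner (WithLp.sndL 2 ℂ H H).continuous)
  -- A symmetric densely defined operator is closable: Γ is the graph of a function.
  have hclosable : ∀ y : H, e.symm (0, y) ∈ Γ → y = 0 := by
    intro y hy
    refine hd.eq_zero_of_inner_right ℂ fun w hw => ?_
    have h1 := hsym _ hy ⟨w, hw⟩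
    have h2 : inner ℂ (T ⟨w, hw⟩ : H) (0 : H) = inner ℂ w y := h1
    rw [← h2, inner_zero_right]
  let V : G → E →L[ℂ] E := fun g =>
    (e.symm : H × H →L[ℂ] E) ∘L ((U.op g).prodMap (U.op g)) ∘L (e : E →L[ℂ] H × H)
  have hV : ∀ g, ∀ x ∈ Γ, V g x ∈ Γ := by
    intro g x hx
    refine map_mem_closure (V g).continuous hx ?_
    rintro _ ⟨v, rfl⟩
    refine ⟨U.smoothOp g v, ?_⟩
    change e.symm (U.op g v, ((T (U.smoothOp g v) : U.smooth) : H)) = e.symm (U.op g v, U.op g (T v))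
    have := LinearMap.congr_fun (h g).eq v
    simp only [Module.End.mul_apply] at this
    rw [this]
    rfl
  have hVinner : ∀ g x y, inner ℂ (V g x) y = inner ℂ x (V g⁻¹ y) := by
    intro g x y
    rw [WithLp.prod_inner_apply, WithLp.prod_inner_apply]
    exact congrArg₂ (· + ·) (U.inner_op_left g x.fst y.fst) (U.inner_op_left g x.snd y.snd)
  have hP : ∀ g x, Γ.starProjection (V g x) = V g (Γ.starProjection x) := by
    intro g x
    refine Submodule.eq_starProjection_of_mem_orthogonal (hV g _ (Submodule.starProjection_apply_mem _ _)) ?_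
    rw [← map_sub, Submodule.mem_orthogonal']
    intro y hy
    rw [hVinner]
    exact Submodule.inner_left_of_mem_orthogonal (hV _ _ hy) (Submodule.sub_starProjection_mem_orthogonal _)
  let i : H →L[ℂ] E := (e.symm : H × H →L[ℂ] E) ∘L ContinuousLinearMap.inl ℂ H H
  let ρ : H →L[ℂ] H := (WithLp.fstL 2 ℂ H H) ∘L Γ.starProjection ∘L i
  let σ : H →L[ℂ] H := (WithLp.sndL 2 ℂ H H) ∘L Γ.starProjection ∘L i
  have hmem : ∀ x : H, e.symm (ρ x, σ x) ∈ Γ := fun x =>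
    Submodule.starProjection_apply_mem Γ (i x)
  have hi : ∀ (x : H) (y : E), inner ℂ (i x) y = inner ℂ x y.fst := by
    intro x y
    rw [WithLp.prod_inner_apply]
    have : inner ℂ (0 : H) y.snd = 0 := inner_zero_left _
    exact (congrArg (inner ℂ x y.fst + ·) this).trans (add_zero _)
  have hi' : ∀ (x : H) (y : E), inner ℂ y (i x) = inner ℂ y.fst x := by
    intro x y
    rw [← inner_conj_symm, hi, inner_conj_symm]
  have hρ : IsSelfAdjoint ρ := by
    rw [ContinuousLinearMap.isSelfAdjoint_iff_isSymmetric]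
    intro x y
    have h1 := Submodule.inner_starProjection_left_eq_right Γ (i x) (i y)
    rw [hi, hi'] at h1
    exact h1
  have hρU : ∀ g, Commute ρ (U.op g) := by
    intro g
    ext x
    have h1 := hP g (i x)
    have h2 : V g (i x) = i (U.op g x) := by
      change e.symm (U.op g x, U.op g 0) = e.symm (U.op g x, 0)
      rw [map_zero]
    rw [h2] at h1
    exact congrArg (WithLp.fstL 2 ℂ H H) h1
  obtain ⟨a, ha⟩ := U.exists_eq_smul_one hU hρ hρU
  have ha' : ∀ x, ρ x = a • x := fun x => by rw [ha]; rfl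
  -- If ρ = 0, then (x, 0) projects to (0, σx) in Γ, which is zero by closability. So (x, 0) is
  -- orthogonal to the graph, x is orthogonal to all smooth vectors, and x = 0.
  have ha0 : a ≠ 0 := by
    rintro rfl
    have h0 : ∀ x, ρ x = 0 := fun x => by rw [ha', zero_smul]
    obtain ⟨x, hx⟩ := exists_ne (0 : H)
    apply hx
    have h1 : σ x = 0 := hclosable _ (by have := hmem x; rwa [h0] at this)
    have h2 : Γ.starProjection (i x) = 0 := by
      change e.symm (ρ x, σ x) = 0
      rw [h0, h1]
      exact map_zero e.symm
    refine hd.eq_zero_of_inner_left ℂ fun w hw => ?_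
    have h3 := Submodule.inner_starProjection_left_eq_right Γ (i x) (j ⟨w, hw⟩)
    rw [h2, inner_zero_left, Submodule.starProjection_eq_self_iff.2 (hj _), hi] at h3
    exact h3.symm
  -- Both (av, σv) and a(v, Tv) lie in Γ, hence σv = aTv. So T extends to the bounded operator a⁻¹σ,
  -- and Schur's lemma applies a second time.
  have hσ : ∀ v : U.smooth, σ v = a • (T v : H) := by
    intro v
    have h1 := sub_mem (hmem v) (Submodule.smul_mem Γ (a : ℂ) (hj v))
    have h2 : e.symm (ρ v, σ v) - (a : ℂ) • j v = e.symm (0, σ v - a • (T v : H)) := by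
      change e.symm (ρ v, σ v) - (a : ℂ) • e.symm ((v : H), (T v : H)) = _
      rw [← map_smul, ← map_sub, Prod.smul_mk, Prod.mk_sub_mk, ha', Complex.coe_smul, Complex.coe_smul, sub_self]
    rw [h2] at h1
    exact sub_eq_zero.1 (hclosable _ h1)
  let S : H →L[ℂ] H := a⁻¹ • σ
  have hS : ∀ v : U.smooth, S v = (T v : H) := by
    intro v
    change a⁻¹ • σ v = _
    rw [hσ, inv_smul_smul₀ ha0]
  have hSS : IsSelfAdjoint S := by
    rw [ContinuousLinearMap.isSelfAdjoint_iff_isSymmetric]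
    intro x y
    refine hd.induction (P := fun x => inner ℂ (S x) y = inner ℂ x (S y)) (fun x hx => ?_)
      (isClosed_eq (S.continuous.inner continuous_const) (continuous_id.inner continuous_const)) x
    refine hd.induction (P := fun y => inner ℂ (S x) y = inner ℂ x (S y)) (fun y hy => ?_)
      (isClosed_eq (continuous_const.inner continuous_id) (continuous_const.inner S.continuous)) y
    have := hT ⟨x, hx⟩ ⟨y, hy⟩
    rwa [← hS, ← hS] at this
  have hSU : ∀ g, Commute S (U.op g) := by
    intro g
    ext x
    refine hd.induction (P := fun x => (S * U.op g) x = (U.op g * S) x) (fun x hx => ?_)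
      (isClosed_eq (S * U.op g).continuous (U.op g * S).continuous) x
    have h1 := LinearMap.congr_fun (h g).eq ⟨x, hx⟩
    have h2 : S (U.smoothOp g ⟨x, hx⟩) = U.op g (T ⟨x, hx⟩) := by
      rw [hS, ← coe_smoothOp]
      exact congrArg _ h1
    rw [← hS] at h2
    exact h2
  obtain ⟨b, hb⟩ := U.exists_eq_smul_one hU hSS hSU
  refine ⟨b, ?_⟩
  ext v
  rw [← hS, hb]
  simp

end Schur

end UnitaryRep

/-! ### The Casimir operator -/

section Casimir

variable {d : ℕ} {H : Type*} [NormedAddCommGroup H] [InnerProductSpace ℂ H] [CompleteSpace H]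
  {U : UnitaryRep (EucCover (d + 1)) H}

theorem dense_smooth_eucCover (hd : 1 ≤ d) (U : UnitaryRep (EucCover (d + 1)) H) :
    Dense (U.smooth : Set H) :=
  U.dense_smooth (isClosedEmbedding_linRep (by omega))

theorem opC_mem {A : Type*} [Ring A] [Algebra ℂ A] {n : ℕ} (S : Subalgebra ℂ A) {X : Fin n → A}
    {J : Fin n → Fin n → A} (hX : ∀ k, X k ∈ S) (hJ : ∀ k l, J k l ∈ S) : opC X J ∈ S :=
  sum_mem fun _ _ => sum_mem fun _ _ => pow_mem (add_mem (sub_mem (mul_mem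
    (sum_mem fun _ _ => mul_mem (hX _) (hX _)) (hJ _ _))
    (sum_mem fun _ _ => mul_mem (mul_mem (hJ _ _) (hX _)) (hX _)))
    (sum_mem fun _ _ => mul_mem (mul_mem (hJ _ _) (hX _)) (hX _))) 2

theorem opC_commute_smoothOp (hd : 1 ≤ d) {ħ : ℝ} (hħ : ħ ≠ 0) (g : EucCover (d + 1)) :
    Commute (opC (posOp ħ U) (angOp ħ U)) (U.smoothOp g) := by
  have hc : Complex.I * (ħ : ℂ) ≠ 0 := mul_ne_zero Complex.I_ne_zero (Complex.ofReal_ne_zero.2 hħ)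
  have hrel := euclideanRelations_rep U hd ħ
  have hdn := dense_smooth_eucCover hd U
  have htame : U.IsTame (opC (posOp ħ U) (angOp ħ U)) := by
    refine U.isTame_of_mem_adjoin (isClosedEmbedding_linRep (by omega)) (opC_mem _ ?_ ?_)
    · exact fun k => Subalgebra.smul_mem _ (Algebra.subset_adjoin (Set.mem_range_self _)) _
    · exact fun k l => Subalgebra.smul_mem _ (Algebra.subset_adjoin (Set.mem_range_self _)) _
  have hun : ∀ x : Module.End ℂ U.smooth, Commute ((Complex.I * (ħ : ℂ)) • x)
      (opC (posOp ħ U) (angOp ħ U)) → Commute (opC (posOp ħ U) (angOp ħ U)) x := by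
    intro x hx
    have := hx.smul_left (Complex.I * (ħ : ℂ))⁻¹
    rw [inv_smul_smul₀ hc] at this
    exact this.symm
  let S : Subgroup (EucCover (d + 1)) :=
    { carrier := {g | Commute (opC (posOp ħ U) (angOp ħ U)) (U.smoothOp g)}
      one_mem' := by
        change Commute _ (U.smoothOp 1)
        rw [U.smoothOp_one]
        exact Commute.one_right _
      mul_mem' := fun {a b} ha hb => by
        change Commute _ (U.smoothOp (a * b))
        rw [U.smoothOp_mul]
        exact Commute.mul_right ha hb
      inv_mem' := fun {a} ha => by
        change Commute _ (U.smoothOp a⁻¹)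
        have ha' : Commute _ (U.smoothOp a) := ha
        calc opC (posOp ħ U) (angOp ħ U) * U.smoothOp a⁻¹
            = U.smoothOp a⁻¹ * (U.smoothOp a * opC (posOp ħ U) (angOp ħ U)) * U.smoothOp a⁻¹ := by
              rw [← mul_assoc, U.smoothOp_inv_mul, one_mul]
          _ = U.smoothOp a⁻¹ * opC (posOp ħ U) (angOp ħ U) := by
              rw [← ha'.eq, mul_assoc, mul_assoc, U.smoothOp_mul_inv, mul_one] }
  refine eucCover_generated (S := S) (by omega) (fun k t => ?_) (fun k l t => ?_) g
  · exact htame.commute_smoothOp hdn (hun _ (hrel.X_commute_C k)) t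
  · exact htame.commute_smoothOp hdn (hun _ (hrel.J_commute_C k l)) t

theorem exists_opC_eq_smul (hd : 1 ≤ d) {ħ : ℝ} (hħ : ħ ≠ 0) (hU : U.IsIrreducible) :
    ∃ c : ℝ, opC (posOp ħ U) (angOp ħ U) = (c : ℂ) • (1 : Module.End ℂ U.smooth) := by
  refine U.exists_eq_smul_one_of_symm hU (dense_smooth_eucCover hd U) ?_
    (opC_commute_smoothOp hd hħ)
  refine IsAdjPair.sum _ fun k _ => IsAdjPair.sum _ fun l _ => ?_
  rw [sq]
  exact (isAdjPair_opW hd ħ k l).mul (isAdjPair_opW hd ħ k l)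

/-- Evaluate ⟨v, 2Cv⟩ using the symmetry of W. Since C is a scalar, this identity makes every W_kl
bounded and detects when all of them vanish. -/
theorem sum_norm_opW_sq (hd : 1 ≤ d) {ħ c : ℝ}
    (hc : opC (posOp ħ U) (angOp ħ U) = (c : ℂ) • (1 : Module.End ℂ U.smooth)) (v : U.smooth) :
    ∑ k, ∑ l, ‖(opW (posOp ħ U) (angOp ħ U) k l v : H)‖ ^ 2 = 2 * c * ‖(v : H)‖ ^ 2 := by
  have h1 := (euclideanRelations_rep U hd ħ).two_smul_C
  rw [hc] at h1
  have h2 : inner ℂ (v : H) (((2 : ℂ) • (c : ℂ) • v : U.smooth) : H)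
      = inner ℂ (v : H) (((∑ k, ∑ l, opW (posOp ħ U) (angOp ħ U) k l *
        opW (posOp ħ U) (angOp ħ U) k l) v : U.smooth) : H) := by rw [← h1]; rfl
  simp only [LinearMap.sum_apply, Submodule.coe_sum, inner_sum, Module.End.mul_apply,
    Submodule.coe_smul, inner_smul_right] at h2
  have h3 : ∀ k l, inner ℂ (v : H) ((opW (posOp ħ U) (angOp ħ U) k l
      (opW (posOp ħ U) (angOp ħ U) k l v) : U.smooth) : H)
      = ((‖(opW (posOp ħ U) (angOp ħ U) k l v : H)‖ ^ 2 : ℝ) : ℂ) := by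
    intro k l
    rw [← isAdjPair_opW hd ħ k l, inner_self_eq_norm_sq_to_K]
    push_cast
    rfl
  simp only [h3, inner_self_eq_norm_sq_to_K] at h2
  apply Complex.ofReal_injective
  simp only [Complex.ofReal_sum, Complex.ofReal_mul, Complex.ofReal_ofNat, Complex.ofReal_pow]
    at h2 ⊢
  rw [← h2, mul_assoc]
  rfl

theorem norm_opW_le (hd : 1 ≤ d) {ħ c : ℝ}
    (hc : opC (posOp ħ U) (angOp ħ U) = (c : ℂ) • (1 : Module.End ℂ U.smooth))
    (k l : Fin (d + 1)) (v : U.smooth) :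
    ‖(opW (posOp ħ U) (angOp ħ U) k l v : H)‖ ≤ √(2 * c) * ‖(v : H)‖ := by
  have h1 := sum_norm_opW_sq hd hc v
  have h2 : ‖(opW (posOp ħ U) (angOp ħ U) k l v : H)‖ ^ 2 ≤ 2 * c * ‖(v : H)‖ ^ 2 := by
    rw [← h1]
    refine le_trans ?_ (Finset.single_le_sum (fun k _ => Finset.sum_nonneg fun l _ => sq_nonneg _)
      (Finset.mem_univ k))
    exact Finset.single_le_sum (f := fun l => ‖(opW (posOp ħ U) (angOp ħ U) k l v : H)‖ ^ 2)
      (fun l _ => sq_nonneg _) (Finset.mem_univ l)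
  rw [← Real.sqrt_sq (norm_nonneg (v : H)), ← Real.sqrt_mul' _ (sq_nonneg _)]
  exact Real.le_sqrt_of_sq_le h2

theorem opC_eq_zero_iff (hd : 1 ≤ d) (ħ : ℝ) :
    opC (posOp ħ U) (angOp ħ U) = 0 ↔ ∀ k l, opW (posOp ħ U) (angOp ħ U) k l = 0 := by
  constructor
  · intro h k l
    ext v
    have h1 := norm_opW_le (c := 0) hd (by rw [h, Complex.ofReal_zero, zero_smul]) k l v
    rw [mul_zero, Real.sqrt_zero, zero_mul] at h1
    exact norm_le_zero_iff.1 h1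
  · intro h
    simp [opC, h]

theorem exists_selfAdjoint_extension {T : Module.End ℂ U.smooth} (hd : Dense (U.smooth : Set H))
    (hT : IsAdjPair U T T) {C : ℝ} (hC : ∀ v : U.smooth, ‖(T v : H)‖ ≤ C * ‖(v : H)‖) :
    ∃ S : H →L[ℂ] H, IsSelfAdjoint S ∧ ∀ v : U.smooth, S v = (T v : H) := by
  have hdr : DenseRange U.smooth.subtype := by simpa [DenseRange] using hd
  let S : H →L[ℂ] H := (U.smooth.subtype ∘ₗ T).extendOfNorm U.smooth.subtype
  have hS : ∀ v : U.smooth, S v = (T v : H) := LinearMap.extendOfNorm_eq hdr ⟨C, hC⟩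
  refine ⟨S, ?_, hS⟩
  rw [ContinuousLinearMap.isSelfAdjoint_iff_isSymmetric]
  intro x y
  refine hd.induction (P := fun x => inner ℂ (S x) y = inner ℂ x (S y)) (fun x hx => ?_)
    (isClosed_eq (S.continuous.inner continuous_const) (continuous_id.inner continuous_const)) x
  refine hd.induction (P := fun y => inner ℂ (S x) y = inner ℂ x (S y)) (fun y hy => ?_)
    (isClosed_eq (continuous_const.inner continuous_id) (continuous_const.inner S.continuous)) y
  have := hT ⟨x, hx⟩ ⟨y, hy⟩
  rwa [← hS, ← hS] at this

/-- The closure is the everywhere defined bounded extension S: the graph of S is closed, and the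
graph of T is dense in it. -/
theorem isSelfAdjointOp_of_bound {T : Module.End ℂ U.smooth} (hd : Dense (U.smooth : Set H))
    (hT : IsAdjPair U T T) {C : ℝ} (hC : ∀ v : U.smooth, ‖(T v : H)‖ ≤ C * ‖(v : H)‖) :
    IsSelfAdjointOp U T := by
  refine ⟨hd, hT, ?_⟩
  obtain ⟨S, hSS, hS⟩ := exists_selfAdjoint_extension hd hT hC
  let A : H →ₗ.[ℂ] H := (S : H →ₗ[ℂ] H).toPMap ⊤
  have hAgraph : ∀ x : H × H, x ∈ A.graph ↔ S x.1 = x.2 := by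
    intro x
    rw [LinearPMap.mem_graph_iff]
    constructor
    · rintro ⟨y, hy1, hy2⟩
      rw [← hy1, ← hy2]
      rfl
    · exact fun h => ⟨⟨x.1, trivial⟩, rfl, h⟩
  have hA : A.IsClosed := by
    have : (A.graph : Set (H × H)) = {x | S x.1 = x.2} := Set.ext hAgraph
    rw [LinearPMap.IsClosed, this]
    exact isClosed_eq (S.continuous.comp continuous_fst) continuous_snd
  have hle : toPMap U T ≤ A := by
    refine ⟨fun _ _ => trivial, ?_⟩
    intro x y hxy
    change ((T x : U.smooth) : H) = S y
    rw [← hxy]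
    exact (hS _).symm
  have hcl : (toPMap U T).closure = A := by
    have hclosable : (toPMap U T).IsClosable := hA.isClosable.leIsClosable hle
    apply LinearPMap.eq_of_eq_graph
    rw [← hclosable.graph_closure_eq_closure_graph]
    apply le_antisymm
    · exact Submodule.topologicalClosure_minimal _ (LinearPMap.le_graph_of_le hle) hA
    · rintro ⟨x, y⟩ hxy
      obtain rfl : S x = y := (hAgraph _).1 hxy
      refine map_mem_closure (f := fun x => (x, S x)) (continuous_id.prodMk S.continuous) (hd x) ?_
      intro v hv
      refine (LinearPMap.mem_graph_iff _).2 ⟨⟨v, hv⟩, rfl, (hS ⟨v, hv⟩).symm⟩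
  rw [hcl, LinearPMap.isSelfAdjoint_def,
    ContinuousLinearMap.toPMap_adjoint_eq_adjoint_toPMap_of_dense S (by simp)]
  rw [← ContinuousLinearMap.star_eq_adjoint, hSS.star_eq]

theorem isSelfAdjointOp_opW (hd : 1 ≤ d) {ħ : ℝ} (hħ : ħ ≠ 0) (hU : U.IsIrreducible)
    (k l : Fin (d + 1)) : IsSelfAdjointOp U (opW (posOp ħ U) (angOp ħ U) k l) := by
  obtain ⟨c, hc⟩ := exists_opC_eq_smul hd hħ hU
  exact isSelfAdjointOp_of_bound (dense_smooth_eucCover hd U) (isAdjPair_opW hd ħ k l)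
    (norm_opW_le hd hc k l)

end Casimir

end EuclideanCover

end

noncomputable section

namespace EuclideanCover

open Topology

/-! ### Joint functional calculus of commuting self-adjoint elements on a sphere -/

section JointCalculus

variable {ι : Type*} [Fintype ι]

/-- The coordinate functions on a sphere. -/
def coordC (r : ℝ) (i : ι) : C(Metric.sphere (0 : EuclideanSpace ℝ ι) r, ℂ) :=
  ⟨fun x => ((x : EuclideanSpace ℝ ι) i : ℂ), by fun_prop⟩

/-- Gelfand theory for the commutative C*-algebra B generated by the a_i. A character has real
values on the a_i, and their squares sum to r², so the character space maps to the sphere; functions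
on the sphere are pulled back to it and read as elements of B. -/
theorem exists_jointCalculus {A : Type*} [CStarAlgebra A] {a : ι → A} (ha : ∀ i, IsSelfAdjoint (a i))
    (hc : ∀ i j, Commute (a i) (a j)) {r : ℝ} (hr : 0 ≤ r) (hs : ∑ i, a i * a i = ((r ^ 2 : ℝ) : ℂ) • 1) :
    ∃ Φ : C(Metric.sphere (0 : EuclideanSpace ℝ ι) r, ℂ) →⋆ₐ[ℂ] A, ∀ i, Φ (coordC r i) = a i := by
  let S : StarSubalgebra ℂ A := StarAlgebra.adjoin ℂ (Set.range a)
  have : IsMulCommutative S := StarAlgebra.isMulCommutative_adjoin ℂ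
    (by rintro _ ⟨i, rfl⟩ _ ⟨j, rfl⟩; exact (hc i j).eq)
    (by rintro _ ⟨i, rfl⟩ _ ⟨j, rfl⟩; rw [(ha j).star_eq]; exact (hc i j).eq)
  let B := S.topologicalClosure
  have : IsClosed (B : Set A) := S.isClosed_topologicalClosure
  let _ : CommCStarAlgebra B :=
    { (inferInstance : CStarAlgebra B) with
      mul_comm := (S.commRingTopologicalClosure fun x y =>
        Subtype.ext (setLike_mul_comm x.2 y.2)).mul_comm }
  let b : ι → B := fun i =>
    ⟨a i, S.le_topologicalClosure (StarAlgebra.subset_adjoin ℂ _ ⟨i, rfl⟩)⟩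
  have hb : ∀ i, IsSelfAdjoint (b i) := fun i => Subtype.ext (ha i)
  have hsb : ∑ i, b i * b i = ((r ^ 2 : ℝ) : ℂ) • 1 := by
    apply Subtype.ext
    rw [AddSubmonoidClass.coe_finsetSum]
    exact hs
  have hreal : ∀ (χ : WeakDual.characterSpace ℂ B) i, ((χ (b i)).re : ℂ) = χ (b i) := by
    intro χ i
    rw [← Complex.conj_eq_iff_re]
    have h1 := map_star (gelfandStarTransform B) (b i)
    rw [(hb i).star_eq] at h1
    exact (DFunLike.congr_fun h1 χ).symm
  let κ : C(WeakDual.characterSpace ℂ B, Metric.sphere (0 : EuclideanSpace ℝ ι) r) :=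
    ⟨fun χ => ⟨WithLp.toLp 2 fun i => (χ (b i)).re, by
      rw [mem_sphere_zero_iff_norm, EuclideanSpace.norm_eq, ← Real.sqrt_sq hr]
      congr 1
      apply Complex.ofReal_injective
      rw [Complex.ofReal_sum]
      calc ∑ i, ((‖(χ (b i)).re‖ ^ 2 : ℝ) : ℂ) = ∑ i, χ (b i * b i) := by
            refine Finset.sum_congr rfl fun i _ => ?_
            rw [Real.norm_eq_abs, sq_abs, Complex.ofReal_pow, hreal, map_mul, sq]
        _ = _ := by rw [← map_sum, hsb, map_smul, map_one, smul_eq_mul, mul_one]⟩, by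
      refine Continuous.subtype_mk ?_ _
      refine (PiLp.continuous_toLp 2 _).comp (continuous_pi fun i => Complex.continuous_re.comp ?_)
      exact (gelfandStarTransform B (b i)).continuous⟩
  refine ⟨B.subtype.comp (((gelfandStarTransform B).symm : C(WeakDual.characterSpace ℂ B, ℂ) →⋆ₐ[ℂ] B).comp
    (ContinuousMap.compStarAlgHom' ℂ ℂ κ)), fun i => ?_⟩
  have h1 : ContinuousMap.compStarAlgHom' ℂ ℂ κ (coordC r i) = gelfandStarTransform B (b i) := by
    ext χ
    exact hreal χ i
  have h2 : (gelfandStarTransform B).symm (ContinuousMap.compStarAlgHom' ℂ ℂ κ (coordC r i)) = b i := by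
    rw [h1]
    exact (gelfandStarTransform B).symm_apply_apply _
  exact congrArg Subtype.val h2

/-- Stone–Weierstrass: the coordinate functions separate points, and star homomorphisms are
continuous. -/
theorem starAlgHom_ext_coordC {A : Type*} [CStarAlgebra A] {r : ℝ}
    {Φ Ψ : C(Metric.sphere (0 : EuclideanSpace ℝ ι) r, ℂ) →⋆ₐ[ℂ] A}
    (h : ∀ i, Φ (coordC r i) = Ψ (coordC r i)) : Φ = Ψ := by
  let S := StarAlgebra.adjoin ℂ (Set.range (coordC (ι := ι) r))
  have hS : S.topologicalClosure = ⊤ := by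
    refine ContinuousMap.starSubalgebra_topologicalClosure_eq_top_of_separatesPoints _ ?_
    intro x y hxy
    have : ∃ i, (x : EuclideanSpace ℝ ι) i ≠ (y : EuclideanSpace ℝ ι) i := by
      by_contra! h'
      exact hxy (Subtype.ext (PiLp.ext h'))
    obtain ⟨i, hi⟩ := this
    refine ⟨_, ⟨coordC r i, StarAlgebra.subset_adjoin ℂ _ ⟨i, rfl⟩, rfl⟩, ?_⟩
    intro h'
    exact hi (Complex.ofReal_injective h')
  ext f
  have hf : f ∈ S.topologicalClosure := by rw [hS]; trivial
  have hle : S ≤ StarAlgHom.equalizer Φ Ψ := by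
    refine StarAlgebra.adjoin_le ?_
    rintro _ ⟨i, rfl⟩
    exact h i
  have hcont : ∀ Φ : C(Metric.sphere (0 : EuclideanSpace ℝ ι) r, ℂ) →⋆ₐ[ℂ] A, Continuous Φ :=
    fun Φ => AddMonoidHomClass.continuous_of_bound Φ 1 fun x => by
      simpa using NonUnitalStarAlgHom.norm_apply_le Φ x
  have hcl : IsClosed {f | Φ f = Ψ f} := isClosed_eq (hcont Φ) (hcont Ψ)
  exact closure_minimal (fun g hg => hle hg) hcl hf

end JointCalculus

end EuclideanCover

end

noncomputable section

namespace EuclideanCover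

open Topology

/-! ### Functional calculus of the position operators -/

/-- The sphere of radius `r` in `ℝᵈ⁺¹`. -/
abbrev PosSphere (d : ℕ) (r : ℝ) : Type := Metric.sphere (0 : EuclideanSpace ℝ (Fin (d + 1))) r

/-- The rotation of the sphere by an element of the spin group. -/
def rotSphere {d : ℕ} {r : ℝ} (s : Spin (d + 1)) : C(PosSphere d r, PosSphere d r) :=
  ⟨fun x => ⟨spinRot s x, by
    rw [mem_sphere_zero_iff_norm, norm_spinRot]
    exact mem_sphere_zero_iff_norm.1 x.2⟩, by
    refine Continuous.subtype_mk ?_ _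
    exact continuous_spinRot.comp (continuous_const.prodMk continuous_subtype_val)⟩

theorem continuous_rotSphere {d : ℕ} {r : ℝ} {Y : Type*} [TopologicalSpace Y]
    {f : Y → Spin (d + 1)} {g : Y → PosSphere d r} (hf : Continuous f) (hg : Continuous g) :
    Continuous fun y => rotSphere (f y) (g y) :=
  Continuous.subtype_mk (continuous_spinRot.comp
    (hf.prodMk (continuous_subtype_val.comp hg))) _

theorem rotSphere_mul {d : ℕ} {r : ℝ} (s t : Spin (d + 1)) (x : PosSphere d r) :
    rotSphere (s * t) x = rotSphere s (rotSphere t x) := Subtype.ext (spinRot_mul s t _)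

section PositionCalculus

variable {d : ℕ} {H : Type*} [NormedAddCommGroup H] [InnerProductSpace ℂ H] [CompleteSpace H]
  {U : UnitaryRep (EucCover (d + 1)) H} {ħ r : ℝ}

theorem norm_posOp_le (hr : 0 ≤ r)
    (hX : sqX (posOp ħ U) = ((r ^ 2 : ℝ) : ℂ) • (1 : Module.End ℂ U.smooth)) (k : Fin (d + 1))
    (v : U.smooth) : ‖(posOp ħ U k v : H)‖ ≤ r * ‖(v : H)‖ := by
  have h1 : inner ℂ (v : H) ((sqX (posOp ħ U) v : U.smooth) : H)
      = ((∑ m, ‖(posOp ħ U m v : H)‖ ^ 2 : ℝ) : ℂ) := by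
    rw [sqX, LinearMap.sum_apply, Submodule.coe_sum, inner_sum, Complex.ofReal_sum]
    refine Finset.sum_congr rfl fun m _ => ?_
    rw [Module.End.mul_apply, ← isAdjPair_posOp ħ m, inner_self_eq_norm_sq_to_K, Complex.ofReal_pow]
    rfl
  have h2 : inner ℂ (v : H) ((sqX (posOp ħ U) v : U.smooth) : H)
      = ((r ^ 2 * ‖(v : H)‖ ^ 2 : ℝ) : ℂ) := by
    rw [hX, LinearMap.smul_apply, Module.End.one_apply, Submodule.coe_smul, inner_smul_right,
      inner_self_eq_norm_sq_to_K, Complex.ofReal_mul, Complex.ofReal_pow (‖(v : H)‖)]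
    rfl
  have h3 : ∑ m, ‖(posOp ħ U m v : H)‖ ^ 2 = r ^ 2 * ‖(v : H)‖ ^ 2 :=
    Complex.ofReal_injective (h1.symm.trans h2)
  have h4 : ‖(posOp ħ U k v : H)‖ ^ 2 ≤ (r * ‖(v : H)‖) ^ 2 := by
    rw [mul_pow, ← h3]
    exact Finset.single_le_sum (f := fun m => ‖(posOp ħ U m v : H)‖ ^ 2)
      (fun m _ => sq_nonneg _) (Finset.mem_univ k)
  exact le_of_sq_le_sq h4 (by positivity)

theorem posOp_smoothOp (hd : 1 ≤ d) (s : Spin (d + 1)) (k : Fin (d + 1)) (v : U.smooth) :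
    posOp ħ U k (U.smoothOp (inSpin s) v) = U.smoothOp (inSpin s)
      (∑ m, ((spinRot s (EuclideanSpace.single m 1) k : ℝ) : ℂ) • posOp ħ U m v) := by
  have h1 := inSpin_conj_dRep_transParam U (by omega) s⁻¹ k
  have h2 : ∀ m, spinRot s⁻¹ (EuclideanSpace.single k (1 : ℝ)) m
      = spinRot s (EuclideanSpace.single m 1) k := by
    intro m
    have h3 := inner_spinRot s (spinRot s⁻¹ (EuclideanSpace.single k (1 : ℝ)))
      (EuclideanSpace.single m 1)
    rw [← spinRot_mul, mul_inv_cancel, spinRot_one] at h3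
    simpa [EuclideanSpace.inner_single_left, EuclideanSpace.inner_single_right] using h3.symm
  simp only [h2] at h1
  rw [map_inv, inv_inv] at h1
  have h4 := LinearMap.congr_fun (congrArg (U.smoothOp (inSpin s) * ·) h1) v
  simp only [← mul_assoc, U.smoothOp_mul_inv, one_mul] at h4
  simp only [Module.End.mul_apply, LinearMap.sum_apply, LinearMap.smul_apply] at h4
  simp only [posOp, LinearMap.smul_apply]
  rw [h4, ← map_smul, Finset.smul_sum]
  simp only [smul_comm (Complex.I * (ħ : ℂ))]

/-- The functional calculus of the position operators, on the sphere which carries their joint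
spectrum, together with its covariance under rotations. -/
theorem exists_positionCalculus (hd : 1 ≤ d) (hr : 0 ≤ r)
    (hX : sqX (posOp ħ U) = ((r ^ 2 : ℝ) : ℂ) • (1 : Module.End ℂ U.smooth)) :
    ∃ Φ : C(PosSphere d r, ℂ) →⋆ₐ[ℂ] (H →L[ℂ] H),
      (∀ (k : Fin (d + 1)) (v : U.smooth), Φ (coordC r k) v = (posOp ħ U k v : H)) ∧
      ∀ (s : Spin (d + 1)) f w,
        U.op (inSpin s) (Φ (f.comp (rotSphere s)) w) = Φ f (U.op (inSpin s) w) := by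
  have hdn := dense_smooth_eucCover hd U
  have hext : ∀ S T : H →L[ℂ] H, (∀ v : U.smooth, S v = T v) → S = T := by
    intro S T h
    ext x
    exact hdn.induction (P := fun x => S x = T x) (fun x hx => h ⟨x, hx⟩)
      (isClosed_eq S.continuous T.continuous) x
  choose X hXsa hXv using fun k : Fin (d + 1) =>
    exists_selfAdjoint_extension hdn (isAdjPair_posOp ħ k) (norm_posOp_le hr hX k)
  have hrel := euclideanRelations_rep U hd ħ
  obtain ⟨Φ, hΦ⟩ := exists_jointCalculus hXsa (fun k l => by
    refine hext _ _ fun v => ?_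
    rw [mul_apply_eq_comp, mul_apply_eq_comp, hXv, hXv, hXv, hXv]
    exact congrArg Subtype.val (LinearMap.congr_fun (hrel.X_comm k l) v)) hr (by
    refine hext _ _ fun v => ?_
    have := congrArg Subtype.val (LinearMap.congr_fun hX v)
    rw [sqX, LinearMap.sum_apply, Submodule.coe_sum] at this
    rw [sum_apply]
    simp only [mul_apply_eq_comp, hXv]
    exact this)
  have hΦv : ∀ (k : Fin (d + 1)) (v : U.smooth), Φ (coordC r k) v = (posOp ħ U k v : H) :=
    fun k v => by rw [hΦ, hXv]
  refine ⟨Φ, hΦv, fun s f w => ?_⟩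
  -- Rotating the function and conjugating by U(s) gives another calculus. It has the same values on
  -- the coordinates, because X is a vector operator, so uniqueness yields covariance.
  let Ψ : C(PosSphere d r, ℂ) →⋆ₐ[ℂ] (H →L[ℂ] H) :=
    ((Unitary.conjStarAlgAut ℂ (H →L[ℂ] H) (U.toHom (inSpin s)) :
      (H →L[ℂ] H) →⋆ₐ[ℂ] (H →L[ℂ] H)).comp Φ).comp
      (ContinuousMap.compStarAlgHom' ℂ ℂ (rotSphere s))
  have hΨ : ∀ f x, Ψ f x = U.op (inSpin s) (Φ (f.comp (rotSphere s)) (U.op (inSpin s)⁻¹ x)) := by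
    intro f x
    have h0 : U.op (inSpin s)⁻¹ = star (U.toHom (inSpin s) : H →L[ℂ] H) := by
      rw [UnitaryRep.op, map_inv]
      rfl
    rw [h0]
    rfl
  have h : Ψ = Φ := by
    refine starAlgHom_ext_coordC fun k => hext _ _ fun v => ?_
    have h1 : (coordC r k).comp (rotSphere s) = ∑ m,
        ((spinRot s (EuclideanSpace.single m 1) k : ℝ) : ℂ) • coordC r m := by
      ext x
      have h2 : (x : EuclideanSpace ℝ (Fin (d + 1)))
          = ∑ m, (x : EuclideanSpace ℝ (Fin (d + 1))) m • EuclideanSpace.single m (1 : ℝ) := by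
        ext i
        simp [Finset.sum_apply, Pi.single_apply]
      have h3 : spinRot s (x : EuclideanSpace ℝ (Fin (d + 1))) k
          = ∑ m, (x : EuclideanSpace ℝ (Fin (d + 1))) m * spinRot s (EuclideanSpace.single m 1) k := by
        conv_lhs => rw [h2]
        change spinRotₗ s _ k = _
        rw [map_sum]
        simp only [map_smul, WithLp.ofLp_sum, Finset.sum_apply, PiLp.smul_apply, smul_eq_mul]
        rfl
      rw [ContinuousMap.sum_apply]
      change ((spinRot s (x : EuclideanSpace ℝ (Fin (d + 1))) k : ℝ) : ℂ) = _
      rw [h3, Complex.ofReal_sum]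
      refine Finset.sum_congr rfl fun m _ => ?_
      rw [Complex.ofReal_mul, mul_comm]
      rfl
    rw [hΨ, h1, hΦv]
    have h4 : U.op (inSpin s)⁻¹ (v : H) = ((U.smoothOp (inSpin s)⁻¹ v : U.smooth) : H) := rfl
    have h5 := posOp_smoothOp (ħ := ħ) hd s k (U.smoothOp (inSpin s)⁻¹ v)
    have h6 : U.smoothOp (inSpin s) (U.smoothOp (inSpin s)⁻¹ v) = v :=
      LinearMap.congr_fun (U.smoothOp_mul_inv _) v
    rw [h6] at h5
    rw [h5, U.coe_smoothOp, h4, map_sum, sum_apply, Submodule.coe_sum]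
    simp only [map_smul, smul_apply, hΦv, Submodule.coe_smul]
  have h7 := hΨ f (U.op (inSpin s) w)
  rw [U.op_inv_op, h] at h7
  exact h7.symm

end PositionCalculus

end EuclideanCover

end

noncomputable section

namespace EuclideanCover

open Topology MeasureTheory

/-! ### Cut-off functions on the sphere -/

/-- A continuous function supported in `[-η, η]` and equal to one on `[-η / 2, η / 2]`. -/
def bump (η y : ℝ) : ℝ := max 0 (min 1 (2 - 2 * |y| / η))

theorem continuous_bump (η : ℝ) : Continuous (bump η) := by
  unfold bump
  fun_prop

theorem bump_nonneg (η y : ℝ) : 0 ≤ bump η y := le_max_left _ _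

theorem bump_le_one (η y : ℝ) : bump η y ≤ 1 := max_le zero_le_one (min_le_left _ _)

theorem bump_neg (η y : ℝ) : bump η (-y) = bump η y := by rw [bump, bump, abs_neg]

theorem bump_eq_one {η y : ℝ} (hη : 0 < η) (h : |y| ≤ η / 2) : bump η y = 1 := by
  have : 2 * |y| / η ≤ 1 := by rw [div_le_one hη]; linarith
  rw [bump, min_eq_left (by linarith), max_eq_right zero_le_one]

theorem abs_lt_of_bump_ne_zero {η y : ℝ} (hη : 0 < η) (h : bump η y ≠ 0) : |y| < η := by
  by_contra! hy
  apply h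
  have : 2 ≤ 2 * |y| / η := by rw [le_div_iff₀ hη]; linarith
  exact max_eq_left ((min_le_right _ _).trans (by linarith))

theorem integral_bump_sq_eq_zero {ε δ : ℝ} (hε : 0 < ε) (hδ : 0 ≤ δ) {g : ℝ → ℝ}
    (h : ∀ t ∈ Set.Icc 0 δ, ε ≤ |g t|) : ∫ t in (0 : ℝ)..δ, bump ε (g t) ^ 2 = 0 := by
  rw [intervalIntegral.integral_of_le hδ,
    setIntegral_congr_fun (g := fun _ => (0 : ℝ)) measurableSet_Ioc, integral_zero]
  intro t ht
  have h2 : bump ε (g t) = 0 := by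
    by_contra h0
    exact absurd (abs_lt_of_bump_ne_zero hε h0) (h t ⟨ht.1.le, ht.2⟩).not_gt
  simp only [h2]
  norm_num

/-- If |g t| < ε as well, then m|t - s| ≤ |g t - g s| < 2ε. The integrand is therefore supported
within 2ε/m of s, an interval of length 4ε/m. -/
theorem integral_bump_sq_le {ε m δ s : ℝ} (hε : 0 < ε) (hm : 0 < m) (hδ : 0 ≤ δ) {g : ℝ → ℝ}
    (hg : Continuous g) (hgs : |g s| < ε)
    (h : ∀ t ∈ Set.Icc 0 δ, m * |t - s| ≤ |g t - g s|) :
    ∫ t in (0 : ℝ)..δ, bump ε (g t) ^ 2 ≤ 4 * ε / m := by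
  have hind : ∀ t ∈ Set.Icc 0 δ, bump ε (g t) ^ 2
      ≤ (Set.Icc (s - 2 * ε / m) (s + 2 * ε / m)).indicator (fun _ => (1 : ℝ)) t := by
    intro t ht
    by_cases h0 : bump ε (g t) = 0
    · rw [h0]
      exact (by norm_num : (0 : ℝ) ^ 2 = 0).trans_le (Set.indicator_nonneg (fun _ _ => zero_le_one) _)
    · have h1 := abs_lt_of_bump_ne_zero hε h0
      have h2 := h t ht
      have h3 : |t - s| ≤ 2 * ε / m := by
        rw [le_div_iff₀ hm, mul_comm]
        have := abs_sub (g t) (g s)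
        linarith
      rw [abs_le] at h3
      rw [Set.indicator_of_mem (Set.mem_Icc.2 ⟨by linarith, by linarith⟩)]
      exact pow_le_one₀ (bump_nonneg _ _) (bump_le_one _ _)
  calc ∫ t in (0 : ℝ)..δ, bump ε (g t) ^ 2
      ≤ ∫ t in (0 : ℝ)..δ, (Set.Icc (s - 2 * ε / m) (s + 2 * ε / m)).indicator (fun _ => (1 : ℝ)) t := by
        refine intervalIntegral.integral_mono_on hδ
          (((continuous_bump ε).comp hg).pow 2 |>.intervalIntegrable _ _) ?_ hind
        rw [intervalIntegrable_iff]
        exact ((integrable_indicator_iff measurableSet_Icc).2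
            (integrableOn_const (by simp))).integrableOn
    _ = ∫ t in Set.Ioc 0 δ, (Set.Icc (s - 2 * ε / m) (s + 2 * ε / m)).indicator (fun _ => (1 : ℝ)) t :=
        intervalIntegral.integral_of_le hδ
    _ ≤ ∫ t, (Set.Icc (s - 2 * ε / m) (s + 2 * ε / m)).indicator (fun _ => (1 : ℝ)) t := by
        refine setIntegral_le_integral ?_ (Filter.Eventually.of_forall fun t =>
          Set.indicator_nonneg (fun _ _ => zero_le_one) _)
        exact (integrable_indicator_iff measurableSet_Icc).2 (integrableOn_const (by simp))
    _ = 4 * ε / m := by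
        rw [integral_indicator measurableSet_Icc]
        simp only [integral_const, smul_eq_mul, mul_one, Measure.real, Measure.restrict_apply,
          MeasurableSet.univ, Set.univ_inter, Real.volume_Icc]
        rw [ENNReal.toReal_ofReal]
        · ring
        · have : 0 ≤ 2 * ε / m := by positivity
          linarith

variable {d : ℕ} {r : ℝ}

/-- The product of bump functions in the coordinates with index in `T`. -/
def cut (r η : ℝ) (T : Finset (Fin d)) : C(PosSphere d r, ℝ) :=
  ⟨fun x => ∏ k ∈ T, bump η ((x : EuclideanSpace ℝ (Fin (d + 1))) k.castSucc), by
    refine continuous_finsetProd _ fun k _ => (continuous_bump η).comp ?_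
    fun_prop⟩

theorem cut_apply (η : ℝ) (T : Finset (Fin d)) (x : PosSphere d r) :
    cut r η T x = ∏ k ∈ T, bump η ((x : EuclideanSpace ℝ (Fin (d + 1))) k.castSucc) := rfl

theorem cut_nonneg (η : ℝ) (T : Finset (Fin d)) (x : PosSphere d r) : 0 ≤ cut r η T x :=
  Finset.prod_nonneg fun _ _ => bump_nonneg _ _

theorem cut_le_one (η : ℝ) (T : Finset (Fin d)) (x : PosSphere d r) : cut r η T x ≤ 1 :=
  Finset.prod_le_one (fun _ _ => bump_nonneg _ _) fun _ _ => bump_le_one _ _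

theorem cut_insert (η : ℝ) {T : Finset (Fin d)} {j : Fin d} (hj : j ∉ T) (x : PosSphere d r) :
    cut r η (insert j T) x
      = bump η ((x : EuclideanSpace ℝ (Fin (d + 1))) j.castSucc) * cut r η T x :=
  Finset.prod_insert hj

theorem abs_lt_of_cut_ne_zero {η : ℝ} (hη : 0 < η) {T : Finset (Fin d)} {x : PosSphere d r}
    (h : cut r η T x ≠ 0) {k : Fin d} (hk : k ∈ T) :
    |(x : EuclideanSpace ℝ (Fin (d + 1))) k.castSucc| < η :=
  abs_lt_of_bump_ne_zero hη (Finset.prod_ne_zero_iff.1 h k hk)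

theorem sum_sq_posSphere (x : PosSphere d r) :
    ∑ k : Fin d, (x : EuclideanSpace ℝ (Fin (d + 1))) k.castSucc ^ 2
      + (x : EuclideanSpace ℝ (Fin (d + 1))) (Fin.last d) ^ 2 = r ^ 2 := by
  have h := EuclideanSpace.norm_sq_eq (x : EuclideanSpace ℝ (Fin (d + 1)))
  rw [mem_sphere_zero_iff_norm.1 x.2, Fin.sum_univ_castSucc] at h
  simp only [Real.norm_eq_abs, sq_abs] at h
  exact h.symm

theorem abs_apply_le (x : PosSphere d r) (k : Fin (d + 1)) :
    |(x : EuclideanSpace ℝ (Fin (d + 1))) k| ≤ r :=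
  (PiLp.norm_apply_le (x : EuclideanSpace ℝ (Fin (d + 1))) k).trans_eq
    (mem_sphere_zero_iff_norm.1 x.2)

/-- The rotations in the plane of the coordinate `j` and the last coordinate. -/
def polar (j : Fin d) (t : ℝ) : Spin (d + 1) :=
  spinRotor j.castSucc (Fin.last d) (Fin.castSucc_lt_last j).ne t

theorem continuous_polar (j : Fin d) : Continuous (polar j) :=
  continuous_spinRotor _ _ (Fin.castSucc_lt_last j).ne

theorem polar_apply_self (j : Fin d) (t : ℝ) (x : PosSphere d r) :
    (rotSphere (polar j t) x : EuclideanSpace ℝ (Fin (d + 1))) j.castSucc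
      = Real.cos t * (x : EuclideanSpace ℝ (Fin (d + 1))) j.castSucc
        + Real.sin t * (x : EuclideanSpace ℝ (Fin (d + 1))) (Fin.last d) :=
  spinRot_spinRotor_left _ _ _ _ _

theorem polar_apply_last (j : Fin d) (t : ℝ) (x : PosSphere d r) :
    (rotSphere (polar j t) x : EuclideanSpace ℝ (Fin (d + 1))) (Fin.last d)
      = Real.cos t * (x : EuclideanSpace ℝ (Fin (d + 1))) (Fin.last d)
        - Real.sin t * (x : EuclideanSpace ℝ (Fin (d + 1))) j.castSucc :=
  spinRot_spinRotor_right _ _ _ _ _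

theorem polar_apply_of_ne {j k : Fin d} (h : k ≠ j) (t : ℝ) (x : PosSphere d r) :
    (rotSphere (polar j t) x : EuclideanSpace ℝ (Fin (d + 1))) k.castSucc
      = (x : EuclideanSpace ℝ (Fin (d + 1))) k.castSucc :=
  spinRot_spinRotor_of_ne _ _ _ _ _ (fun h' => h (Fin.castSucc_injective d h'))
    (Fin.castSucc_lt_last k).ne

theorem cut_polar {η : ℝ} {T : Finset (Fin d)} {j : Fin d} (hj : j ∉ T) (t : ℝ) (x : PosSphere d r) :
    cut r η T (rotSphere (polar j t) x) = cut r η T x := by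
  refine Finset.prod_congr rfl fun k hk => ?_
  rw [polar_apply_of_ne (ne_of_mem_of_not_mem hk hj)]

/-- The j-th coordinate moves with velocity equal to the last coordinate, so near the poles it
passes through a narrow strip at a speed bounded below. -/
theorem hasDerivAt_polar (j : Fin d) (x : PosSphere d r) (t : ℝ) :
    HasDerivAt (fun t => (rotSphere (polar j t) x : EuclideanSpace ℝ (Fin (d + 1))) j.castSucc)
      ((rotSphere (polar j t) x : EuclideanSpace ℝ (Fin (d + 1))) (Fin.last d)) t := by
  simp only [polar_apply_self, polar_apply_last]
  have h := ((Real.hasDerivAt_cos t).mul_const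
    ((x : EuclideanSpace ℝ (Fin (d + 1))) j.castSucc)).add ((Real.hasDerivAt_sin t).mul_const
    ((x : EuclideanSpace ℝ (Fin (d + 1))) (Fin.last d)))
  exact h.congr_deriv (by ring)

theorem exists_polar_sub (j : Fin d) (x : PosSphere d r) (s t : ℝ) :
    ∃ u ∈ Set.uIcc s t, (rotSphere (polar j t) x : EuclideanSpace ℝ (Fin (d + 1))) j.castSucc
      - (rotSphere (polar j s) x : EuclideanSpace ℝ (Fin (d + 1))) j.castSucc
      = (rotSphere (polar j u) x : EuclideanSpace ℝ (Fin (d + 1))) (Fin.last d) * (t - s) := by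
  have key : ∀ s t : ℝ, s < t → ∃ u ∈ Set.Icc s t,
      (rotSphere (polar j t) x : EuclideanSpace ℝ (Fin (d + 1))) j.castSucc
      - (rotSphere (polar j s) x : EuclideanSpace ℝ (Fin (d + 1))) j.castSucc
      = (rotSphere (polar j u) x : EuclideanSpace ℝ (Fin (d + 1))) (Fin.last d) * (t - s) := by
    intro s t hst
    obtain ⟨u, hu, h⟩ := exists_hasDerivAt_eq_slope _ _ hst
      (fun u _ => (hasDerivAt_polar j x u).continuousAt.continuousWithinAt)
      (fun u _ => hasDerivAt_polar j x u)
    refine ⟨u, Set.Ioo_subset_Icc_self hu, ?_⟩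
    rw [h, div_mul_cancel₀ _ (sub_pos.2 hst).ne']
  rcases lt_trichotomy s t with h | rfl | h
  · obtain ⟨u, hu, h'⟩ := key s t h
    exact ⟨u, Set.Icc_subset_uIcc hu, h'⟩
  · exact ⟨s, Set.left_mem_uIcc, by simp⟩
  · obtain ⟨u, hu, h'⟩ := key t s h
    exact ⟨u, Set.Icc_subset_uIcc' hu, by linarith⟩

theorem abs_polar_sub_le (j : Fin d) (x : PosSphere d r) (s t : ℝ) :
    |(rotSphere (polar j t) x : EuclideanSpace ℝ (Fin (d + 1))) j.castSucc
      - (rotSphere (polar j s) x : EuclideanSpace ℝ (Fin (d + 1))) j.castSucc| ≤ r * |t - s| := by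
  obtain ⟨u, -, h⟩ := exists_polar_sub j x s t
  rw [h, abs_mul]
  exact mul_le_mul_of_nonneg_right (abs_apply_le _ _) (abs_nonneg _)

/-- Averaging a narrow cut-off function over small rotations. -/
theorem integral_cut_sq_le (hr : 0 < r) {ε η δ : ℝ} (hε : 0 < ε) (hδ : 0 ≤ δ) (hη : d * η ^ 2 ≤ 3 / 4 * r ^ 2)
    (hεδ : ε + δ * r ≤ η / 2) {T : Finset (Fin d)} {j : Fin d} (hj : j ∉ T) (x : PosSphere d r) :
    ∫ t in (0 : ℝ)..δ, ((cut r ε Tᶜ * cut r η T) (rotSphere (polar j t) x)) ^ 2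
      ≤ 8 * ε / r * ((cut r ε (insert j T)ᶜ * cut r η (insert j T)) x) ^ 2 := by
  have hδr : 0 ≤ δ * r := by positivity
  have hη0 : 0 < η := by linarith
  have hTc : Tᶜ = insert j (insert j T)ᶜ := by
    ext k
    by_cases hk : k = j
    · simp [hk, hj]
    · simp [hk]
  have hjc : j ∉ (insert j T)ᶜ := by simp
  set g : ℝ → ℝ := fun t => (rotSphere (polar j t) x : EuclideanSpace ℝ (Fin (d + 1))) j.castSucc
    with hg
  set Q : ℝ := cut r ε (insert j T)ᶜ x * cut r η T x with hQ
  have h1 : ∀ t, (cut r ε Tᶜ * cut r η T) (rotSphere (polar j t) x) = bump ε (g t) * Q := by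
    intro t
    rw [ContinuousMap.mul_apply, hTc, cut_insert _ hjc, cut_polar hjc, cut_polar hj, hQ]
    ring
  have h2 : (cut r ε (insert j T)ᶜ * cut r η (insert j T)) x
      = bump η ((x : EuclideanSpace ℝ (Fin (d + 1))) j.castSucc) * Q := by
    rw [ContinuousMap.mul_apply, cut_insert _ hj, hQ]
    ring
  simp only [h1, h2, mul_pow, intervalIntegral.integral_mul_const]
  rw [← mul_assoc]
  -- Q collects the cut-offs which the rotation leaves unchanged. If it vanishes, both sides are
  -- zero; otherwise each of the first d coordinates other than the j-th has size at most η.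
  by_cases hQ0 : Q = 0
  · rw [hQ0]
    norm_num
  refine mul_le_mul_of_nonneg_right ?_ (sq_nonneg Q)
  have hgc : Continuous g := continuous_iff_continuousAt.2 fun t => (hasDerivAt_polar j x t).continuousAt
  have hg0 : g 0 = (x : EuclideanSpace ℝ (Fin (d + 1))) j.castSucc := by
    simp only [hg, polar_apply_self]
    simp
  have hsmall : ∀ s ∈ Set.Icc 0 δ, |g s| < ε → ∀ t ∈ Set.Icc 0 δ, |g t| ≤ η / 2 := by
    intro s hs hgs t ht
    have h3 := abs_polar_sub_le j x s t
    have h4 : |t - s| ≤ δ := abs_le.2 ⟨by linarith [hs.2, ht.1], by linarith [hs.1, ht.2]⟩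
    have h5 : r * |t - s| ≤ r * δ := mul_le_mul_of_nonneg_left h4 hr.le
    have h6 : |g t| ≤ |g t - g s| + |g s| := by
      have := abs_add_le (g t - g s) (g s)
      rwa [sub_add_cancel] at this
    have h7 : |g t - g s| ≤ r * |t - s| := h3
    linarith
  have hQk : ∀ k, k ≠ j → (x : EuclideanSpace ℝ (Fin (d + 1))) k.castSucc ^ 2 ≤ η ^ 2 := by
    intro k hk
    have h3 : |(x : EuclideanSpace ℝ (Fin (d + 1))) k.castSucc| ≤ η := by
      by_cases hkT : k ∈ T
      · exact (abs_lt_of_cut_ne_zero hη0 (right_ne_zero_of_mul hQ0) hkT).le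
      · exact (abs_lt_of_cut_ne_zero hε (left_ne_zero_of_mul hQ0) (by simp [hk, hkT])).le.trans
          (by linarith)
    exact sq_le_sq' (abs_le.1 h3).1 (abs_le.1 h3).2
  -- If the rotated coordinate never enters the strip, the integral is zero. If it does, ε + δr ≤
  -- η/2 keeps it within η/2 for all times, so the wide bump at x equals 1.
  by_cases hit : ∃ s ∈ Set.Icc 0 δ, |g s| < ε
  · obtain ⟨s, hs, hgs⟩ := hit
    rw [bump_eq_one hη0 (by rw [← hg0]; exact hsmall s hs hgs 0 ⟨le_rfl, hδ⟩), one_pow, mul_one]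
    -- The first d coordinates stay within η, so dη² ≤ ¾ r² forces the last one to have size at
    -- least r/2. This is the slope m, and 4ε/m = 8ε/r.
    have h3 := integral_bump_sq_le (m := r / 2) hε (by positivity) hδ hgc hgs (by
      intro t ht
      obtain ⟨u, hu, h4⟩ := exists_polar_sub j x s t
      have hu' : u ∈ Set.Icc 0 δ := (Set.uIcc_subset_Icc hs ht) hu
      have h5 : g t - g s = (rotSphere (polar j u) x : EuclideanSpace ℝ (Fin (d + 1))) (Fin.last d)
        * (t - s) := h4
      rw [h5, abs_mul]
      refine mul_le_mul_of_nonneg_right ?_ (abs_nonneg _)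
      have h6 := sum_sq_posSphere (rotSphere (polar j u) x)
      have h7 : ∑ k : Fin d, (rotSphere (polar j u) x : EuclideanSpace ℝ (Fin (d + 1))) k.castSucc ^ 2
          ≤ ∑ _k : Fin d, η ^ 2 := by
        refine Finset.sum_le_sum fun k _ => ?_
        by_cases hk : k = j
        · subst hk
          have h8 : |g u| ≤ η := (hsmall s hs hgs u hu').trans (by linarith)
          exact sq_le_sq' (abs_le.1 h8).1 (abs_le.1 h8).2
        · rw [polar_apply_of_ne hk]
          exact hQk k hk
      rw [Finset.sum_const, Finset.card_univ, Fintype.card_fin, nsmul_eq_mul] at h7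
      rw [← abs_of_pos (half_pos hr)]
      refine sq_le_sq.1 ?_
      rw [div_pow]
      linarith)
    refine h3.trans (le_of_eq ?_)
    field_simp
    norm_num
  · push Not at hit
    rw [integral_bump_sq_eq_zero hε hδ hit]
    positivity

/-- The sphere is covered by few rotations of a narrow neighbourhood of the poles. -/
theorem exists_rotations_cover (hr : 0 < r) {ε : ℝ} (hε : 0 < ε) (hεr : ε ≤ r) (T : Finset (Fin d)) :
    ∃ (ι : Type) (_ : Fintype ι) (s : ι → Spin (d + 1)), (Fintype.card ι : ℝ) ≤ (8 * r / ε) ^ T.card ∧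
      ∀ x : PosSphere d r, 1 ≤ ∑ i, cut r ε T (rotSphere (s i) x) ^ 2 := by
  induction T using Finset.induction_on with
  | empty => exact ⟨Unit, inferInstance, fun _ => 1, by simp, fun x => by simp [cut_apply]⟩
  | insert j T hj ih =>
    obtain ⟨ι, _, s, hcard, hs⟩ := ih
    -- Turning by h moves a coordinate by at most rh = ε/2, the radius on which the bump is 1. The
    -- number of angles is at most 2πr/ε + 1 ≤ 8r/ε, as 2π < 7 and ε ≤ r.
    set h : ℝ := ε / (2 * r) with hh
    have hh0 : 0 < h := by positivity
    set N : ℕ := ⌊Real.pi / h⌋₊ + 1 with hN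
    refine ⟨Fin N × ι, inferInstance, fun p => polar j (p.1 * h) * s p.2, ?_, fun x => ?_⟩
    · rw [Finset.card_insert_of_notMem hj, pow_succ', Fintype.card_prod, Fintype.card_fin,
        Nat.cast_mul]
      refine mul_le_mul ?_ hcard (by positivity) (by positivity)
      have h1 : (⌊Real.pi / h⌋₊ : ℝ) ≤ Real.pi / h := Nat.floor_le (by positivity)
      have h2 : Real.pi / h = 2 * Real.pi * r / ε := by rw [hh]; field_simp
      have h3 : 1 ≤ r / ε := by rwa [one_le_div hε]
      have h4 : 2 * Real.pi * r / ε ≤ 7 * (r / ε) := by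
        rw [mul_div_assoc]
        exact mul_le_mul_of_nonneg_right (by linarith [Real.pi_lt_d2]) (by positivity)
      rw [hN, Nat.cast_add, Nat.cast_one, mul_div_assoc]
      linarith
    · refine (hs x).trans ?_
      rw [Fintype.sum_prod_type_right]
      refine Finset.sum_le_sum fun i _ => ?_
      set y := rotSphere (s i) x with hy
      have hgc : Continuous fun t : ℝ => (rotSphere (polar j t) y : EuclideanSpace ℝ (Fin (d + 1))) j.castSucc :=
        continuous_iff_continuousAt.2 fun t => (hasDerivAt_polar j y t).continuousAt
      -- A half turn changes the sign of the j-th coordinate, so it vanishes for some angle in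
      -- between. The coordinates in T are not affected.
      have hzero : ∃ t ∈ Set.Icc 0 Real.pi,
          (rotSphere (polar j t) y : EuclideanSpace ℝ (Fin (d + 1))) j.castSucc = 0 := by
        have h0 : (rotSphere (polar j 0) y : EuclideanSpace ℝ (Fin (d + 1))) j.castSucc
          = (y : EuclideanSpace ℝ (Fin (d + 1))) j.castSucc := by rw [polar_apply_self]; simp
        have hπ : (rotSphere (polar j Real.pi) y : EuclideanSpace ℝ (Fin (d + 1))) j.castSucc
          = -(y : EuclideanSpace ℝ (Fin (d + 1))) j.castSucc := by rw [polar_apply_self]; simp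
        have hm := intermediate_value_uIcc (a := 0) (b := Real.pi) hgc.continuousOn
        rw [Set.uIcc_of_le Real.pi_pos.le] at hm
        have h00 : (0 : ℝ) ∈ Set.uIcc
            ((rotSphere (polar j 0) y : EuclideanSpace ℝ (Fin (d + 1))) j.castSucc)
            ((rotSphere (polar j Real.pi) y : EuclideanSpace ℝ (Fin (d + 1))) j.castSucc) := by
          rw [h0, hπ, Set.mem_uIcc]
          rcases le_total 0 ((y : EuclideanSpace ℝ (Fin (d + 1))) j.castSucc) with h | h
          · exact Or.inr ⟨by linarith, h⟩
          · exact Or.inl ⟨h, by linarith⟩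
        obtain ⟨t, ht, h⟩ := hm h00
        exact ⟨t, ht, h⟩
      obtain ⟨t, ht, ht0⟩ := hzero
      have hfl : ⌊t / h⌋₊ < N := by
        rw [hN, Nat.lt_succ_iff]
        exact Nat.floor_le_floor (div_le_div_of_nonneg_right ht.2 hh0.le)
      refine le_trans ?_ (Finset.single_le_sum (f := fun k : Fin N =>
        cut r ε (insert j T) (rotSphere (polar j (k * h) * s i) x) ^ 2) (fun _ _ => sq_nonneg _)
        (Finset.mem_univ ⟨⌊t / h⌋₊, hfl⟩))
      have h1 : |(⌊t / h⌋₊ : ℝ) * h - t| ≤ h := by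
        have h2 := Nat.floor_le (div_nonneg ht.1 hh0.le)
        have h3 := Nat.lt_floor_add_one (t / h)
        rw [le_div_iff₀ hh0] at h2
        rw [div_lt_iff₀ hh0] at h3
        rw [abs_le]
        constructor <;> linarith
      have h2 := abs_polar_sub_le j y t ((⌊t / h⌋₊ : ℝ) * h)
      rw [ht0, sub_zero] at h2
      have h3 : r * h = ε / 2 := by rw [hh]; field_simp
      have h4 := mul_le_mul_of_nonneg_left h1 hr.le
      rw [rotSphere_mul, ← hy, cut_insert _ hj, cut_polar hj, bump_eq_one hε (by linarith), one_mul]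

end EuclideanCover

end

noncomputable section

namespace EuclideanCover

open Topology MeasureTheory

/-! ### Quadratic forms of a functional calculus -/

theorem continuous_comp_family {X : Type*} [TopologicalSpace X] (p : C(X, ℝ)) {R : ℝ → C(X, X)}
    (hR : Continuous fun z : ℝ × X => R z.1 z.2) : Continuous fun t => p.comp (R t) :=
  ContinuousMap.continuous_of_continuous_uncurry _ (p.continuous.comp hR)

section Calculus

variable {X : Type*} [TopologicalSpace X] [CompactSpace X]
  {H : Type*} [NormedAddCommGroup H] [InnerProductSpace ℂ H] [CompleteSpace H]

/-- Real functions as complex functions. -/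
def toC (p : C(X, ℝ)) : C(X, ℂ) := ⟨fun x => (p x : ℂ), by fun_prop⟩

theorem toC_mul (p q : C(X, ℝ)) : toC (p * q) = toC p * toC q := by
  ext x
  exact Complex.ofReal_mul _ _

theorem star_toC (p : C(X, ℝ)) : star (toC p) = toC p := by
  ext x
  exact Complex.conj_ofReal _

theorem norm_toC_le (p : C(X, ℝ)) : ‖toC p‖ ≤ ‖p‖ := by
  refine (ContinuousMap.norm_le _ (norm_nonneg p)).2 fun x => ?_
  change ‖(p x : ℂ)‖ ≤ _
  rw [Complex.norm_real]
  exact p.norm_coe_le_norm x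

variable (Φ : C(X, ℂ) →⋆ₐ[ℂ] (H →L[ℂ] H))

/-- The functional `p ↦ ⟨w, Φ(p) w⟩` on real functions. -/
def quadForm (w : H) : C(X, ℝ) →L[ℝ] ℝ :=
  LinearMap.mkContinuous
    { toFun := fun p => (inner ℂ w (Φ (toC p) w)).re
      map_add' := fun p q => by
        have : toC (p + q) = toC p + toC q := by
          ext x
          exact Complex.ofReal_add _ _
        rw [this, map_add, add_apply, inner_add_right, Complex.add_re]
      map_smul' := fun c p => by
        have : toC (c • p) = (c : ℂ) • toC p := by
          ext x
          exact Complex.ofReal_mul _ _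
        rw [this, map_smul, smul_apply, inner_smul_right, Complex.re_ofReal_mul]
        rfl } (‖w‖ * ‖w‖) (fun p => by
    have h1 : ‖Φ (toC p)‖ ≤ ‖p‖ := (NonUnitalStarAlgHom.norm_apply_le Φ _).trans (norm_toC_le p)
    calc ‖(inner ℂ w (Φ (toC p) w)).re‖ ≤ ‖inner ℂ w (Φ (toC p) w)‖ := Complex.abs_re_le_norm _
      _ ≤ ‖w‖ * ‖Φ (toC p) w‖ := norm_inner_le_norm _ _
      _ ≤ ‖w‖ * (‖p‖ * ‖w‖) := by
        gcongr
        exact ((Φ (toC p)).le_opNorm w).trans (by gcongr)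
      _ = ‖w‖ * ‖w‖ * ‖p‖ := by ring)

theorem quadForm_apply (w : H) (p : C(X, ℝ)) :
    quadForm Φ w p = (inner ℂ w (Φ (toC p) w)).re := rfl

theorem norm_calculus_sq (p : C(X, ℝ)) (w : H) : ‖Φ (toC p) w‖ ^ 2 = quadForm Φ w (p * p) := by
  rw [quadForm_apply, toC_mul, map_mul, mul_apply_eq_comp]
  nth_rewrite 2 [← star_toC]
  rw [map_star, ContinuousLinearMap.star_eq_adjoint, ContinuousLinearMap.adjoint_inner_right,
    inner_self_eq_norm_sq_to_K]
  norm_cast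

theorem quadForm_nonneg (w : H) {p : C(X, ℝ)} (hp : ∀ x, 0 ≤ p x) : 0 ≤ quadForm Φ w p := by
  let q : C(X, ℝ) := ⟨fun x => √(p x), by fun_prop⟩
  have h : p = q * q := by
    ext x
    exact (Real.mul_self_sqrt (hp x)).symm
  rw [h, ← norm_calculus_sq]
  positivity

theorem quadForm_mono (w : H) {p q : C(X, ℝ)} (h : ∀ x, p x ≤ q x) :
    quadForm Φ w p ≤ quadForm Φ w q := by
  rw [← sub_nonneg, ← map_sub]
  exact quadForm_nonneg Φ w fun x => sub_nonneg.2 (h x)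

theorem quadForm_one (w : H) : quadForm Φ w 1 = ‖w‖ ^ 2 := by
  have h : (1 : C(X, ℝ)) = 1 * 1 := (mul_one 1).symm
  have h1 : toC (1 : C(X, ℝ)) = 1 := by
    ext x
    exact Complex.ofReal_one
  rw [h, ← norm_calculus_sq, h1, map_one, one_apply_eq_self]

/-- ‖Φ(p)w‖² is a positive functional of p², so pointwise domination of functions becomes domination
of norms for each single vector. -/
theorem norm_calculus_le {p q : C(X, ℝ)} {κ : ℝ} (hκ : 0 ≤ κ) (h : ∀ x, |p x| ≤ κ * |q x|) (w : H) :
    ‖Φ (toC p) w‖ ≤ κ * ‖Φ (toC q) w‖ := by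
  refine le_of_sq_le_sq ?_ (by positivity)
  have e : κ ^ 2 * quadForm Φ w (q * q) = quadForm Φ w (κ ^ 2 • (q * q)) :=
    ((quadForm Φ w).map_smul _ _).symm
  rw [mul_pow, norm_calculus_sq, norm_calculus_sq, e]
  refine quadForm_mono Φ w fun x => ?_
  have h1 := pow_le_pow_left₀ (abs_nonneg _) (h x) 2
  rw [sq_abs, mul_pow, sq_abs] at h1
  simp only [ContinuousMap.smul_apply, smul_eq_mul, ← sq]
  exact h1

/-- The functional is continuous, hence commutes with the integral of a continuous family, and it is
positive. Only a pointwise inequality for the averaged functions is required. -/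
theorem quadForm_integral_le {F : ℝ → C(X, ℝ)} (hF : Continuous F) {q : C(X, ℝ)} {δ : ℝ}
    (h : ∀ x, ∫ t in (0 : ℝ)..δ, F t x ≤ q x) (w : H) :
    ∫ t in (0 : ℝ)..δ, quadForm Φ w (F t) ≤ quadForm Φ w q := by
  have h1 : ∫ t in (0 : ℝ)..δ, quadForm Φ w (F t) = quadForm Φ w (∫ t in (0 : ℝ)..δ, F t) :=
    (quadForm Φ w).intervalIntegral_comp_comm (hF.intervalIntegrable _ _)
  rw [h1]
  refine quadForm_mono Φ w fun x => ?_
  have h2 : ∫ t in (0 : ℝ)..δ, F t x = (∫ t in (0 : ℝ)..δ, F t) x :=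
    (ContinuousMap.evalCLM ℝ x).intervalIntegral_comp_comm (hF.intervalIntegrable 0 δ)
  exact h2.symm.trans_le (h x)

end Calculus

/-! ### A one-dimensional Sobolev inequality -/

/-- Integrate the derivative of (δ - t)‖u(t)‖², which vanishes at t = δ and equals δ‖u(0)‖² at t =
0, and use 2⟨u, u'⟩ ≥ -(‖u‖² + ‖u'‖²). -/
theorem sobolev_interval {H : Type*} [NormedAddCommGroup H] [InnerProductSpace ℂ H] {u u' : ℝ → H}
    (hu : ∀ t, HasDerivAt u (u' t) t) (hu' : Continuous u') {δ : ℝ} (hδ : 0 ≤ δ) :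
    δ * ‖u 0‖ ^ 2 ≤ (1 + δ) * (∫ t in (0 : ℝ)..δ, ‖u t‖ ^ 2) + δ * ∫ t in (0 : ℝ)..δ, ‖u' t‖ ^ 2 := by
  let _ : InnerProductSpace ℝ H := InnerProductSpace.rclikeToReal ℂ H
  have huc : Continuous u := continuous_iff_continuousAt.2 fun t => (hu t).continuousAt
  have h1 : ∀ t, HasDerivAt (fun t => (δ - t) * ‖u t‖ ^ 2)
      (-‖u t‖ ^ 2 + (δ - t) * (2 * inner ℝ (u t) (u' t))) t := by
    intro t
    have h2 := ((hasDerivAt_const t δ).sub (hasDerivAt_id t)).mul (hu t).norm_sq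
    refine h2.congr_deriv ?_
    simp
  have hc : Continuous fun t => -‖u t‖ ^ 2 + (δ - t) * (2 * inner ℝ (u t) (u' t)) := by fun_prop
  have h2 := intervalIntegral.integral_eq_sub_of_hasDerivAt (a := 0) (b := δ) (fun t _ => h1 t)
    (hc.intervalIntegrable _ _)
  have h3 : -∫ t in (0 : ℝ)..δ, (-‖u t‖ ^ 2 + (δ - t) * (2 * inner ℝ (u t) (u' t)))
      ≤ ∫ t in (0 : ℝ)..δ, ((1 + δ) * ‖u t‖ ^ 2 + δ * ‖u' t‖ ^ 2) := by
    rw [← intervalIntegral.integral_neg]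
    refine intervalIntegral.integral_mono_on hδ (hc.neg.intervalIntegrable _ _)
      (Continuous.intervalIntegrable (by fun_prop) _ _) fun t ht => ?_
    have h4 := abs_le.1 (abs_real_inner_le_norm (u t) (u' t))
    have h5 := two_mul_le_add_sq ‖u t‖ ‖u' t‖
    have h6 : 0 ≤ δ - t := by linarith [ht.2]
    have h7 : (δ - t) * -(2 * inner ℝ (u t) (u' t)) ≤ δ * (‖u t‖ ^ 2 + ‖u' t‖ ^ 2) :=
      (mul_le_mul_of_nonneg_left (by linarith) h6).trans
        (mul_le_mul_of_nonneg_right (by linarith [ht.1]) (by positivity))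
    linarith
  rw [h2, intervalIntegral.integral_add (Continuous.intervalIntegrable (by fun_prop) _ _)
    (Continuous.intervalIntegrable (by fun_prop) _ _), intervalIntegral.integral_const_mul,
    intervalIntegral.integral_const_mul] at h3
  simpa using h3

/-! ### Localization of smooth vectors near a point of the sphere -/

section Localization

variable {d : ℕ} {H : Type*} [NormedAddCommGroup H] [InnerProductSpace ℂ H] [CompleteSpace H]
  {U : UnitaryRep (EucCover (d + 1)) H} {r : ℝ}
  {Φ : C(PosSphere d r, ℂ) →⋆ₐ[ℂ] (H →L[ℂ] H)}
  (hΦ : ∀ (s : Spin (d + 1)) f w,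
    U.op (inSpin s) (Φ (f.comp (rotSphere s)) w) = Φ f (U.op (inSpin s) w))

include hΦ in
theorem norm_calculus_op_sq (s : Spin (d + 1)) (p : C(PosSphere d r, ℝ)) (w : H) :
    ‖Φ (toC p) (U.op (inSpin s) w)‖ ^ 2
      = quadForm Φ w ((p * p).comp (rotSphere s)) := by
  have h : (p * p).comp (rotSphere s) = p.comp (rotSphere s) * p.comp (rotSphere s) := rfl
  rw [← hΦ, U.norm_op, h, ← norm_calculus_sq]
  rfl

include hΦ in
theorem integral_norm_calculus_sq_le (j : Fin d) {p q : C(PosSphere d r, ℝ)} {κ δ : ℝ}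
    (h : ∀ x, ∫ t in (0 : ℝ)..δ, (p (rotSphere (polar j t) x)) ^ 2 ≤ κ * q x ^ 2) (w : H) :
    ∫ t in (0 : ℝ)..δ, ‖Φ (toC p) (U.op (inSpin (polar j t)) w)‖ ^ 2 ≤ κ * ‖Φ (toC q) w‖ ^ 2 := by
  simp only [norm_calculus_op_sq hΦ]
  have hF : Continuous fun t : ℝ => (p * p).comp (rotSphere (polar j t)) :=
    continuous_comp_family _ (continuous_rotSphere
      (f := fun z : ℝ × PosSphere d r => polar j z.1)
      ((continuous_polar j).comp continuous_fst) continuous_snd)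
  have e : κ * quadForm Φ w (q * q) = quadForm Φ w (κ • (q * q)) :=
    ((quadForm Φ w).map_smul _ _).symm
  rw [norm_calculus_sq, e]
  refine quadForm_integral_le Φ hF (fun x => ?_) w
  have h1 := h x
  simp only [ContinuousMap.comp_apply, ContinuousMap.smul_apply,
    smul_eq_mul, ← sq]
  exact h1

include hΦ in
/-- Exchanging a narrow cut-off in one coordinate for a wide one. -/
theorem norm_calculus_cut_sq_le (hr : 0 < r) {ε η δ : ℝ} (hε : 0 < ε) (hδ : 0 < δ)
    (hη : d * η ^ 2 ≤ 3 / 4 * r ^ 2) (hεδ : ε + δ * r ≤ η / 2) {T : Finset (Fin d)} {j : Fin d}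
    (hj : j ∉ T) (w : U.smooth) :
    ‖Φ (toC (cut r ε Tᶜ * cut r η T)) w‖ ^ 2 ≤ 8 * (1 + δ) / (r * δ) * ε *
      (‖Φ (toC (cut r ε (insert j T)ᶜ * cut r η (insert j T))) w‖ ^ 2
        + ‖Φ (toC (cut r ε (insert j T)ᶜ * cut r η (insert j T)))
          (U.dRep (rotParam j.castSucc (Fin.last d)) w : U.smooth)‖ ^ 2) := by
  set p := cut r ε Tᶜ * cut r η T
  set q := cut r ε (insert j T)ᶜ * cut r η (insert j T)
  set φ := rotParam j.castSucc (Fin.last d)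
  have hpol : ∀ t : ℝ, inSpin (polar j t) = φ (Multiplicative.ofAdd t) := fun t =>
    (rotParam_ofAdd _ t).symm
  -- The Sobolev inequality is applied to this orbit. By covariance the integrals on its right side
  -- average the narrow cut-off over small rotations, which costs a factor ε.
  have hder : ∀ t : ℝ, HasDerivAt (fun t : ℝ => Φ (toC p) (U.op (inSpin (polar j t)) w))
      (Φ (toC p) (U.op (inSpin (polar j t)) (U.dRep φ w : U.smooth))) t := by
    intro t
    simp only [hpol]
    exact ((Φ (toC p)).restrictScalars ℝ).hasFDerivAt.comp_hasDerivAt t (U.op_hasDerivAt φ w t)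
  have hcont : Continuous fun t : ℝ => Φ (toC p) (U.op (inSpin (polar j t)) (U.dRep φ w : U.smooth)) := by
    simp only [hpol]
    exact (Φ (toC p)).continuous.comp ((U.continuous_op _).comp φ.continuous_ofAdd)
  have h1 := sobolev_interval hder hcont hδ.le
  have h2 := integral_norm_calculus_sq_le hΦ j
    (integral_cut_sq_le hr hε hδ.le hη hεδ hj)
  have h3 := h2 (w : H)
  have h4 := h2 (U.dRep φ w : U.smooth)
  rw [hpol, φ.map_ofAdd_zero, U.op_one] at h1
  set a := ‖Φ (toC q) w‖ ^ 2
  set b := ‖Φ (toC q) (U.dRep φ w : U.smooth)‖ ^ 2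
  have ha : 0 ≤ a := sq_nonneg _
  have hb : 0 ≤ b := sq_nonneg _
  have h5 : δ * ‖Φ (toC p) w‖ ^ 2 ≤ (1 + δ) * (8 * ε / r * a) + (1 + δ) * (8 * ε / r * b) := by
    refine h1.trans (add_le_add (mul_le_mul_of_nonneg_left h3 (by positivity)) ?_)
    refine mul_le_mul (by linarith) h4 ?_ (by positivity)
    exact intervalIntegral.integral_nonneg hδ.le fun t _ => sq_nonneg _
  have h6 : 8 * (1 + δ) / (r * δ) * ε * (a + b)
      = ((1 + δ) * (8 * ε / r * a) + (1 + δ) * (8 * ε / r * b)) / δ := by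
    field_simp
  rw [h6, le_div_iff₀ hδ, mul_comm]
  exact h5

include hΦ in
-- A Sobolev estimate in the d directions transverse to the pole, with a constant independent of ε.
-- T collects the coordinates whose narrow cut-off has been exchanged for a wide one; each exchange
-- gains a factor ε in the squared norm at the price of at most one more rotation generator in the
-- words. In the end only wide cut-offs remain, on which Φ is a contraction.
theorem exists_norm_calculus_cut_le (hr : 0 < r) :
    ∃ (S : Finset (List (OneParam (EucCover (d + 1))))) (C ε₀ : ℝ), 0 ≤ C ∧ 0 < ε₀ ∧
      ∀ ε, 0 < ε → ε ≤ ε₀ → ∀ w : U.smooth, ‖Φ (toC (cut r ε Finset.univ)) w‖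
        ≤ C * √(ε ^ d) * ∑ L ∈ S, ‖(((L.map U.dRep).prod w : U.smooth) : H)‖ := by
  classical
  -- The scales needed for the averaging estimate: (d + 1)η = r/2 gives dη² ≤ r²/4, and δr = η/4
  -- together with ε ≤ η/4 gives ε + δr ≤ η/2.
  set η : ℝ := r / (2 * (d + 1)) with hη
  have hη0 : 0 < η := by positivity
  have hηd : d * η ^ 2 ≤ 3 / 4 * r ^ 2 := by
    have h1 : (d + 1 : ℝ) * η = r / 2 := by rw [hη]; field_simp
    have h2 : (d : ℝ) * η ^ 2 ≤ ((d + 1 : ℝ) * η) ^ 2 := by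
      rw [mul_pow]
      refine mul_le_mul_of_nonneg_right ?_ (sq_nonneg _)
      nlinarith [(Nat.cast_nonneg d : (0 : ℝ) ≤ d)]
    rw [h1] at h2
    nlinarith [sq_nonneg r]
  set δ : ℝ := η / (4 * r) with hδ
  have hδ0 : 0 < δ := by positivity
  have hδr : δ * r = η / 4 := by rw [hδ]; field_simp
  set K : ℝ := 8 * (1 + δ) / (r * δ) with hK
  have hK0 : 0 ≤ K := by positivity
  have key : ∀ T : Finset (Fin d), ∃ (S : Finset (List (OneParam (EucCover (d + 1))))),
      ∀ ε, 0 < ε → ε ≤ η / 4 → ∀ w : U.smooth, ‖Φ (toC (cut r ε Finset.univ)) w‖ ^ 2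
        ≤ (2 * K * ε) ^ T.card * ∑ L ∈ S,
          ‖Φ (toC (cut r ε Tᶜ * cut r η T)) ((L.map U.dRep).prod w : U.smooth)‖ ^ 2 := by
    intro T
    induction T using Finset.induction_on with
    | empty =>
      refine ⟨{[]}, fun ε _ _ w => ?_⟩
      have h : cut r ε (∅ : Finset (Fin d))ᶜ * cut r η ∅ = cut r ε (Finset.univ : Finset (Fin d)) := by
        ext x
        simp [cut_apply]
      rw [h]
      simp
    | insert j T hj ih =>
      obtain ⟨S, hS⟩ := ih
      refine ⟨S ∪ S.image fun L => rotParam j.castSucc (Fin.last d) :: L, fun ε hε hε' w => ?_⟩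
      refine (hS ε hε hε' w).trans ?_
      rw [Finset.card_insert_of_notMem hj, pow_succ, mul_assoc ((2 * K * ε) ^ T.card)]
      refine mul_le_mul_of_nonneg_left ?_ (by positivity)
      set f : List (OneParam (EucCover (d + 1))) → ℝ := fun L =>
        ‖Φ (toC (cut r ε (insert j T)ᶜ * cut r η (insert j T))) ((L.map U.dRep).prod w : U.smooth)‖ ^ 2
        with hf
      have hf0 : ∀ L, 0 ≤ f L := fun L => sq_nonneg _
      have h1 : ∑ L ∈ S, f (rotParam j.castSucc (Fin.last d) :: L)
          = ∑ L ∈ S.image fun L => rotParam j.castSucc (Fin.last d) :: L, f L :=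
        (Finset.sum_image fun L _ L' _ h => List.cons_injective h).symm
      calc ∑ L ∈ S, ‖Φ (toC (cut r ε Tᶜ * cut r η T)) ((L.map U.dRep).prod w : U.smooth)‖ ^ 2
          ≤ ∑ L ∈ S, K * ε * (f L + f (rotParam j.castSucc (Fin.last d) :: L)) := by
            refine Finset.sum_le_sum fun L _ => ?_
            have h2 := norm_calculus_cut_sq_le hΦ hr hε hδ0 hηd (by rw [hδr]; linarith) hj
              ((L.map U.dRep).prod w)
            exact h2
        _ = K * ε * (∑ L ∈ S, f L + ∑ L ∈ S.image fun L => rotParam j.castSucc (Fin.last d) :: L, f L) := by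
            rw [← Finset.mul_sum, Finset.sum_add_distrib, h1]
        _ ≤ K * ε * (∑ L ∈ S ∪ S.image fun L => rotParam j.castSucc (Fin.last d) :: L, f L
            + ∑ L ∈ S ∪ S.image fun L => rotParam j.castSucc (Fin.last d) :: L, f L) := by
            refine mul_le_mul_of_nonneg_left (add_le_add ?_ ?_) (by positivity)
            · exact Finset.sum_le_sum_of_subset_of_nonneg Finset.subset_union_left fun L _ _ => hf0 L
            · exact Finset.sum_le_sum_of_subset_of_nonneg Finset.subset_union_right fun L _ _ => hf0 L
        _ = _ := by ring
  obtain ⟨S, hS⟩ := key Finset.univ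
  refine ⟨S, √((2 * K) ^ d), η / 4, Real.sqrt_nonneg _, by positivity, fun ε hε hε' w => ?_⟩
  have h1 := hS ε hε hε' w
  rw [Finset.card_univ, Fintype.card_fin, mul_pow] at h1
  have h2 : ∀ v : H, ‖Φ (toC (cut r ε (Finset.univ : Finset (Fin d))ᶜ * cut r η Finset.univ)) v‖ ≤ ‖v‖ := by
    intro v
    have h3 := norm_calculus_le Φ (κ := 1) zero_le_one (p := cut r ε (Finset.univ : Finset (Fin d))ᶜ * cut r η Finset.univ)
      (q := 1) (fun x => by
        rw [ContinuousMap.mul_apply, abs_of_nonneg (mul_nonneg (cut_nonneg _ _ _) (cut_nonneg _ _ _))]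
        have h5 : cut r ε (Finset.univ : Finset (Fin d))ᶜ x * cut r η Finset.univ x ≤ 1 :=
          mul_le_one₀ (cut_le_one _ _ x)
            (cut_nonneg _ _ x) (cut_le_one _ _ x)
        simpa using h5) v
    have h4 : toC (1 : C(PosSphere d r, ℝ)) = 1 := by
      ext x
      exact Complex.ofReal_one
    rwa [h4, map_one, one_mul] at h3
  refine le_of_sq_le_sq ?_ (by positivity)
  rw [mul_pow, mul_pow, Real.sq_sqrt (by positivity), Real.sq_sqrt (by positivity)]
  refine h1.trans (mul_le_mul_of_nonneg_left ?_ (by positivity))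
  refine (Finset.sum_le_sum fun L _ => pow_le_pow_left₀ (norm_nonneg _) (h2 _) 2).trans ?_
  exact Finset.sum_sq_le_sq_sum_of_nonneg fun L _ => norm_nonneg _

end Localization

end EuclideanCover

end

noncomputable section

namespace EuclideanCover

open Topology MeasureTheory Filter

/-! ### Existence of a generalized position eigenvector -/

section PoleCut

variable {d : ℕ} {r : ℝ}

/-- A function on the sphere concentrated near the pole `r e`. -/
def poleCut (r ε : ℝ) : C(PosSphere d r, ℝ) :=
  cut r ε Finset.univ * ⟨fun x => max 0 ((x : EuclideanSpace ℝ (Fin (d + 1))) (Fin.last d)) / r, by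
    fun_prop⟩

theorem poleCut_apply (ε : ℝ) (x : PosSphere d r) : poleCut r ε x = cut r ε Finset.univ x
    * (max 0 ((x : EuclideanSpace ℝ (Fin (d + 1))) (Fin.last d)) / r) := rfl

theorem abs_poleCut_le (hr : 0 < r) (ε : ℝ) (x : PosSphere d r) :
    |poleCut r ε x| ≤ 1 * |cut r ε Finset.univ x| := by
  rw [poleCut_apply, abs_mul, mul_comm]
  refine mul_le_mul_of_nonneg_right ?_ (abs_nonneg _)
  rw [abs_of_nonneg (by positivity), div_le_one hr]
  exact max_le hr.le ((le_abs_self _).trans (abs_apply_le x _))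

theorem sq_last_ge {ε : ℝ} (hε : 0 < ε) {x : PosSphere d r} (hx : cut r ε Finset.univ x ≠ 0) :
    r ^ 2 - d * ε ^ 2 ≤ (x : EuclideanSpace ℝ (Fin (d + 1))) (Fin.last d) ^ 2 := by
  have h1 := sum_sq_posSphere x
  have h2 : ∑ k : Fin d, (x : EuclideanSpace ℝ (Fin (d + 1))) k.castSucc ^ 2 ≤ ∑ _k : Fin d, ε ^ 2 := by
    refine Finset.sum_le_sum fun k _ => ?_
    have h3 := abs_le.1 (abs_lt_of_cut_ne_zero hε hx (Finset.mem_univ k)).le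
    exact sq_le_sq' h3.1 h3.2
  rw [Finset.sum_const, Finset.card_univ, Fintype.card_fin, nsmul_eq_mul] at h2
  linarith

/-- On the support of the cut-off function the coordinates are close to those of the pole. -/
theorem abs_poleCut_mul_le (hr : 0 < r) {ε : ℝ} (hε : 0 < ε) (hεr : ε ≤ r) (k : Fin (d + 1))
    (x : PosSphere d r) :
    |poleCut r ε x * ((x : EuclideanSpace ℝ (Fin (d + 1))) k - if k = Fin.last d then r else 0)|
      ≤ (1 + d) * ε * |poleCut r ε x| := by
  rw [abs_mul, mul_comm]
  by_cases h0 : poleCut r ε x = 0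
  · rw [h0]
    simp
  refine mul_le_mul_of_nonneg_right ?_ (abs_nonneg _)
  have hc : cut r ε Finset.univ x ≠ 0 := left_ne_zero_of_mul h0
  have hd : (0 : ℝ) ≤ d * ε := by positivity
  refine Fin.lastCases ?_ (fun k => ?_) k
  · rw [if_pos rfl]
    have h1 := sq_last_ge hε hc
    have h2 : max 0 ((x : EuclideanSpace ℝ (Fin (d + 1))) (Fin.last d)) ≠ 0 := by
      intro h
      apply h0
      rw [poleCut_apply, h, zero_div, mul_zero]
    have h3 : 0 < (x : EuclideanSpace ℝ (Fin (d + 1))) (Fin.last d) := by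
      by_contra! h
      exact h2 (max_eq_left h)
    have h4 := (le_abs_self _).trans (abs_apply_le x (Fin.last d))
    set y := (x : EuclideanSpace ℝ (Fin (d + 1))) (Fin.last d)
    rw [abs_of_nonpos (by linarith)]
    -- Since y > 0, (r - y)r ≤ (r - y)(r + y) = r² - y² ≤ dε².
    have h5 : (r - y) * r ≤ d * ε ^ 2 := by nlinarith
    have h6 : d * ε ^ 2 ≤ d * ε * r := by
      rw [sq, ← mul_assoc]
      exact mul_le_mul_of_nonneg_left hεr hd
    have h7 : r - y ≤ d * ε := le_of_mul_le_mul_right (h5.trans h6) hr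
    linarith
  · rw [if_neg (Fin.castSucc_lt_last k).ne, sub_zero]
    have := abs_lt_of_cut_ne_zero hε hc (Finset.mem_univ k)
    linarith

/-- The covering for `cut` sees both poles. A second copy, turned by π, exchanges them, and max(0,
z)² + max(0, -z)² = z² ≥ r²/2 on the support recovers half of the old lower bound. -/
theorem exists_rotations_poleCut (hd : 1 ≤ d) (hr : 0 < r) {ε : ℝ} (hε : 0 < ε) (hεr : ε ≤ r)
    (hεd : d * ε ^ 2 ≤ r ^ 2 / 2) :
    ∃ (ι : Type) (_ : Fintype ι) (s : ι → Spin (d + 1)),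
      (Fintype.card ι : ℝ) ≤ 2 * (8 * r / ε) ^ d ∧
      ∀ x : PosSphere d r, 1 / 2 ≤ ∑ i, poleCut r ε (rotSphere (s i) x) ^ 2 := by
  obtain ⟨ι, _, s, hcard, hs⟩ := exists_rotations_cover hr hε hεr (Finset.univ : Finset (Fin d))
  let j : Fin d := ⟨0, hd⟩
  refine ⟨ι ⊕ ι, inferInstance, Sum.elim s fun i => polar j Real.pi * s i, ?_, fun x => ?_⟩
  · rw [Finset.card_univ, Fintype.card_fin] at hcard
    rw [Fintype.card_sum, Nat.cast_add]
    linarith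
  · rw [Fintype.sum_sum_type, ← Finset.sum_add_distrib]
    simp only [Sum.elim_inl, Sum.elim_inr, rotSphere_mul]
    have h1 : (1 / 2 : ℝ) ≤ 1 / 2 * ∑ i, cut r ε Finset.univ (rotSphere (s i) x) ^ 2 := by
      linarith [hs x]
    refine h1.trans ?_
    rw [Finset.mul_sum]
    refine Finset.sum_le_sum fun i _ => ?_
    set y := rotSphere (s i) x
    have h2 : cut r ε Finset.univ (rotSphere (polar j Real.pi) y) = cut r ε Finset.univ y := by
      rw [cut_apply, cut_apply]
      refine Finset.prod_congr rfl fun k _ => ?_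
      by_cases hk : k = j
      · rw [hk, polar_apply_self, Real.cos_pi, Real.sin_pi, zero_mul, add_zero, neg_one_mul, bump_neg]
      · rw [polar_apply_of_ne hk]
    rw [poleCut_apply, poleCut_apply, h2, polar_apply_last, Real.cos_pi, Real.sin_pi, zero_mul,
      sub_zero, neg_one_mul]
    by_cases h0 : cut r ε Finset.univ y = 0
    · rw [h0]
      norm_num
    have h3 := sq_last_ge hε h0
    set z := (y : EuclideanSpace ℝ (Fin (d + 1))) (Fin.last d)
    have h4 : max 0 z ^ 2 + max 0 (-z) ^ 2 = z ^ 2 := by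
      rcases le_total 0 z with h | h
      · rw [max_eq_right h, max_eq_left (by linarith)]
        ring
      · rw [max_eq_left h, max_eq_right (by linarith)]
        ring
    have h5 : 1 / 2 ≤ z ^ 2 / r ^ 2 := by
      rw [le_div_iff₀ (by positivity)]
      linarith
    calc 1 / 2 * cut r ε Finset.univ y ^ 2 ≤ z ^ 2 / r ^ 2 * cut r ε Finset.univ y ^ 2 :=
          mul_le_mul_of_nonneg_right h5 (sq_nonneg _)
      _ = _ := by
          rw [← h4]
          ring

end PoleCut

section Existence

variable {d : ℕ} {H : Type*} [NormedAddCommGroup H] [InnerProductSpace ℂ H] [CompleteSpace H]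
  {U : UnitaryRep (EucCover (d + 1)) H} {ħ r : ℝ}

/-- Pigeonhole: the squared norms over all covering rotations add up to at least ‖w‖²/2, and there
are at most 2(8r/ε)ᵈ of them. The order εᵈ matches that of the Sobolev bound, so after division by
it the limit is finite and nonzero. -/
theorem exists_rotation_norm_ge {Φ : C(PosSphere d r, ℂ) →⋆ₐ[ℂ] (H →L[ℂ] H)}
    (hΦ : ∀ (s : Spin (d + 1)) f w,
      U.op (inSpin s) (Φ (f.comp (rotSphere s)) w) = Φ f (U.op (inSpin s) w))
    (hd : 1 ≤ d) (hr : 0 < r) {ε : ℝ} (hε : 0 < ε) (hεr : ε ≤ r) (hεd : d * ε ^ 2 ≤ r ^ 2 / 2) (w : H) :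
    ∃ s : Spin (d + 1), (4 * (8 * r) ^ d)⁻¹ * ε ^ d * ‖w‖ ^ 2
      ≤ ‖Φ (toC (poleCut r ε)) (U.op (inSpin s) w)‖ ^ 2 := by
  obtain ⟨ι, _, s, hcard, hs⟩ := exists_rotations_poleCut hd hr hε hεr hεd
  have h1 : 1 / 2 * ‖w‖ ^ 2 ≤ ∑ i, ‖Φ (toC (poleCut r ε)) (U.op (inSpin (s i)) w)‖ ^ 2 := by
    have e : 1 / 2 * quadForm Φ w 1 = quadForm Φ w ((1 / 2 : ℝ) • (1 : C(PosSphere d r, ℝ))) :=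
      ((quadForm Φ w).map_smul _ _).symm
    simp only [norm_calculus_op_sq hΦ]
    rw [← quadForm_one Φ, e, ← map_sum]
    refine quadForm_mono Φ w fun x => ?_
    rw [ContinuousMap.sum_apply]
    simp only [ContinuousMap.comp_apply, ContinuousMap.smul_apply,
      ContinuousMap.one_apply, smul_eq_mul, mul_one, ← sq]
    exact hs x
  have hne : (Finset.univ : Finset ι).Nonempty := by
    rw [Finset.univ_nonempty_iff]
    by_contra h
    rw [not_nonempty_iff] at h
    have hx : (EuclideanSpace.single (Fin.last d) r : EuclideanSpace ℝ (Fin (d + 1)))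
        ∈ Metric.sphere (0 : EuclideanSpace ℝ (Fin (d + 1))) r := by
      rw [mem_sphere_zero_iff_norm, PiLp.norm_single, Real.norm_of_nonneg hr.le]
    have := hs ⟨_, hx⟩
    rw [Finset.univ_eq_empty, Finset.sum_empty] at this
    norm_num at this
  have h2 : ∑ _i : ι, (4 * (8 * r) ^ d)⁻¹ * ε ^ d * ‖w‖ ^ 2 ≤ 1 / 2 * ‖w‖ ^ 2 := by
    rw [Finset.sum_const, Finset.card_univ, nsmul_eq_mul, ← mul_assoc]
    refine mul_le_mul_of_nonneg_right ?_ (sq_nonneg _)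
    refine (mul_le_mul_of_nonneg_right hcard (by positivity)).trans (le_of_eq ?_)
    rw [div_pow]
    field_simp
    norm_num
  obtain ⟨i, -, hi⟩ := Finset.exists_le_of_sum_le hne (h2.trans h1)
  exact ⟨s i, hi⟩

theorem exists_posEigenvector [Nontrivial H] (hd : 1 ≤ d) (hr : 0 < r)
    (hX : sqX (posOp ħ U) = ((r ^ 2 : ℝ) : ℂ) • (1 : Module.End ℂ U.smooth)) :
    ∃ ψ : U.smooth →ₗ⋆[ℂ] ℂ, IsPosEigenvector ħ r U ψ ∧ ∃ v, ψ v ≠ 0 := by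
  obtain ⟨Φ, hΦX, hΦ⟩ := exists_positionCalculus hd hr.le hX
  obtain ⟨S, C, ε₀, hC, hε₀, hbound⟩ := exists_norm_calculus_cut_le hΦ hr
  have := compactSpace_spin (n := d + 1) (by omega)
  -- a nonzero smooth vector
  obtain ⟨w₀, hw₀⟩ : ∃ w₀ : U.smooth, (w₀ : H) ≠ 0 := by
    by_contra! h
    obtain ⟨x, hx⟩ := exists_ne (0 : H)
    refine hx ((dense_smooth_eucCover hd U).eq_zero_of_inner_left ℂ fun w hw => ?_)
    have hw0 : w = 0 := h ⟨w, hw⟩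
    rw [hw0, inner_zero_right]
  -- the scales
  set ε₁ : ℝ := min ε₀ (r / (2 * (d + 1))) with hε₁
  have hε₁0 : 0 < ε₁ := lt_min hε₀ (by positivity)
  set ε : ℕ → ℝ := fun n => ε₁ / (n + 1) with hε
  have hεpos : ∀ n, 0 < ε n := fun n => by positivity
  have hεle : ∀ n, ε n ≤ ε₁ := fun n => div_le_self hε₁0.le (by
    have : (0 : ℝ) ≤ n := Nat.cast_nonneg n
    linarith)
  have hεd' : ∀ n, (d + 1 : ℝ) * ε n ≤ r / 2 := fun n => by
    have h1 := (hεle n).trans (min_le_right _ _)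
    have h2 := mul_le_mul_of_nonneg_left h1 (by positivity : (0 : ℝ) ≤ d + 1)
    refine h2.trans (le_of_eq ?_)
    field_simp
  have hd0 : (0 : ℝ) ≤ d := Nat.cast_nonneg d
  have hεr : ∀ n, ε n ≤ r := fun n => by nlinarith [hεd' n, hεpos n]
  have hεd : ∀ n, d * ε n ^ 2 ≤ r ^ 2 / 2 := fun n => by
    have h1 : d * ε n ≤ r / 2 := by nlinarith [hεd' n, hεpos n]
    have h2 := mul_le_mul h1 (hεr n) (hεpos n).le (by positivity)
    nlinarith
  set p : ℕ → C(PosSphere d r, ℝ) := fun n => poleCut r (ε n) with hp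
  choose s hs using fun n => exists_rotation_norm_ge hΦ hd hr (hεpos n) (hεr n) (hεd n) (w₀ : H)
  -- Sobolev bound
  set N : U.smooth → ℝ := fun u => C * ∑ L ∈ S, ‖(((L.map U.dRep).prod u : U.smooth) : H)‖ with hN
  have hN0 : ∀ u, 0 ≤ N u := fun u => by positivity
  -- Normalization: ‖Φ(p_n)u‖ is of order εᵈᐟ² both in the Sobolev bound and in the pigeonhole
  -- bound.
  set a : ℕ → ℝ := fun n => (√(ε n ^ d))⁻¹ with ha
  have hq : ∀ n, 0 < √(ε n ^ d) := fun n => Real.sqrt_pos.2 (pow_pos (hεpos n) _)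
  have ha0 : ∀ n, 0 < a n := fun n => inv_pos.2 (hq n)
  have haN : ∀ n u, a n * ‖Φ (toC (p n)) (u : U.smooth)‖ ≤ N u := by
    intro n u
    have h1 := norm_calculus_le Φ zero_le_one (abs_poleCut_le hr (ε n)) (u : H)
    rw [one_mul] at h1
    have h2 := h1.trans (hbound (ε n) (hεpos n) ((hεle n).trans (min_le_left _ _)) u)
    rw [ha, inv_mul_le_iff₀ (hq n)]
    refine h2.trans (le_of_eq ?_)
    rw [hN]
    ring
  -- the limit
  let F : Ultrafilter ℕ := hyperfilter ℕ
  have hF : (F : Filter ℕ) ≤ atTop := Nat.hyperfilter_le_atTop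
  -- The good rotation depends on n. Compactness of Spin gives a limit s₀, so that the single vector
  -- w = U(s₀)w₀ can be used for all n.
  obtain ⟨s₀, -, hs₀⟩ := (isCompact_univ (X := Spin (d + 1))).ultrafilter_le_nhds (F.map s) (by simp)
  have hs₀' : Tendsto s F (𝓝 s₀) := hs₀
  set w : U.smooth := U.smoothOp (inSpin s₀) w₀ with hw
  let B : ℕ → U.smooth → ℂ := fun n u =>
    ((a n ^ 2 : ℝ) : ℂ) * inner ℂ (Φ (toC (p n)) (u : H)) (Φ (toC (p n)) (w : H))
  have hB : ∀ n u, ‖B n u‖ ≤ a n * ‖Φ (toC (p n)) (u : H)‖ * N w := by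
    intro n u
    rw [norm_mul, Complex.norm_real, Real.norm_of_nonneg (sq_nonneg _)]
    calc a n ^ 2 * ‖inner ℂ (Φ (toC (p n)) (u : H)) (Φ (toC (p n)) (w : H))‖
        ≤ a n ^ 2 * (‖Φ (toC (p n)) (u : H)‖ * ‖Φ (toC (p n)) (w : H)‖) :=
          mul_le_mul_of_nonneg_left (norm_inner_le_norm _ _) (sq_nonneg _)
      _ = a n * ‖Φ (toC (p n)) (u : H)‖ * (a n * ‖Φ (toC (p n)) (w : H)‖) := by ring
      _ ≤ a n * ‖Φ (toC (p n)) (u : H)‖ * N w :=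
          mul_le_mul_of_nonneg_left (haN n w) (mul_nonneg (ha0 n).le (norm_nonneg _))
  have hBN : ∀ n u, ‖B n u‖ ≤ N u * N w := fun n u =>
    (hB n u).trans (mul_le_mul_of_nonneg_right (haN n u) (hN0 w))
  -- Bounded scalar sequences converge along an ultrafilter, for all u simultaneously; hence the
  -- limit is conjugate-linear and inherits the bound by seminorms.
  have hlim : ∀ u, ∃ z : ℂ, ‖z‖ ≤ N u * N w ∧ Tendsto (fun n => B n u) F (𝓝 z) := by
    intro u
    obtain ⟨z, hz, hz'⟩ := (isCompact_closedBall (0 : ℂ) (N u * N w)).ultrafilter_le_nhds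
      (F.map fun n => B n u) (by
        rw [le_principal_iff]
        refine mem_map.2 (Filter.Eventually.of_forall fun n : ℕ => ?_)
        simpa using hBN n u)
    exact ⟨z, by simpa using hz, hz'⟩
  choose z hz hzlim using hlim
  let ψ : U.smooth →ₗ⋆[ℂ] ℂ :=
    { toFun := z
      map_add' := fun u v => by
        refine tendsto_nhds_unique (hzlim (u + v)) (((hzlim u).add (hzlim v)).congr fun n => ?_)
        simp only [B, Submodule.coe_add, map_add, inner_add_left, mul_add]
      map_smul' := fun c u => by
        refine tendsto_nhds_unique (hzlim (c • u)) (((hzlim u).const_mul _).congr fun n => ?_)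
        simp only [B, Submodule.coe_smul, map_smul, inner_smul_left]
        ring }
  have hψ : ∀ u, ψ u = z u := fun _ => rfl
  refine ⟨ψ, ⟨⟨S, C * N w, fun u => (hz u).trans (le_of_eq ?_)⟩, fun k u => ?_⟩, w, ?_⟩
  · rw [hN]
    ring
  · -- the eigenvalue equations
    set lam : ℝ := if k = Fin.last d then r else 0 with hlam
    have hlam' : (if k = Fin.last d then (r : ℂ) else 0) = (lam : ℂ) := by
      rw [hlam]
      split_ifs <;> simp
    rw [hlam']
    -- Applying Φ(p_n) to (X_k - λ)u amounts to applying Φ(p_n g) to u, and g is O(ε_n) where p_n is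
    -- nonzero.
    let g : C(PosSphere d r, ℝ) := ⟨fun x => (x : EuclideanSpace ℝ (Fin (d + 1))) k - lam, by fun_prop⟩
    have hg : ∀ n, Φ (toC (p n)) ((posOp ħ U k u - (lam : ℂ) • u : U.smooth) : H)
        = Φ (toC (p n * g)) (u : H) := by
      intro n
      have h1 : toC g = coordC r k - (lam : ℂ) • 1 := by
        ext x
        change (((x : EuclideanSpace ℝ (Fin (d + 1))) k - lam : ℝ) : ℂ)
          = ((x : EuclideanSpace ℝ (Fin (d + 1))) k : ℂ) - (lam : ℂ) • 1
        simp
      rw [toC_mul, map_mul, h1, map_sub, map_smul, map_one, mul_apply_eq_comp,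
        sub_apply, hΦX]
      rfl
    have h0 : Tendsto (fun n => B n (posOp ħ U k u - (lam : ℂ) • u)) F (𝓝 0) := by
      have hε0 : Tendsto (fun n => (1 + d) * ε n * (N u * N w)) atTop (𝓝 0) := by
        have h1 : Tendsto ε atTop (𝓝 0) :=
          tendsto_const_nhds.div_atTop (tendsto_natCast_atTop_atTop.atTop_add tendsto_const_nhds)
        simpa using (h1.const_mul (1 + d : ℝ)).mul_const (N u * N w)
      refine squeeze_zero_norm (fun n => ?_) (hε0.mono_left hF)
      refine (hB n _).trans ?_
      rw [hg, ← mul_assoc ((1 + (d : ℝ)) * ε n)]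
      refine mul_le_mul_of_nonneg_right ?_ (hN0 w)
      have h2 := norm_calculus_le Φ (p := p n * g) (by have := hεpos n; positivity)
        (fun x => abs_poleCut_mul_le hr (hεpos n) (hεr n) k x) (u : H)
      calc a n * ‖Φ (toC (p n * g)) (u : H)‖
          ≤ a n * ((1 + d) * ε n * ‖Φ (toC (p n)) (u : H)‖) :=
            mul_le_mul_of_nonneg_left h2 (ha0 n).le
        _ = (1 + d) * ε n * (a n * ‖Φ (toC (p n)) (u : H)‖) := by ring
        _ ≤ (1 + d) * ε n * N u :=
            mul_le_mul_of_nonneg_left (haN n u) (by have := hεpos n; positivity)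
    have h1 := tendsto_nhds_unique (hzlim (posOp ħ U k u - (lam : ℂ) • u)) h0
    rw [← hψ, map_sub, LinearMap.map_smulₛₗ, Complex.conj_ofReal, smul_eq_mul] at h1
    exact sub_eq_zero.1 h1
  · -- the limit does not vanish
    set m : ℝ := √((4 * (8 * r) ^ d)⁻¹) * ‖(w₀ : H)‖ with hm
    have hm0 : 0 < m := mul_pos (Real.sqrt_pos.2 (by positivity)) (norm_pos_iff.2 hw₀)
    have hlow : ∀ n, m ≤ a n * ‖Φ (toC (p n)) (U.smoothOp (inSpin (s n)) w₀ : U.smooth)‖ := by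
      intro n
      rw [ha, ← div_eq_inv_mul, le_div_iff₀ (hq n)]
      refine le_of_sq_le_sq ?_ (norm_nonneg _)
      refine le_trans (le_of_eq ?_) (hs n)
      rw [hm, mul_pow, mul_pow, Real.sq_sqrt (by positivity),
        Real.sq_sqrt (pow_nonneg (hεpos n).le _)]
      ring
    -- Orbits are continuous in each seminorm, so by the Sobolev bound replacing U(s_n)w₀ by w
    -- changes the normalized norms by an amount tending to zero. Half of the lower bound survives.
    have hcont : Tendsto (fun n => N (U.smoothOp (inSpin (s n)) w₀ - w)) F (𝓝 0) := by
      have h1 : ∀ L : List (OneParam (EucCover (d + 1))), Tendsto (fun n =>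
          ‖(((L.map U.dRep).prod (U.smoothOp (inSpin (s n)) w₀ - w) : U.smooth) : H)‖) F (𝓝 0) := by
        intro L
        have h2 := (U.continuous_prod_dRep_smoothOp (isClosedEmbedding_linRep (by omega)) L w₀).tendsto
          (inSpin s₀)
        have hin : Continuous (inSpin : Spin (d + 1) → EucCover (d + 1)) :=
          continuous_to_cover continuous_const continuous_id
        have h3 := h2.comp ((hin.tendsto s₀).comp hs₀')
        have h4 := (h3.sub_const (((L.map U.dRep).prod w : U.smooth) : H)).norm
        rw [sub_self, norm_zero] at h4
        refine h4.congr fun n => ?_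
        rw [map_sub]
        rfl
      have h5 := (tendsto_finsetSum S fun L _ => h1 L).const_mul C
      rw [Finset.sum_const_zero, mul_zero] at h5
      exact h5
    have hev : ∀ᶠ n in F, m / 2 ≤ a n * ‖Φ (toC (p n)) (w : H)‖ := by
      filter_upwards [hcont.eventually (gt_mem_nhds (half_pos hm0))] with n hn
      have h1 := haN n (U.smoothOp (inSpin (s n)) w₀ - w)
      rw [Submodule.coe_sub, map_sub] at h1
      have h2 := norm_sub_norm_le (Φ (toC (p n)) (U.smoothOp (inSpin (s n)) w₀ : U.smooth))
        (Φ (toC (p n)) (w : H))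
      have h3 := mul_le_mul_of_nonneg_left h2 (ha0 n).le
      linarith [hlow n]
    have hre : (m / 2) ^ 2 ≤ (ψ w).re := by
      refine ge_of_tendsto ((Complex.continuous_re.tendsto _).comp (hzlim w)) ?_
      filter_upwards [hev] with n hn
      have h1 : (B n w).re = (a n * ‖Φ (toC (p n)) (w : H)‖) ^ 2 := by
        simp only [B]
        rw [Complex.re_ofReal_mul, mul_pow]
        exact congrArg _ (inner_self_eq_norm_sq (𝕜 := ℂ) _)
      change _ ≤ (B n w).re
      rw [h1]
      exact pow_le_pow_left₀ (by positivity) hn 2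
    intro h
    rw [h, Complex.zero_re] at hre
    have : 0 < (m / 2) ^ 2 := by positivity
    linarith

end Existence

end EuclideanCover

end

noncomputable section

namespace EuclideanCover

open Topology

/-! ### Action of the little group on generalized position eigenvectors -/

section LittleGroup

variable {d : ℕ} {H : Type*} [NormedAddCommGroup H] [InnerProductSpace ℂ H] [CompleteSpace H]
  {U : UnitaryRep (EucCover (d + 1)) H} {ħ r : ℝ}

namespace IsPosEigenvector

variable {ψ : U.smooth →ₗ⋆[ℂ] ℂ}

/-- With the position operators on the left, ψ replaces X_m by r for the last index and by 0
otherwise, so each sum keeps a single term. For k, l ≤ d the result is r² ψ ∘ J_kl; if k or l is the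
last index everything cancels. -/
theorem apply_opW (hψ : IsPosEigenvector ħ r U ψ) (hd : 1 ≤ d)
    (hX : sqX (posOp ħ U) = ((r ^ 2 : ℝ) : ℂ) • (1 : Module.End ℂ U.smooth))
    (k l : Fin (d + 1)) (v : U.smooth) :
    ψ (opW (posOp ħ U) (angOp ħ U) k l v) = (r : ℂ) ^ 2 * ψ (angOp ħ U k l v)
      - r * (if l = Fin.last d then (r : ℂ) else 0) * ψ (angOp ħ U k (Fin.last d) v)
      + r * (if k = Fin.last d then (r : ℂ) else 0) * ψ (angOp ħ U l (Fin.last d) v) := by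
  have h1 : ∀ a b : Fin (d + 1), ψ ((∑ m, posOp ħ U m * posOp ħ U b * angOp ħ U a m) v)
      = r * (if b = Fin.last d then (r : ℂ) else 0) * ψ (angOp ħ U a (Fin.last d) v) := by
    intro a b
    rw [LinearMap.sum_apply, map_sum]
    simp only [Module.End.mul_apply, hψ.2, ite_mul, zero_mul, Finset.sum_ite_eq', Finset.mem_univ,
      if_true]
    split_ifs <;> ring
  rw [(euclideanRelations_rep U hd ħ).W_eq_left, hX, LinearMap.add_apply, LinearMap.sub_apply,
    map_add, map_sub, h1, h1, smul_mul_assoc, one_mul, LinearMap.smul_apply,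
    LinearMap.map_smulₛₗ, Complex.conj_ofReal, Complex.ofReal_pow, smul_eq_mul]

theorem apply_angOp_swap (ψ : U.smooth →ₗ⋆[ℂ] ℂ) (hd : 1 ≤ d) (k l : Fin (d + 1)) (v : U.smooth) :
    ψ (angOp ħ U l k v) = -ψ (angOp ħ U k l v) := by
  rw [(euclideanRelations_rep U hd ħ).J_swap k l, LinearMap.neg_apply, map_neg]

theorem apply_angOp (hħ : ħ ≠ 0) (k l : Fin (d + 1)) (v : U.smooth) :
    ψ (angOp ħ U k l v) = 0 ↔ ψ (U.dRep (rotParam k l) v) = 0 := by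
  rw [angOp, LinearMap.smul_apply, LinearMap.map_smulₛₗ, smul_eq_mul, mul_eq_zero, or_iff_right]
  simp [hħ]

end IsPosEigenvector

theorem spinRotor_mem_littleGroup {k l : Fin (d + 1)} (h : k ≠ l) (hk : k ≠ Fin.last d)
    (hl : l ≠ Fin.last d) (t : ℝ) : spinRotor k l h t ∈ littleGroup d := by
  change spinRot _ _ = _
  rw [spinRot_spinRotor]
  simp [hk, hl]

/-- The rotations in this plane fix the pole, hence lie in the little group; differentiate the
invariance of ψ along them. -/
theorem IsPosEigenvector.apply_angOp_eq_zero {ψ : U.smooth →ₗ⋆[ℂ] ℂ}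
    (hψ : IsPosEigenvector ħ r U ψ) (hU : LittleGroupTrivial ħ r U) (hd : 1 ≤ d) (hħ : ħ ≠ 0)
    {k l : Fin (d + 1)} (hk : k ≠ Fin.last d) (hl : l ≠ Fin.last d) (v : U.smooth) :
    ψ (angOp ħ U k l v) = 0 := by
  by_cases h : k = l
  · subst h
    exact self_eq_neg.1 (apply_angOp_swap ψ hd k k v)
  · rw [apply_angOp hħ]
    refine UnitaryRep.IsDistribution.dRep_eq_zero (isClosedEmbedding_linRep (by omega)) hψ.1
      (fun t w => ?_) v
    have h1 := hU _ (inv_mem (spinRotor_mem_littleGroup h hk hl t)) ψ hψ w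
    rwa [map_inv, inv_inv, ← rotParam_ofAdd] at h1

/-- Every W_kl is annihilated by ψ on the left, hence so is C = c. One nonzero ψ then forces c = 0;
its existence is the substance of the argument. -/
theorem LittleGroupTrivial.opC_eq_zero (hU : LittleGroupTrivial ħ r U) (hirr : U.IsIrreducible)
    (hd : 1 ≤ d) (hħ : ħ ≠ 0) (hr : 0 < r)
    (hX : sqX (posOp ħ U) = ((r ^ 2 : ℝ) : ℂ) • (1 : Module.End ℂ U.smooth)) :
    opC (posOp ħ U) (angOp ħ U) = 0 := by
  have := hirr.1
  obtain ⟨ψ, hψ, v, hv⟩ := exists_posEigenvector hd hr hX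
  have hW : ∀ k l w, ψ (opW (posOp ħ U) (angOp ħ U) k l w) = 0 := by
    intro k l w
    have hs := IsPosEigenvector.apply_angOp_swap (ħ := ħ) ψ hd l k w
    rw [hψ.apply_opW hd hX]
    by_cases hk : k = Fin.last d
    · subst hk
      rw [if_pos rfl, hs]
      split_ifs with hl
      · subst hl
        rw [self_eq_neg.1 hs]
        ring
      · ring
    · rw [if_neg hk]
      split_ifs with hl
      · rw [hl]
        ring
      · rw [hψ.apply_angOp_eq_zero hU hd hħ hk hl]
        ring
  obtain ⟨c, hc⟩ := exists_opC_eq_smul hd hħ hirr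
  have h1 : ψ (opC (posOp ħ U) (angOp ħ U) v) = 0 := by
    simp only [opC, LinearMap.sum_apply, map_sum, sq, Module.End.mul_apply, hW,
      Finset.sum_const_zero]
  rw [hc, LinearMap.smul_apply, LinearMap.map_smulₛₗ, smul_eq_mul, Complex.conj_ofReal,
    Module.End.one_apply] at h1
  rw [hc, (mul_eq_zero.1 h1).resolve_right hv, zero_smul]

/-- W = 0 makes ψ vanish on the ranges of the J_kl with k, l ≤ d, so ψ is invariant under the rotors
of these planes, and those generate a group containing the little group. -/
theorem littleGroupTrivial_of_opW_eq_zero (hd : 2 ≤ d) (hħ : ħ ≠ 0) (hr : 0 < r)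
    (hX : sqX (posOp ħ U) = ((r ^ 2 : ℝ) : ℂ) • (1 : Module.End ℂ U.smooth))
    (hW : ∀ k l, opW (posOp ħ U) (angOp ħ U) k l = 0) : LittleGroupTrivial ħ r U := by
  intro s hs ψ hψ v
  have hlast : ∀ {k : Fin (d + 1)}, (k : ℕ) < d → k ≠ Fin.last d := by
    rintro k hk rfl
    exact hk.ne rfl
  have key : ∀ g ∈ rotorGroup (d + 1) d, ∀ w, ψ (U.smoothOp (inSpin g) w) = ψ w := by
    intro g hg
    refine Subgroup.closure_induction (fun g hg w => ?_) (fun w => ?_) (fun a b _ _ ha hb w => ?_)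
      (fun a _ ha w => ?_) hg
    · obtain ⟨k, l, h, t, hk, hl, rfl⟩ := hg
      rw [← rotParam_ofAdd]
      refine UnitaryRep.IsDistribution.invariant (isClosedEmbedding_linRep (by omega)) hψ.1
        (fun u => ?_) t w
      have h1 := hψ.apply_opW (by omega) hX k l u
      rw [hW, LinearMap.zero_apply, map_zero, if_neg (hlast hk), if_neg (hlast hl), mul_zero,
        zero_mul, zero_mul, sub_zero, add_zero, eq_comm, mul_eq_zero] at h1
      exact (IsPosEigenvector.apply_angOp hħ k l u).1
        (h1.resolve_left (pow_ne_zero 2 (Complex.ofReal_ne_zero.2 hr.ne')))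
    · rw [map_one, UnitaryRep.smoothOp_one, Module.End.one_apply]
    · rw [map_mul, UnitaryRep.smoothOp_mul, Module.End.mul_apply, ha, hb]
    · rw [map_inv, ← ha, ← Module.End.mul_apply, UnitaryRep.smoothOp_mul_inv, Module.End.one_apply]
  rw [← map_inv]
  exact key _ (inv_mem (littleGroup_le_rotorGroup hd hs)) v

end LittleGroup

end EuclideanCover

end

theorem mainTheorem6 {d : ℕ} (hd : 2 ≤ d) {ħ r : ℝ} (hħ : 0 < ħ) (hr : 0 < r)
    {H : Type*} [NormedAddCommGroup H] [InnerProductSpace ℂ H] [CompleteSpace H]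
    (U : UnitaryRep (EucCover (d + 1)) H) (hU : U.IsIrreducible)
    (hX : sqX (posOp ħ U) = ((r ^ 2 : ℝ) : ℂ) • (1 : Module.End ℂ U.smooth)) :
    -- the little group acts trivially iff the constraint holds
    (LittleGroupTrivial ħ r U ↔
      ∀ k l : Fin (d + 1),
        sqX (posOp ħ U) * angOp ħ U k l =
          ∑ m, angOp ħ U k m * posOp ħ U m * posOp ħ U l -
            ∑ m, angOp ħ U l m * posOp ħ U m * posOp ħ U k) ∧
    -- `C` is a Casimir element, and it acts as a scalar
    opC (ueaX ħ) (ueaJ ħ) ∈ Subalgebra.center ℂ (EucUEA (d + 1)) ∧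
    (∃ c : ℝ, opC (posOp ħ U) (angOp ħ U) = (c : ℂ) • (1 : Module.End ℂ U.smooth)) ∧
    -- every `W_{kl}` is self-adjoint
    (∀ k l : Fin (d + 1), IsSelfAdjointOp U (opW (posOp ħ U) (angOp ħ U) k l)) ∧
    -- `C` vanishes exactly when the little group acts trivially
    (opC (posOp ħ U) (angOp ħ U) = 0 ↔ LittleGroupTrivial ħ r U) := by
  have hd1 : 1 ≤ d := by omega
  have hW := opC_eq_zero_iff (U := U) hd1 ħ
  have hC : opC (posOp ħ U) (angOp ħ U) = 0 ↔ LittleGroupTrivial ħ r U :=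
    ⟨fun h => littleGroupTrivial_of_opW_eq_zero hd hħ.ne' hr hX (hW.1 h),
      fun h => h.opC_eq_zero hU hd1 hħ.ne' hr hX⟩
  refine ⟨?_, opC_uea_mem_center hħ.ne', exists_opC_eq_smul hd1 hħ.ne' hU,
    fun k l => isSelfAdjointOp_opW hd1 hħ.ne' hU k l, hC⟩
  -- Through C = 0 ⇔ all W_kl = 0, the constraint is the equation W_kl = 0 with the sums moved to
  -- the other side.
  rw [← hC, hW]
  refine forall₂_congr fun k l => ?_
  rw [opW, sub_add, sub_eq_zero]
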